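/- Let $\Lambda=2\omega_1\mathbb Z+2\omega_2\mathbb Z\subset\mathbb C$ be a lattice, $\sigma$ its Weierstrass sigma function, $\zeta_W=\sigma'/\sigma$. Let $\eta\in\mathbb C\setminus\Lambda$, $\lambda\in\mathbb C\setminus\{0\}$, $N\ge 1$, and let $x_i^m$ ($m\in\mathbb Z$, $1\le i\le N$) be complex numbers in generic position: $x_i^m-x_j^m\notin\Lambda\cup(\pm\eta+\Lambda)$ for $i\ne j$, and $x_i^{m+1}-x_j^m\notin\Lambda\cup(-\eta+\Lambda)$ for all $i,j$. Put $\tau^m(x)=\prod_{i=1}^N\sigma(x-x_i^m)$ and consider $$\psi^m(x+\eta)-\lambda\,\frac{\tau^m(x)\,\tau^{m+1}(x+\eta)}{\tau^{m+1}(x)\,\tau^m(x+\eta)}\,\psi^m(x)=\psi^{m+1}(x),\qquad m\in\mathbb Z.\tag{1}$$ A *double-Bloch solution* of (1) with multipliers $(B_1,B_2)$ is a solution $(\psi^m)_{m\in\mathbb Z}$ such that each $\psi^m$ is meromorphic on $\mathbb C$, has no singularities other than at most simple poles at points of $x_i^m+\Lambda$, and satisfies $\psi^m(x+2\omega_a)=B_a\psi^m(x)$,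 $a=1,2$. Pairs $B$, $\tilde B$ are *equivalent* if $\tilde B_a=B_ae^{2b\omega_a}$ $(a=1,2)$ for some $b\in\mathbb C$. For $\zeta\notin\pm\eta+\Lambda$ let $$\Phi(x,\zeta)=\frac{\sigma(\zeta+x+\eta)}{\sigma(\zeta+\eta)\sigma(x)}\left[\frac{\sigma(\zeta-\eta)}{\sigma(\zeta+\eta)}\right]^{x/(2\eta)}.$$ A sequence $(\psi^m)$ *has the form (2) with parameters* $(\zeta,k)$, $\zeta\notin\pm\eta+\Lambda$, $k\neq0$, if there are constants $c_i(m)\in\mathbb C$ with $$\psi^m(x)=\sum_{i=1}^N c_i(m)\,\Phi(x-x_i^m,\zeta)\,k^{x/\eta}\qquad\text{for all }m,\tag{2}$$ where both powers are computed with some choice of $\log\frac{\sigma(\zeta-\eta)}{\sigma(\zeta+\eta)}$ and of $\log k$, the same for all $m,i,x$. The pair $(\zeta,k)$ is *admissible* if some double-Bloch solution that is not identically zero has the form (2) with these parameters. **Theorem.** Suppose that (1) has $N$ double-Bloch solutions $\psi_1,\dots,\psi_N$ with pairwise equivalent Bloch multipliers such that, for every $m$, the functions $\psi_1^m,\dots,\psi_N^m$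 are linearly independent over the field of $\eta$-periodic meromorphic functions of $x$. Then: 1. (1) has infinitely many double-Bloch solutions: there is an infinite sequence of double-Bloch solutions whose Bloch multipliers are pairwise inequivalent and which are linearly independent over $\mathbb C$ for every fixed $m$. 2. Every double-Bloch solution of (1) whose multipliers are equivalent neither to $(1,1)$ nor to $(e^{4\eta\zeta_W(\omega_1)},e^{4\eta\zeta_W(\omega_2)})$ (the classes belonging to the excluded values $\zeta\equiv-\eta$ and $\zeta\equiv\eta$) has the form (2) for some $\zeta\notin\pm\eta+\Lambda$ and $k\ne0$. 3. The admissible pairs are parametrized by the points of an algebraic curve. Put $$u(\zeta)=\frac{\sigma(\zeta)^2}{\sigma(\zeta+\eta)\sigma(\zeta-\eta)},\qquad v(\zeta)=\frac{\sigma(2\zeta)}{\sigma(\zeta+\eta)^2\sigma(\zeta-\eta)^2}.$$ There are a squarefree polynomial $q\in\mathbb C[u]$ of degree 3 or 4 such that $\zeta\mapsto(u(\zeta),v(\zeta))$ is a well-defined bijection of $(\mathbb C\setminus(\pm\eta+\Lambda))/\Lambda$ onto the affine elliptic curve $v^2=q(u)$, and a polynomial $P\in\mathbb C[u,v][k]$,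 monic of degree $2N$ in $k$, such that for the algebraic curve $$\Gamma=\{(u,v,k)\in\mathbb C^3:\ v^2=q(u),\ P(u,v,k)=0\}$$ the following holds. If $(\zeta,k)$ is admissible, then $k\neq0$ and $(u(\zeta),v(\zeta),k)\in\Gamma$. Conversely, if $\zeta\notin\pm\eta+\Lambda$, $k\ne0$, $(u(\zeta),v(\zeta),k)\in\Gamma$ and $\zeta+\eta+\sum_{i}(x_i^{m+1}-x_i^m)\notin\Lambda$ for all $m\in\mathbb Z$, then $(\zeta,k)$ is admissible. -/

import Mathlib

open Polynomial

noncomputable section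

namespace EllipticHirota

/-- The Weierstrass sigma function of the lattice `ℤ ω₁ + ℤ ω₂` (here `L.ω₁`, `L.ω₂` are full
periods): `σ(z) = z ∏_{l ≠ 0} (1 - z / l) exp (z / l + z² / (2 l²))`. -/
def sigma (L : PeriodPair) (z : ℂ) : ℂ :=
  z * ∏' l : {l : L.lattice // l ≠ 0},
    ((1 - z / (l : ℂ)) * Complex.exp (z / (l : ℂ) + z ^ 2 / (2 * (l : ℂ) ^ 2)))

/-- The Weierstrass zeta function `σ' / σ`. -/
def zetaW (L : PeriodPair) (z : ℂ) : ℂ := deriv (sigma L) z / sigma L z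

/-- The elliptic polynomial `∏ i, σ (z - y i)` with zeros `y i`. -/
def tau (L : PeriodPair) {N : ℕ} (y : Fin N → ℂ) (z : ℂ) : ℂ := ∏ i, sigma L (z - y i)

/-- The points congruent to some `y i` modulo the lattice. -/
def poles (L : PeriodPair) {N : ℕ} (y : Fin N → ℂ) : Set ℂ := {z | ∃ i, z - y i ∈ L.lattice}

/-- Generic position of the zeros `x m i` of the tau functions (differences are taken modulo the
lattice). -/
structure Generic (L : PeriodPair) (η : ℂ) {N : ℕ} (x : ℤ → Fin N → ℂ) : Prop where
  same_time : ∀ m i j, i ≠ j → x m i - x m j ∉ L.lattice ∧ x m i - x m j + η ∉ L.lattice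
  next_time : ∀ m i j,
    x (m + 1) i - x m j ∉ L.lattice ∧ x (m + 1) i - x m j + η ∉ L.lattice

/-- `ψ` is a solution of
`ψᵐ(z + η) - lam (τᵐ(z) τᵐ⁺¹(z + η)) / (τᵐ⁺¹(z) τᵐ(z + η)) ψᵐ(z) = ψᵐ⁺¹(z)`, `m ∈ ℤ`,
such that every `ψᵐ` is a meromorphic double-Bloch function with Bloch multipliers `B.1`, `B.2`
whose only singularities are at most simple poles at the points `x m i` modulo the lattice.
Values at poles are irrelevant. -/
structure IsDoubleBlochSolution (L : PeriodPair) (η lam : ℂ) {N : ℕ} (x : ℤ → Fin N → ℂ)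
    (B : ℂ × ℂ) (ψ : ℤ → ℂ → ℂ) : Prop where
  analyticAt : ∀ m, ∀ z ∉ poles L (x m), AnalyticAt ℂ (ψ m) z
  meromorphicAt : ∀ m z, MeromorphicAt (ψ m) z
  simple_poles : ∀ m z, -1 ≤ meromorphicOrderAt (ψ m) z
  bloch₁ : ∀ m, ∀ z ∉ poles L (x m), ψ m (z + L.ω₁) = B.1 * ψ m z
  bloch₂ : ∀ m, ∀ z ∉ poles L (x m), ψ m (z + L.ω₂) = B.2 * ψ m z
  equation : ∀ m z, z ∉ poles L (x m) → z + η ∉ poles L (x m) → z ∉ poles L (x (m + 1)) →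
    ψ m (z + η) - lam * (tau L (x m) z * tau L (x (m + 1)) (z + η)) /
      (tau L (x (m + 1)) z * tau L (x m) (z + η)) * ψ m z = ψ (m + 1) z

/-- Two pairs of Bloch multipliers are equivalent if they differ by the effect of a gauge
transformation `f(z) ↦ f(z) exp (b z)`. -/
def EquivMultipliers (L : PeriodPair) (B B' : ℂ × ℂ) : Prop :=
  ∃ b : ℂ, B'.1 = B.1 * Complex.exp (b * L.ω₁) ∧ B'.2 = B.2 * Complex.exp (b * L.ω₂)

/-- `ψ` is not the zero solution. -/
def Nontrivial (L : PeriodPair) {N : ℕ} (x : ℤ → Fin N → ℂ) (ψ : ℤ → ℂ → ℂ) : Prop :=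
  ∃ m, ∃ z ∉ poles L (x m), ψ m z ≠ 0

/-- Linear independence of functions `φ r`, regular outside `poles L y`, over the `η`-periodic
functions. It is enough to allow entire coefficients, since every meromorphic `η`-periodic function
is a quotient of entire ones. -/
def PeriodicIndependent (L : PeriodPair) (η : ℂ) {N : ℕ} (y : Fin N → ℂ)
    (φ : Fin N → ℂ → ℂ) : Prop :=
  ∀ p : Fin N → ℂ → ℂ, (∀ r, Differentiable ℂ (p r)) → (∀ r z, p r (z + η) = p r z) →
    (∀ z ∉ poles L y, ∑ r, p r z * φ r z = 0) → ∀ r z, p r z = 0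

/-- The values of the spectral parameter at which `Phi` is defined: `ζ ≢ ± η`. -/
def Regular (L : PeriodPair) (η ζ : ℂ) : Prop := ζ - η ∉ L.lattice ∧ ζ + η ∉ L.lattice

/-- `Φ(z, ζ) = σ(ζ + z + η) / (σ(ζ + η) σ(z)) [σ(ζ - η) / σ(ζ + η)] ^ (z / (2 η))`, where the power
is computed with the value `ℓ` of the logarithm of `σ(ζ - η) / σ(ζ + η)`. -/
def Phi (L : PeriodPair) (η ζ ℓ z : ℂ) : ℂ :=
  sigma L (ζ + z + η) / (sigma L (ζ + η) * sigma L z) * Complex.exp (ℓ * (z / (2 * η)))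

/-- `ψᵐ(z) = ∑ i, c m i Φ(z - x m i, ζ) k ^ (z / η)` for some coefficients `c` and some choice
`ℓ`, `κ` of the logarithms of `σ(ζ - η) / σ(ζ + η)` and `k` (the same for all `m`, `i`, `z`). -/
def HasForm (L : PeriodPair) (η : ℂ) {N : ℕ} (x : ℤ → Fin N → ℂ) (ζ k : ℂ)
    (ψ : ℤ → ℂ → ℂ) : Prop :=
  ∃ (ℓ κ : ℂ) (c : ℤ → Fin N → ℂ),
    Complex.exp ℓ = sigma L (ζ - η) / sigma L (ζ + η) ∧ Complex.exp κ = k ∧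
    ∀ m, ∀ z ∉ poles L (x m),
      ψ m z = ∑ i, c m i * Phi L η ζ ℓ (z - x m i) * Complex.exp (κ * (z / η))

/-- The pair `(ζ, k)` corresponds to a nonzero double-Bloch solution. -/
def Admissible (L : PeriodPair) (η lam : ℂ) {N : ℕ} (x : ℤ → Fin N → ℂ) (ζ k : ℂ) : Prop :=
  Regular L η ζ ∧ ∃ (B : ℂ × ℂ) (ψ : ℤ → ℂ → ℂ),
    IsDoubleBlochSolution L η lam x B ψ ∧ Nontrivial L x ψ ∧ HasForm L η x ζ k ψ

/-- First affine coordinate on the elliptic curve `ℂ / Λ` without the points `± η`. It is equal to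
`-1 / (σ(η)² (℘(ζ) - ℘(η)))`. -/
def coordU (L : PeriodPair) (η ζ : ℂ) : ℂ :=
  sigma L ζ ^ 2 / (sigma L (ζ + η) * sigma L (ζ - η))

/-- Second affine coordinate on the elliptic curve `ℂ / Λ` without the points `± η`. It is equal to
`-℘'(ζ) / (σ(η)⁴ (℘(ζ) - ℘(η))²)`. -/
def coordV (L : PeriodPair) (η ζ : ℂ) : ℂ :=
  sigma L (2 * ζ) / (sigma L (ζ + η) * sigma L (ζ - η)) ^ 2

/-- The affine algebraic curve `{(u, v, k) : v² = q(u), P(u, v; k) = 0}` in `ℂ³`. For `P` monic in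
the last variable it is a finite covering of the plane curve `v² = q(u)`. -/
def coveringCurve (q : ℂ[X]) (P : (MvPolynomial (Fin 2) ℂ)[X]) : Set (ℂ × ℂ × ℂ) :=
  {p | p.2.1 ^ 2 = q.eval p.1 ∧
    (P.map (MvPolynomial.eval ![p.1, p.2.1])).eval p.2.2 = 0}

end EllipticHirota

end

noncomputable section

namespace EllipticHirota

open Filter Topology Complex

/-! Multiplying a double-Bloch solution by τ turns it into entire functions g^m = τ^m ψ^m that
satisfy a bilinear difference equation. Each g^m is a theta function of degree N. Nonzero
multipliers can be written B_a = exp(q_a s + b ω_a), with q_a the quasi-periods of ζ_W. The class s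
modulo Λ is invariant under gauge transformations and corresponds to ζ = s − η. Two facts replace
all counting of zeros: a theta function of degree 0 with a zero vanishes, and so does one of
nontrivial class (`IsTheta.eq_zero`, `IsTheta.eq_zero_of_class`). Hence a theta function of degree N
and class s ∉ Λ is determined by its values at N points, which gives the explicit form of the
solutions (`IsTheta.eq_interp`, `exists_hasForm`).

The N given solutions serve only to force equations of motion on the zeros x_i^m
(`equationsOfMotion`). At a zero p of τ^{m+1} the bilinear equation gives three relations. If g^m(p)
≠ 0 for one solution, eliminating the values of g yields the equation of motion at p. If g^m(p) = 0
for all N solutions, then all g^{m+1} vanish at p and at p − η. This produces a linear relation over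
the η-periodic functions, contrary to the hypothesis.

Evaluated at the zeros of τ^m and τ^{m+1}, the bilinear equation becomes an eigenvalue problem for
`laxMatrix` and a time step by `evolutionMatrix`. The equations of motion are exactly what makes the
two compatible (`laxMatrix_mul_evolutionMatrix`). So the spectrum does not depend on m, and an
eigenvector at time 0 propagates to all times wherever the evolution is invertible
(`exists_solution_of_eigenvector`). Since only countably many classes are excluded, infinitely many
inequivalent solutions exist.

The eigenvalue is ν = exp(ℓ/2) k σ(ζ + η), whose sign depends on the choice of the logarithm ℓ. Its
square k² σ(ζ + η) σ(ζ − η) does not, so the curve comes from the characteristic polynomial of the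
squared Lax matrix. The coefficients of that polynomial are theta functions in ζ of even degree;
divided by powers of `den` they are polynomials in u and v (`IsTheta.exists_mvPolynomial`,
`exists_spectralPolynomial`). -/

section

/-! ### The Weierstrass product: convergence, zeros, and the relation of σ'/σ to ℘. -/

theorem norm_weierstrassFactor_sub_one_le {w : ℂ} (hw : ‖w‖ ≤ 1 / 2) :
    ‖(1 - w) * exp (w + w ^ 2 / 2) - 1‖ ≤ 4 * ‖w‖ ^ 3 := by
  set t : ℂ := w + w ^ 2 / 2 with ht
  have hw0 := norm_nonneg w
  have hle : ‖t‖ ≤ 5 / 4 * ‖w‖ := by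
    calc ‖t‖ ≤ ‖w‖ + ‖w ^ 2 / 2‖ := norm_add_le _ _
      _ = ‖w‖ + ‖w‖ ^ 2 / 2 := by simp
      _ ≤ _ := by nlinarith
  have ht1 : ‖t‖ ≤ 1 := by linarith
  have hexp := Complex.exp_bound ht1 (n := 3) (by norm_num)
  have hsum : ∑ m ∈ Finset.range 3, t ^ m / (m.factorial : ℂ) = 1 + t + t ^ 2 / 2 := by
    simp [Finset.sum_range_succ, Nat.factorial]
  rw [hsum] at hexp
  have hR : ‖exp t - (1 + t + t ^ 2 / 2)‖ ≤ 1 / 2 * ‖w‖ ^ 3 := by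
    refine hexp.trans ?_
    have : ‖t‖ ^ 3 ≤ (5 / 4 * ‖w‖) ^ 3 := by gcongr
    have h3 : 0 ≤ ‖w‖ ^ 3 := by positivity
    norm_num [Nat.factorial]
    nlinarith
  -- The exponent t is chosen so that the terms of order 1 and 2 in w cancel; only w³ times a
  -- polynomial remains besides the Taylor remainder.
  have hid : (1 - w) * exp t - 1 =
      (1 - w) * (exp t - (1 + t + t ^ 2 / 2)) +
        w ^ 3 * (-(1 / 2) - 3 / 8 * w - 1 / 8 * w ^ 2) := by
    rw [ht]; ring
  rw [hid]
  have h1 : ‖1 - w‖ ≤ 3 / 2 := by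
    have := norm_sub_le (1 : ℂ) w
    simp at this; linarith
  have h2 : ‖-(1 / 2) - 3 / 8 * w - 1 / 8 * w ^ 2‖ ≤ 1 := by
    calc _ ≤ ‖-(1 / 2) - 3 / 8 * w‖ + ‖1 / 8 * w ^ 2‖ := norm_sub_le _ _
      _ ≤ ‖(-(1 / 2) : ℂ)‖ + ‖3 / 8 * w‖ + ‖1 / 8 * w ^ 2‖ := by gcongr; exact norm_sub_le _ _
      _ = 1 / 2 + 3 / 8 * ‖w‖ + 1 / 8 * ‖w‖ ^ 2 := by simp
      _ ≤ 1 := by nlinarith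
  calc _ ≤ ‖(1 - w) * (exp t - (1 + t + t ^ 2 / 2))‖ +
        ‖w ^ 3 * (-(1 / 2) - 3 / 8 * w - 1 / 8 * w ^ 2)‖ := norm_add_le _ _
    _ = ‖1 - w‖ * ‖exp t - (1 + t + t ^ 2 / 2)‖ +
        ‖w‖ ^ 3 * ‖-(1 / 2) - 3 / 8 * w - 1 / 8 * w ^ 2‖ := by simp only [norm_mul, norm_pow]
    _ ≤ 3 / 2 * (1 / 2 * ‖w‖ ^ 3) + ‖w‖ ^ 3 * 1 := by gcongr
    _ ≤ _ := by nlinarith [pow_nonneg hw0 3]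

/-- The nonzero lattice points. -/
abbrev Punctured (L : PeriodPair) := {l : L.lattice // l ≠ 0}

/-- The factor of the product for `σ` belonging to the nonzero lattice point `l`. -/
def sigmaFactor (L : PeriodPair) (l : Punctured L) (z : ℂ) : ℂ :=
  (1 - z / (l : ℂ)) * exp (z / (l : ℂ) + z ^ 2 / (2 * (l : ℂ) ^ 2))

variable (L : PeriodPair)

theorem Punctured.coe_ne_zero {L : PeriodPair} (l : Punctured L) : ((l : L.lattice) : ℂ) ≠ 0 := by
  simpa using l.2

theorem summable_norm_punctured :
    Summable fun l : Punctured L => ‖((l : L.lattice) : ℂ)‖ ^ (-3 : ℝ) := by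
  have := ZLattice.summable_norm_rpow L.lattice (-3) (by simp; norm_num)
  exact this.comp_injective Subtype.val_injective

theorem eventually_norm_punctured_ge (r : ℝ) :
    ∀ᶠ l : Punctured L in cofinite, r ≤ ‖((l : L.lattice) : ℂ)‖ := by
  have h : ∀ᶠ l : L.lattice in cofinite, r ≤ ‖(l : ℂ)‖ := by
    refine (isCompact_iff_finite.mp (isCompact_closedBall (0 : L.lattice) r)).subset ?_
    intro l hl
    simp only [Set.mem_compl_iff, Set.mem_ofPred_eq, not_le] at hl
    simpa using hl.le
  exact Subtype.val_injective.tendsto_cofinite.eventually h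

theorem norm_sigmaFactor_sub_one_le {r : ℝ} {l : Punctured L} (hl : 2 * r ≤ ‖((l : L.lattice) : ℂ)‖)
    {z : ℂ} (hz : ‖z‖ ≤ r) :
    ‖sigmaFactor L l z - 1‖ ≤ 4 * r ^ 3 * ‖((l : L.lattice) : ℂ)‖ ^ (-3 : ℝ) := by
  have hl0 : 0 < ‖((l : L.lattice) : ℂ)‖ := norm_pos_iff.mpr l.coe_ne_zero
  have hw : ‖z / ((l : L.lattice) : ℂ)‖ ≤ 1 / 2 := by
    rw [norm_div, div_le_iff₀ hl0]; linarith
  have := norm_weierstrassFactor_sub_one_le hw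
  have hE : sigmaFactor L l z = (1 - z / ((l : L.lattice) : ℂ)) *
      exp (z / ((l : L.lattice) : ℂ) + (z / ((l : L.lattice) : ℂ)) ^ 2 / 2) := by
    rw [sigmaFactor]; congr 2; rw [div_pow]; field_simp
  rw [hE]
  refine this.trans ?_
  rw [norm_div, div_pow, mul_assoc]
  rw [Real.rpow_neg hl0.le, div_eq_mul_inv]
  norm_cast
  gcongr

theorem differentiable_sigmaFactor (l : Punctured L) : Differentiable ℂ (sigmaFactor L l) := by
  unfold sigmaFactor; fun_prop

theorem hasProdLocallyUniformlyOn_sigmaFactor (r : ℝ) :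
    HasProdLocallyUniformlyOn (sigmaFactor L) (fun z => ∏' l, sigmaFactor L l z)
      (Metric.ball 0 r) := by
  have h := Summable.hasProdLocallyUniformlyOn_one_add (f := fun l z => sigmaFactor L l z - 1)
    (Metric.isOpen_ball (x := (0 : ℂ)) (ε := r)) ((summable_norm_punctured L).mul_left (4 * r ^ 3))
    ?_ ?_
  · simpa using h
  · filter_upwards [eventually_norm_punctured_ge L (2 * r)] with l hl z hz
    exact norm_sigmaFactor_sub_one_le L hl (by simpa using (Metric.mem_ball.mp hz).le)
  · intro l
    exact ((differentiable_sigmaFactor L l).sub_const 1).continuous.continuousOn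

theorem differentiable_tprod_sigmaFactor : Differentiable ℂ (fun z => ∏' l, sigmaFactor L l z) := by
  intro z
  have h : DifferentiableOn ℂ (fun z => ∏' l, sigmaFactor L l z) (Metric.ball 0 (‖z‖ + 1)) :=
    (hasProdLocallyUniformlyOn_sigmaFactor L _).differentiableOn
      (.of_forall fun _ => by
        simpa [Finset.prod_fn] using DifferentiableOn.finsetProd
          (fun l _ => (differentiable_sigmaFactor L l).differentiableOn)) Metric.isOpen_ball
  exact h.differentiableAt (Metric.isOpen_ball.mem_nhds (by simp))

theorem sigma_eq (z : ℂ) : sigma L z = z * ∏' l, sigmaFactor L l z := rfl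

theorem differentiable_sigma : Differentiable ℂ (sigma L) :=
  differentiable_id.mul (differentiable_tprod_sigmaFactor L)

theorem tprod_sigmaFactor_ne_zero {z : ℂ} (hz : ∀ l : Punctured L, z ≠ ((l : L.lattice) : ℂ)) :
    ∏' l, sigmaFactor L l z ≠ 0 := by
  have h := tprod_one_add_ne_zero_of_summable (f := fun l => sigmaFactor L l z - 1) ?_ ?_
  · simpa using h
  · intro l
    have : 1 - z / ((l : L.lattice) : ℂ) ≠ 0 := by
      rw [sub_ne_zero, ne_comm, Ne, div_eq_one_iff_eq l.coe_ne_zero]; exact hz l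
    simpa [sigmaFactor] using this
  · refine ((summable_norm_punctured L).mul_left (4 * ‖z‖ ^ 3)).of_norm_bounded_eventually ?_
    filter_upwards [eventually_norm_punctured_ge L (2 * ‖z‖)] with l hl
    simpa using norm_sigmaFactor_sub_one_le L hl le_rfl

theorem sigma_zero : sigma L 0 = 0 := by simp [sigma]

theorem sigma_ne_zero {z : ℂ} (hz : z ∉ L.lattice) : sigma L z ≠ 0 := by
  refine mul_ne_zero (fun h => hz (h ▸ zero_mem _)) (tprod_sigmaFactor_ne_zero L ?_)
  rintro l rfl
  exact hz l.1.2

theorem deriv_sigma_zero : deriv (sigma L) 0 = 1 := by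
  have h := (hasDerivAt_id' (0 : ℂ)).fun_mul (differentiable_tprod_sigmaFactor L 0).hasDerivAt
  have h' : deriv (sigma L) 0 = _ := h.deriv
  rw [h']
  simp [sigmaFactor]

theorem sigma_neg (z : ℂ) : sigma L (-z) = -sigma L z := by
  have : ∏' l, sigmaFactor L l (-z) = ∏' l, sigmaFactor L l z := by
    let e : Punctured L ≃ Punctured L := (Equiv.neg L.lattice).subtypeEquiv (by simp)
    rw [← e.tprod_eq]
    refine tprod_congr fun l => ?_
    simp [sigmaFactor, e]
  rw [sigma_eq, sigma_eq, this, neg_mul]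

/-- The regular part at the origin of the Weierstrass zeta function. -/
def zetaExcept (z : ℂ) : ℂ :=
  ∑' l : L.lattice, if l.1 = 0 then 0 else (1 / (z - l) + 1 / l + z / l ^ 2)

theorem zetaSummand_bound {r : ℝ} (hr : 0 < r) {s : ℂ} (hs : ‖s‖ < r) {l : ℂ} (h : 2 * r ≤ ‖l‖) :
    ‖1 / (s - l) + 1 / l + s / l ^ 2‖ ≤ 2 * r ^ 2 * ‖l‖ ^ (-3 : ℝ) := by
  have hl : 0 < ‖l‖ := by linarith
  have hl0 : l ≠ 0 := norm_pos_iff.mp hl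
  have hsl : s - l ≠ 0 := by
    intro h0; rw [sub_eq_zero] at h0; subst h0; linarith
  have : 1 / (s - l) + 1 / l + s / l ^ 2 = s ^ 2 / ((s - l) * l ^ 2) := by
    field_simp; ring
  rw [this, norm_div, norm_mul, norm_pow, norm_pow]
  have h2 : ‖l‖ / 2 ≤ ‖s - l‖ := by
    rw [norm_sub_rev]
    exact .trans (by linarith) (norm_sub_norm_le l s)
  rw [Real.rpow_neg hl.le]
  norm_cast
  calc ‖s‖ ^ 2 / (‖s - l‖ * ‖l‖ ^ 2) ≤ r ^ 2 / (‖l‖ / 2 * ‖l‖ ^ 2) := by gcongr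
    _ = _ := by field_simp

theorem hasSumLocallyUniformly_zetaExcept :
    HasSumLocallyUniformly
      (fun (l : L.lattice) (z : ℂ) => if l.1 = 0 then 0 else (1 / (z - l) + 1 / l + z / l ^ 2))
      (zetaExcept L) := by
  refine L.hasSumLocallyUniformly_aux (u := fun r l => 2 * r ^ 2 * ‖l‖ ^ (-3 : ℝ)) _
    (fun _ _ ↦ (ZLattice.summable_norm_rpow _ _ (by simp; norm_num)).mul_left _) fun r hr ↦
    Filter.eventually_atTop.mpr ⟨2 * r, ?_⟩
  rintro _ h s hs l rfl
  split_ifs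
  · simp only [norm_zero]; positivity
  · exact zetaSummand_bound hr hs h

theorem differentiableOn_zetaExcept : DifferentiableOn ℂ (zetaExcept L) (L.lattice)ᶜ := by
  refine (hasSumLocallyUniformly_zetaExcept L).hasSumLocallyUniformlyOn.differentiableOn
    (.of_forall fun s ↦ .fun_sum fun i hi ↦ ?_) L.isClosed_lattice.isOpen_compl
  split_ifs
  · simp
  · refine .add (.add (.div (by fun_prop) (by fun_prop) fun x hx h => ?_) (by fun_prop))
      (by fun_prop)
    rw [sub_eq_zero] at h
    exact hx (h ▸ i.2)

/-- Termwise differentiation links the zeta function to `weierstrassP`, whose periodicity is the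
source of all quasi-periodicity below. -/
theorem deriv_zetaExcept {z : ℂ} (hz : z ∉ L.lattice) :
    deriv (zetaExcept L) z = -L.weierstrassPExcept 0 z := by
  have hne : ∀ x : ℂ, x ∈ (L.lattice : Set ℂ)ᶜ → ∀ l : L.lattice, x - l ≠ 0 :=
    fun x hx l h => hx (by rw [sub_eq_zero] at h; exact h ▸ l.2)
  have hd : ∀ l : L.lattice, ∀ x ∈ (L.lattice : Set ℂ)ᶜ,
      HasDerivAt (fun z : ℂ => if l.1 = 0 then 0 else (1 / (z - l) + 1 / l + z / l ^ 2))
        (-(if l.1 = 0 then 0 else (1 / (x - l) ^ 2 - 1 / l ^ 2))) x := by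
    intro l x hx
    split_ifs with h0
    · simpa using hasDerivAt_const x (0 : ℂ)
    · have h1 : HasDerivAt (fun z : ℂ => 1 / (z - l)) (-1 / (x - l) ^ 2) x := by
        simpa using ((hasDerivAt_id' x).sub_const (l : ℂ)).fun_inv (hne x hx l)
      refine ((h1.add_const (1 / (l : ℂ))).fun_add
        ((hasDerivAt_id' x).div_const ((l : ℂ) ^ 2))).congr_deriv ?_
      ring
  have h1 := ((hasSumLocallyUniformly_zetaExcept L).tendstoLocallyUniformlyOn (s := (L.lattice : Set ℂ)ᶜ)).deriv
    (.of_forall fun s ↦ .fun_sum fun l _ x hx => (hd l x hx).differentiableAt.differentiableWithinAt)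
    L.isClosed_lattice.isOpen_compl
  have h2 := h1.tendsto_at (a := z) hz
  have h3 : Tendsto (fun s : Finset L.lattice => ∑ l ∈ s,
      (-(if l.1 = 0 then 0 else (1 / (z - l) ^ 2 - 1 / l ^ 2)))) atTop
      (𝓝 (-L.weierstrassPExcept 0 z)) := by
    exact (L.hasSum_weierstrassPExcept 0 z).neg
  refine tendsto_nhds_unique h2 (h3.congr fun s => ?_)
  simp only [Function.comp_apply]
  rw [deriv_fun_sum fun l _ => (hd l z hz).differentiableAt]
  exact Finset.sum_congr rfl fun l _ => (hd l z hz).deriv.symm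

/-- Logarithmic differentiation of the product, factor by factor. -/
theorem zetaW_eq {z : ℂ} (hz : z ∉ L.lattice) : zetaW L z = 1 / z + zetaExcept L z := by
  have hz0 : z ≠ 0 := fun h => hz (h ▸ zero_mem _)
  have hne : ∀ l : Punctured L, z - ((l : L.lattice) : ℂ) ≠ 0 :=
    fun l h => hz (by rw [sub_eq_zero] at h; exact h ▸ l.1.2)
  have hprod := tprod_sigmaFactor_ne_zero L (z := z) fun l h => hz (h ▸ l.1.2)
  have hlog : ∀ l : Punctured L, logDeriv (sigmaFactor L l) z =
      1 / (z - ((l : L.lattice) : ℂ)) + 1 / ((l : L.lattice) : ℂ) +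
        z / ((l : L.lattice) : ℂ) ^ 2 := by
    intro l
    have hl := l.coe_ne_zero
    have h1 : 1 - z / ((l : L.lattice) : ℂ) ≠ 0 := by
      rw [sub_ne_zero, ne_comm, Ne, div_eq_one_iff_eq hl]
      intro h; exact hne l (by rw [h, sub_self])
    have hd1 : HasDerivAt (fun z : ℂ => 1 - z / ((l : L.lattice) : ℂ))
        (-(1 / ((l : L.lattice) : ℂ))) z :=
      ((hasDerivAt_id' z).div_const _).const_sub 1
    have hd2 : HasDerivAt (fun z : ℂ => z / ((l : L.lattice) : ℂ) +
        z ^ 2 / (2 * ((l : L.lattice) : ℂ) ^ 2))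
        (1 / ((l : L.lattice) : ℂ) + 2 * z / (2 * ((l : L.lattice) : ℂ) ^ 2)) z := by
      have := ((hasDerivAt_id' z).div_const ((l : L.lattice) : ℂ)).fun_add
        ((hasDerivAt_pow 2 z).div_const (2 * ((l : L.lattice) : ℂ) ^ 2))
      simpa using this
    have hd := hd1.fun_mul hd2.cexp
    have hder : deriv (sigmaFactor L l) z = _ := hd.deriv
    rw [logDeriv_apply, hder]
    simp only [sigmaFactor]
    have h2 := hne l
    have h3 : ((l : L.lattice) : ℂ) - z ≠ 0 := by rw [← neg_sub]; exact neg_ne_zero.mpr h2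
    have he := exp_ne_zero (z / ((l : L.lattice) : ℂ) + z ^ 2 / (2 * ((l : L.lattice) : ℂ) ^ 2))
    have h1' : 1 - z / ((l : L.lattice) : ℂ) = (((l : L.lattice) : ℂ) - z) / ((l : L.lattice) : ℂ) := by
      field_simp
    rw [h1']
    field_simp
    ring
  have hsum : HasSum (fun l : Punctured L => 1 / (z - ((l : L.lattice) : ℂ)) +
      1 / ((l : L.lattice) : ℂ) + z / ((l : L.lattice) : ℂ) ^ 2) (zetaExcept L z) := by
    have h := (hasSumLocallyUniformly_zetaExcept L).hasSum (x := z)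
    have h' : HasSum (fun l : L.lattice => Set.indicator {l : L.lattice | l ≠ 0}
        (fun l => 1 / (z - l) + 1 / (l : ℂ) + z / (l : ℂ) ^ 2) l) (zetaExcept L z) := by
      convert h using 2 with l
      by_cases h0 : l = 0 <;> simp [h0]
    exact (hasSum_subtype_iff_indicator (f := fun l : L.lattice => 1 / (z - l) + 1 / (l : ℂ) + z / (l : ℂ) ^ 2)).mpr h'
  have hmain : logDeriv (fun z => ∏' l, sigmaFactor L l z) z = ∑' l, logDeriv (sigmaFactor L l) z := by
    refine logDeriv_tprod_eq_tsum (Metric.isOpen_ball (x := (0 : ℂ)) (ε := ‖z‖ + 1)) (by simp)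
      ?_ (fun l => (differentiable_sigmaFactor L l).differentiableOn) ?_
      (hasProdLocallyUniformlyOn_sigmaFactor L _).multipliableLocallyUniformlyOn hprod
    · intro l h0
      exact hprod (tprod_of_exists_eq_zero ⟨l, h0⟩)
    · simp_rw [hlog]; exact hsum.summable
  have : zetaW L z = logDeriv (fun w => w * ∏' l, sigmaFactor L l w) z := rfl
  rw [this, logDeriv_mul (f := fun w => w) z hz0 hprod differentiableAt_fun_id (differentiable_tprod_sigmaFactor L z),
    hmain]
  simp_rw [hlog]
  rw [hsum.tsum_eq]
  simp [logDeriv_apply]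

theorem hasDerivAt_zetaW {z : ℂ} (hz : z ∉ L.lattice) :
    HasDerivAt (zetaW L) (-L.weierstrassP z) z := by
  have hz0 : z ≠ 0 := fun h => hz (h ▸ zero_mem _)
  have hopen := L.isClosed_lattice.isOpen_compl.mem_nhds (show z ∈ (L.lattice : Set ℂ)ᶜ from hz)
  have h1 := ((differentiableOn_zetaExcept L).differentiableAt hopen).hasDerivAt
  rw [deriv_zetaExcept L hz] at h1
  have h2 := (hasDerivAt_inv hz0).fun_add h1
  have h3 : -L.weierstrassP z = -(z ^ 2)⁻¹ + -L.weierstrassPExcept 0 z := by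
    rw [← L.weierstrassPExcept_add 0 z]
    simp
  rw [h3]
  refine h2.congr_of_eventuallyEq ?_
  filter_upwards [hopen] with w hw
  rw [zetaW_eq L hw]; simp

theorem isPreconnected_compl_of_countable {S : Set ℂ} (hS : S.Countable) : IsPreconnected Sᶜ :=
  (hS.isPathConnected_compl_of_one_lt_rank (by simp)).isConnected.isPreconnected

theorem countable_lattice : (L.lattice : Set ℂ).Countable :=
  Set.countable_coe_iff.mp L.latticeEquivProd.injective.countable

end

/-! ### Quasi-periodicity and simple zeros of σ. -/

section

variable (L : PeriodPair)

/-- The two basic periods. -/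
def per : Fin 2 → ℂ := ![L.ω₁, L.ω₂]

/-- The quasi-periods of the Weierstrass zeta function belonging to the two basic periods. -/
def qper (a : Fin 2) : ℂ := 2 * zetaW L (per L a / 2)

theorem per_mem (a : Fin 2) : per L a ∈ L.lattice := by
  fin_cases a
  exacts [L.ω₁_mem_lattice, L.ω₂_mem_lattice]

theorem per_half_notMem (a : Fin 2) : per L a / 2 ∉ L.lattice := by
  fin_cases a
  exacts [L.ω₁_div_two_notMem_lattice, L.ω₂_div_two_notMem_lattice]

theorem per_half_sub_notMem : per L 1 / 2 - per L 0 / 2 ∉ L.lattice := by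
  have := (L.mul_ω₁_add_mul_ω₂_mem_lattice (α := -1 / 2) (β := 1 / 2)).not.mpr (by norm_num)
  convert this using 2
  simp [per]; ring

variable {L}

/-- The translations preserving a set form a group, so the two generators suffice. -/
theorem mem_iff_add_lattice {S : Set ℂ} (hS : ∀ a z, z + per L a ∈ S ↔ z ∈ S) {l : ℂ}
    (hl : l ∈ L.lattice) (z : ℂ) : z + l ∈ S ↔ z ∈ S := by
  let T : AddSubgroup ℂ :=
    { carrier := {l | ∀ z, z + l ∈ S ↔ z ∈ S}
      zero_mem' := by simp
      add_mem' := by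
        intro a b ha hb z
        rw [← add_assoc, hb, ha]
      neg_mem' := by
        intro a ha z
        rw [← ha (z + -a), neg_add_cancel_right] }
  have : L.lattice ≤ AddSubgroup.toIntSubmodule T := by
    rw [PeriodPair.lattice, Submodule.span_le]
    rintro x (rfl | rfl)
    exacts [hS 0, hS 1]
  exact this hl z

theorem apply_add_lattice {E : Type*} {f : ℂ → E} (hf : ∀ a z, f (z + per L a) = f z) {l : ℂ}
    (hl : l ∈ L.lattice) (z : ℂ) : f (z + l) = f z :=
  (mem_iff_add_lattice (S := {w | f w = f z}) (fun a w => by simp [hf]) hl z).mpr rfl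

theorem notMem_add_lattice {l : ℂ} (hl : l ∈ L.lattice) (z : ℂ) :
    z + l ∈ L.lattice ↔ z ∈ L.lattice := by
  constructor
  · intro h; simpa using sub_mem h hl
  · intro h; exact add_mem h hl

theorem apply_eq_of_deriv_eq_zero_compl_lattice {f : ℂ → ℂ}
    (hf : ∀ z ∉ L.lattice, HasDerivAt f 0 z) {z w : ℂ} (hz : z ∉ L.lattice) (hw : w ∉ L.lattice) :
    f z = f w :=
  L.isClosed_lattice.isOpen_compl.is_const_of_deriv_eq_zero
    (isPreconnected_compl_of_countable (countable_lattice L))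
    (fun z hz => (hf z hz).differentiableAt.differentiableWithinAt)
    (fun z hz => (hf z hz).deriv) hz hw

theorem zetaW_neg (z : ℂ) : zetaW L (-z) = -zetaW L z := by
  have h : (fun z => sigma L (-z)) = fun z => -sigma L z := funext (sigma_neg L)
  have h1 : deriv (sigma L) (-z) = deriv (sigma L) z := by
    have h2 := congrArg (fun f => deriv f z) h
    simp only [deriv_comp_neg, deriv.fun_neg] at h2
    exact neg_injective h2
  rw [zetaW, zetaW, h1, sigma_neg, div_neg]

/-- The difference has derivative ℘(z) − ℘(z + ω) = 0 on the connected complement of the lattice.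
Oddness at z = −ω/2 identifies the constant. -/
theorem zetaW_add_per (a : Fin 2) {z : ℂ} (hz : z ∉ L.lattice) :
    zetaW L (z + per L a) = zetaW L z + qper L a := by
  have key : ∀ z ∉ L.lattice,
      HasDerivAt (fun z => zetaW L (z + per L a) - zetaW L z) 0 z := by
    intro z hz
    have hz' : z + per L a ∉ L.lattice := by rwa [notMem_add_lattice (per_mem L a)]
    have h := ((hasDerivAt_zetaW L hz').comp_add_const z (per L a)).fun_sub (hasDerivAt_zetaW L hz)
    refine h.congr_deriv ?_
    have := L.weierstrassP_add_coe z ⟨per L a, per_mem L a⟩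
    simp only at this
    rw [this, sub_self]
  have hm : -(per L a / 2) ∉ L.lattice := by
    rw [neg_mem_iff]; exact per_half_notMem L a
  have h := apply_eq_of_deriv_eq_zero_compl_lattice key hz hm
  have e : -(per L a / 2) + per L a = per L a / 2 := by ring
  simp only [e, zetaW_neg] at h
  rw [qper]
  linear_combination h

theorem hasDerivAt_sigma (z : ℂ) : HasDerivAt (sigma L) (deriv (sigma L) z) z :=
  (differentiable_sigma L z).hasDerivAt

theorem deriv_sigma_eq {z : ℂ} (hz : z ∉ L.lattice) :
    deriv (sigma L) z = zetaW L z * sigma L z := by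
  rw [zetaW, div_mul_cancel₀ _ (sigma_ne_zero L hz)]

/-- The quotient of the two sides has zero derivative by `zetaW_add_per`; the constant is again read
off at −ω/2, where oddness of σ produces the minus sign. -/
theorem sigma_add_per_of_notMem (a : Fin 2) {z : ℂ} (hz : z ∉ L.lattice) :
    sigma L (z + per L a) = -exp (qper L a * (z + per L a / 2)) * sigma L z := by
  have key : ∀ z ∉ L.lattice, HasDerivAt
      (fun z => sigma L (z + per L a) / sigma L z * exp (-(qper L a * z))) 0 z := by
    intro z hz
    have hz' : z + per L a ∉ L.lattice := by rwa [notMem_add_lattice (per_mem L a)]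
    have h0 := sigma_ne_zero L hz
    have h1 := (hasDerivAt_sigma (L := L) (z + per L a)).comp_add_const z (per L a)
    have h2 := (h1.fun_div (hasDerivAt_sigma z) h0).fun_mul
      (((hasDerivAt_id' z).const_mul (qper L a)).fun_neg.cexp)
    refine h2.congr_deriv ?_
    rw [deriv_sigma_eq hz, deriv_sigma_eq hz', zetaW_add_per a hz]
    field_simp
    ring
  have hm : -(per L a / 2) ∉ L.lattice := by
    rw [neg_mem_iff]; exact per_half_notMem L a
  have h := apply_eq_of_deriv_eq_zero_compl_lattice key hz hm
  have e : -(per L a / 2) + per L a = per L a / 2 := by ring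
  have h0 := sigma_ne_zero L hz
  simp only [e, sigma_neg, div_neg, div_self (sigma_ne_zero L (per_half_notMem L a))] at h
  have h3 : sigma L (z + per L a) = (sigma L (z + per L a) / sigma L z * exp (-(qper L a * z))) *
      exp (qper L a * z) * sigma L z := by
    rw [mul_assoc (sigma L (z + per L a) / sigma L z), ← exp_add]
    field_simp
    simp
  rw [h3, h]
  rw [show qper L a * (z + per L a / 2) = -(qper L a * -(per L a / 2)) + qper L a * z by ring,
    exp_add]
  ring

theorem sigma_eq_zero_iff {z : ℂ} : sigma L z = 0 ↔ z ∈ L.lattice := by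
  constructor
  · intro h; by_contra hz; exact sigma_ne_zero L hz h
  · intro h
    have hdense : Dense ((L.lattice : Set ℂ)ᶜ) := (countable_lattice L).dense_compl ℝ
    have hquasi : ∀ a z, sigma L (z + per L a) =
        -exp (qper L a * (z + per L a / 2)) * sigma L z := by
      intro a
      have hc := (differentiable_sigma L).continuous
      refine fun z => congrFun (Continuous.ext_on hdense ?_ ?_
        fun z hz => sigma_add_per_of_notMem a hz) z
      · fun_prop
      · fun_prop
    have := mem_iff_add_lattice (S := {w | sigma L w = 0}) (L := L)
      (fun a z => by simp [hquasi, exp_ne_zero]) h 0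
    simpa [sigma_zero] using this

theorem sigma_add_per (a : Fin 2) (z : ℂ) :
    sigma L (z + per L a) = -exp (qper L a * (z + per L a / 2)) * sigma L z := by
  by_cases hz : z ∈ L.lattice
  · rw [sigma_eq_zero_iff.mpr hz, sigma_eq_zero_iff.mpr (add_mem hz (per_mem L a)), mul_zero]
  · exact sigma_add_per_of_notMem a hz

/-- Differentiating the quasi-periodicity at a zero leaves only a nonzero factor, so σ'(0) = 1 is
carried to every lattice point. -/
theorem deriv_sigma_ne_zero {z : ℂ} (hz : z ∈ L.lattice) : deriv (sigma L) z ≠ 0 := by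
  have key : ∀ a z, sigma L z = 0 → deriv (sigma L) (z + per L a) =
      -exp (qper L a * (z + per L a / 2)) * deriv (sigma L) z := by
    intro a z hz
    have h1 := (hasDerivAt_sigma (L := L) (z + per L a)).comp_add_const z (per L a)
    have h2 := ((((hasDerivAt_id' z).add_const (per L a / 2)).const_mul (qper L a)).cexp.fun_neg).fun_mul
      (hasDerivAt_sigma (L := L) z)
    simp_rw [← sigma_add_per] at h2
    rw [h1.unique h2, hz]
    ring
  have := mem_iff_add_lattice (S := {w | w ∈ L.lattice ∧ deriv (sigma L) w ≠ 0}) (L := L)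
      (fun a z => by
        simp only [Set.mem_ofPred_eq, notMem_add_lattice (per_mem L a)]
        refine and_congr_right fun hz => ?_
        rw [key a z (sigma_eq_zero_iff.mpr hz)]
        simp [exp_ne_zero]) hz 0
  rw [zero_add] at this
  exact (this.mpr ⟨zero_mem _, by simp [deriv_sigma_zero]⟩).2

/-! ### Entire functions -/

theorem entire_eq_zero_of_mul {f g : ℂ → ℂ} (hf : Differentiable ℂ f) (hg : Differentiable ℂ g)
    (h : ∀ z, f z * g z = 0) (z₀ : ℂ) (hz₀ : f z₀ ≠ 0) : ∀ z, g z = 0 := by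
  have := AnalyticOnNhd.eq_zero_or_eq_zero_of_mul_eq_zero (U := Set.univ) (f := f) (g := g)
    (fun z _ => hf.analyticAt z) (fun z _ => hg.analyticAt z) (fun z _ => h z)
    isPreconnected_univ
  rcases this with h | h
  · exact absurd (h z₀ trivial) hz₀
  · exact fun z => h z trivial

/-- At a simple zero of t the singularity of f / t is removable, with value f' / t' there. -/
theorem entire_dvd {f t : ℂ → ℂ} (hf : Differentiable ℂ f) (ht : Differentiable ℂ t)
    (h : ∀ z, t z = 0 → deriv t z ≠ 0 ∧ f z = 0) :
    ∃ g, Differentiable ℂ g ∧ ∀ z, f z = t z * g z := by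
  refine ⟨fun z => if t z = 0 then deriv f z / deriv t z else f z / t z, ?_, ?_⟩
  · intro z₀
    by_cases h0 : t z₀ = 0
    · obtain ⟨h1, h2⟩ := h z₀ h0
      have hdf : Differentiable ℂ (dslope f z₀) := fun z =>
        ((differentiableOn_dslope (s := Set.univ) univ_mem).mpr hf.differentiableOn).differentiableAt
          univ_mem
      have hdt : Differentiable ℂ (dslope t z₀) := fun z =>
        ((differentiableOn_dslope (s := Set.univ) univ_mem).mpr ht.differentiableOn).differentiableAt
          univ_mem
      have hne : dslope t z₀ z₀ ≠ 0 := by rwa [dslope_same]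
      have hev : ∀ᶠ z in 𝓝 z₀, dslope t z₀ z ≠ 0 :=
        (hdt z₀).continuousAt.eventually_ne hne
      refine ((hdf z₀).fun_div (hdt z₀) hne).congr_of_eventuallyEq ?_
      filter_upwards [hev] with z hz
      by_cases hzz : z = z₀
      · subst hzz; simp [h0, dslope_same]
      · have e1 : f z = (z - z₀) * dslope f z₀ z := by
          have := sub_smul_dslope f z₀ z
          rw [h2, sub_zero, smul_eq_mul] at this
          exact this.symm
        have e2 : t z = (z - z₀) * dslope t z₀ z := by
          have := sub_smul_dslope t z₀ z
          rw [h0, sub_zero, smul_eq_mul] at this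
          exact this.symm
        have hz1 : z - z₀ ≠ 0 := sub_ne_zero.mpr hzz
        rw [if_neg (by rw [e2]; exact mul_ne_zero hz1 hz), e1, e2]
        field_simp
    · have hev : ∀ᶠ z in 𝓝 z₀, t z ≠ 0 := (ht z₀).continuousAt.eventually_ne h0
      refine ((hf z₀).fun_div (ht z₀) h0).congr_of_eventuallyEq ?_
      filter_upwards [hev] with z hz
      simp [hz]
  · intro z
    by_cases h0 : t z = 0
    · simp [h0, (h z h0).2]
    · simp only [h0, if_false]; field_simp

theorem isBounded_range_of_periodic {f : ℂ → ℂ} (hf : Continuous f)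
    (hper : ∀ a z, f (z + per L a) = f z) : Bornology.IsBounded (Set.range f) := by
  have hb : Bornology.IsBounded (ZSpan.fundamentalDomain L.basis) :=
    ZSpan.fundamentalDomain_isBounded L.basis
  obtain ⟨R, hR⟩ := hb.subset_closedBall 0
  refine ((isCompact_closedBall (0 : ℂ) R).image hf).isBounded.subset ?_
  rintro _ ⟨z, rfl⟩
  refine ⟨ZSpan.fract L.basis z, hR (ZSpan.fract_mem_fundamentalDomain _ _), ?_⟩
  have hfl : ((ZSpan.floor L.basis z : Submodule.span ℤ (Set.range L.basis)) : ℂ) ∈ L.lattice := by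
    rw [L.lattice_eq_span_range_basis]; exact (ZSpan.floor L.basis z).2
  rw [← apply_add_lattice hper hfl, ZSpan.fract_apply, sub_add_cancel]

theorem eq_const_of_periodic {f : ℂ → ℂ} (hf : Differentiable ℂ f)
    (hper : ∀ a z, f (z + per L a) = f z) (z w : ℂ) : f z = f w :=
  hf.apply_eq_apply_of_bounded (isBounded_range_of_periodic hf.continuous hper) z w

/-- The multipliers at z and −z cancel, so the product is an entire elliptic function. No multiplier
has to be nonzero. -/
theorem bloch_mul_neg_const {f : ℂ → ℂ} (hf : Differentiable ℂ f) {B : Fin 2 → ℂ}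
    (hB : ∀ a z, f (z + per L a) = B a * f z) (z w : ℂ) : f z * f (-z) = f w * f (-w) := by
  refine eq_const_of_periodic (L := L) (f := fun z => f z * f (-z)) (by fun_prop) ?_ z w
  intro a z
  have := hB a (-(z + per L a))
  rw [show -(z + per L a) + per L a = -z by ring] at this
  simp only [this, hB]
  ring

theorem bloch_eq_zero {f : ℂ → ℂ} (hf : Differentiable ℂ f) {B : Fin 2 → ℂ}
    (hB : ∀ a z, f (z + per L a) = B a * f z) {z₀ : ℂ} (h₀ : f z₀ = 0) (z : ℂ) : f z = 0 := by
  by_contra hz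
  have h : ∀ w, f w * f (-w) = 0 := fun w => by
    rw [bloch_mul_neg_const hf hB w z₀, h₀, zero_mul]
  have := entire_eq_zero_of_mul (g := fun w => f (-w)) hf (by fun_prop) h z hz (-z)
  simp only [neg_neg] at this
  exact hz this

/-- Either f has a zero and vanishes, or f'/f is entire and elliptic, hence constant. -/
theorem bloch_eq_exp {f : ℂ → ℂ} (hf : Differentiable ℂ f) {B : Fin 2 → ℂ}
    (hB : ∀ a z, f (z + per L a) = B a * f z) :
    ∃ c b, ∀ z, f z = c * exp (b * z) := by
  by_cases h0 : ∃ z₀, f z₀ = 0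
  · obtain ⟨z₀, h₀⟩ := h0
    exact ⟨0, 0, fun z => by rw [bloch_eq_zero hf hB h₀ z, zero_mul]⟩
  push Not at h0
  have hdf : Differentiable ℂ (deriv f) := fun z => (hf.analyticAt z).deriv.differentiableAt
  have hper : ∀ a z, (fun z => deriv f z / f z) (z + per L a) = (fun z => deriv f z / f z) z := by
    intro a z
    have h1 : deriv f (z + per L a) = B a * deriv f z := by
      have h2 := (hf (z + per L a)).hasDerivAt.comp_add_const z (per L a)
      simp only [hB] at h2
      exact h2.unique ((hf z).hasDerivAt.const_mul (B a))
    have hBa : B a ≠ 0 := fun h => h0 (z + per L a) (by rw [hB, h, zero_mul])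
    simp only [h1, hB]
    exact mul_div_mul_left _ _ hBa
  have hconst := eq_const_of_periodic (L := L) (f := fun z => deriv f z / f z)
    (fun z => (hdf z).fun_div (hf z) (h0 z)) hper
  set b := deriv f 0 / f 0 with hb
  refine ⟨f 0, b, fun z => ?_⟩
  have hd : ∀ z, HasDerivAt (fun z => f z * exp (-(b * z))) 0 z := by
    intro z
    refine ((hf z).hasDerivAt.fun_mul (((hasDerivAt_id' z).const_mul b).fun_neg.cexp)).congr_deriv ?_
    have h3 : deriv f z = b * f z := by
      have : deriv f z / f z = b := hconst z 0
      rw [← this, div_mul_cancel₀ _ (h0 z)]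
    rw [h3]; ring
  have := is_const_of_deriv_eq_zero (fun z => (hd z).differentiableAt) (fun z => (hd z).deriv) z 0
  simp only [mul_zero, neg_zero, exp_zero, mul_one] at this
  rw [← this, mul_assoc, ← exp_add]
  simp

/-! ### Theta functions -/

variable (L) in
/-- An entire function `f` with `f (z + ω_a) = α a * exp (d * q_a * z) * f z` for the basic periods
`ω_a` and their quasi-periods `q_a`. -/
structure IsTheta (d : ℂ) (α : Fin 2 → ℂ) (f : ℂ → ℂ) : Prop where
  differentiable : Differentiable ℂ f
  add_per : ∀ a z, f (z + per L a) = α a * exp (d * qper L a * z) * f z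

variable (L) in
/-- The multiplier of `z ↦ σ (z - y)`. -/
def sigmaMul (y : ℂ) (a : Fin 2) : ℂ := -exp (qper L a * (per L a / 2 - y))

theorem sigmaMul_ne_zero (y : ℂ) (a : Fin 2) : sigmaMul L y a ≠ 0 := neg_ne_zero.mpr (exp_ne_zero _)

namespace IsTheta

variable {d d' : ℂ} {α β : Fin 2 → ℂ} {f g : ℂ → ℂ}

theorem sigma_sub (y : ℂ) : IsTheta L 1 (sigmaMul L y) (fun z => sigma L (z - y)) where
  differentiable := (differentiable_sigma L).comp (differentiable_id.sub_const y)
  add_per a z := by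
    rw [show z + per L a - y = z - y + per L a by ring, sigma_add_per, sigmaMul,
      show qper L a * (z - y + per L a / 2) =
        qper L a * (per L a / 2 - y) + 1 * qper L a * z by ring, exp_add]
    ring

theorem exp_mul (b : ℂ) : IsTheta L 0 (fun a => exp (b * per L a)) (fun z => exp (b * z)) where
  differentiable := by fun_prop
  add_per a z := by
    rw [mul_add, exp_add]; simp; ring

theorem mul (hf : IsTheta L d α f) (hg : IsTheta L d' β g) :
    IsTheta L (d + d') (fun a => α a * β a) (fun z => f z * g z) where
  differentiable := hf.differentiable.mul hg.differentiable
  add_per a z := by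
    rw [hf.add_per, hg.add_per, add_mul, add_mul, exp_add]; ring

theorem add (hf : IsTheta L d α f) (hg : IsTheta L d α g) :
    IsTheta L d α (fun z => f z + g z) where
  differentiable := hf.differentiable.add hg.differentiable
  add_per a z := by rw [hf.add_per, hg.add_per]; ring

theorem const_mul (hf : IsTheta L d α f) (c : ℂ) : IsTheta L d α (fun z => c * f z) where
  differentiable := hf.differentiable.const_mul c
  add_per a z := by rw [hf.add_per]; ring

theorem sub (hf : IsTheta L d α f) (hg : IsTheta L d α g) :
    IsTheta L d α (fun z => f z - g z) where
  differentiable := hf.differentiable.sub hg.differentiable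
  add_per a z := by rw [hf.add_per, hg.add_per]; ring

theorem sum {ι : Type*} (s : Finset ι) {f : ι → ℂ → ℂ} (hf : ∀ i ∈ s, IsTheta L d α (f i)) :
    IsTheta L d α (fun z => ∑ i ∈ s, f i z) where
  differentiable := Differentiable.fun_sum fun i hi => (hf i hi).differentiable
  add_per a z := by
    rw [Finset.mul_sum]; exact Finset.sum_congr rfl fun i hi => (hf i hi).add_per a z

theorem prod {ι : Type*} (s : Finset ι) {d : ι → ℂ} {α : ι → Fin 2 → ℂ} {f : ι → ℂ → ℂ}
    (hf : ∀ i ∈ s, IsTheta L (d i) (α i) (f i)) :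
    IsTheta L (∑ i ∈ s, d i) (fun a => ∏ i ∈ s, α i a) (fun z => ∏ i ∈ s, f i z) where
  differentiable := Differentiable.fun_finsetProd fun i hi => (hf i hi).differentiable
  add_per a z := by
    rw [Finset.sum_mul, Finset.sum_mul, exp_sum, ← Finset.prod_mul_distrib,
      ← Finset.prod_mul_distrib]
    exact Finset.prod_congr rfl fun i hi => (hf i hi).add_per a z

theorem comp_add (hf : IsTheta L d α f) (t : ℂ) :
    IsTheta L d (fun a => α a * exp (d * qper L a * t)) (fun z => f (z + t)) where
  differentiable := hf.differentiable.comp (differentiable_id.add_const t)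
  add_per a z := by
    rw [show z + per L a + t = z + t + per L a by ring, hf.add_per, mul_add, exp_add]; ring

/-- The transformation law of the product yields that of g after cancelling f, which is not
identically zero. -/
theorem of_mul (hf : IsTheta L d α (fun z => f z * g z)) (hfβ : IsTheta L d' β f)
    (hβ : ∀ a, β a ≠ 0) (hg : Differentiable ℂ g) {z₀ : ℂ} (hz₀ : f z₀ ≠ 0) :
    IsTheta L (d - d') (fun a => α a / β a) g where
  differentiable := hg
  add_per a z := by
    have hf' := hfβ.differentiable
    have key : ∀ z, f z * (β a * exp (d' * qper L a * z) * g (z + per L a) -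
        α a * exp (d * qper L a * z) * g z) = 0 := by
      intro z
      have h1 := hf.add_per a z
      simp only [hfβ.add_per] at h1
      linear_combination h1
    have := entire_eq_zero_of_mul hf' (by fun_prop) key z₀ hz₀ z
    rw [sub_mul, sub_mul, exp_sub]
    have h1 := hβ a
    have h2 := exp_ne_zero (d' * qper L a * z)
    generalize exp (d' * qper L a * z) = E at this h2 ⊢
    generalize exp (d * qper L a * z) = F at this ⊢
    field_simp
    linear_combination this

theorem congr {d₁ : ℂ} {α₁ : Fin 2 → ℂ} (hf : IsTheta L d α f) (hd : d = d₁) (hα : ∀ a, α a = α₁ a) :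
    IsTheta L d₁ α₁ f := by
  obtain rfl : α = α₁ := funext hα
  exact hd ▸ hf

theorem eq_zero_add_lattice (hf : IsTheta L d α f) (hα : ∀ a, α a ≠ 0) {z w : ℂ} (hz : f z = 0)
    (h : w - z ∈ L.lattice) : f w = 0 := by
  have := mem_iff_add_lattice (S := {w | f w = 0}) (L := L)
    (fun a z => by simp [hf.add_per, hα, exp_ne_zero]) h z
  rw [add_sub_cancel] at this
  exact this.mpr hz

/-- An elliptic function without poles that has a zero vanishes. -/
theorem eq_zero (hf : IsTheta L 0 α f) {z₀ : ℂ} (h : f z₀ = 0) (z : ℂ) : f z = 0 :=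
  bloch_eq_zero hf.differentiable (B := α) (fun a z => by rw [hf.add_per]; simp) h z

theorem dvd_sigma (hf : IsTheta L d α f) (hα : ∀ a, α a ≠ 0) {y : ℂ} (hy : f y = 0) :
    ∃ g, IsTheta L (d - 1) (fun a => α a / sigmaMul L y a) g ∧ ∀ z, f z = sigma L (z - y) * g z := by
  have hs := sigma_sub (L := L) y
  obtain ⟨g, hg, hfg⟩ := entire_dvd hf.differentiable hs.differentiable (fun z hz => by
    rw [sigma_eq_zero_iff] at hz
    refine ⟨?_, hf.eq_zero_add_lattice hα hy hz⟩
    rw [deriv_comp_sub_const]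
    exact deriv_sigma_ne_zero hz)
  refine ⟨g, ?_, hfg⟩
  refine of_mul (f := fun z => sigma L (z - y)) (by rw [← funext hfg]; exact hf) hs
    (sigmaMul_ne_zero y) hg (z₀ := y + per L 0 / 2) ?_
  simpa using sigma_ne_zero L (per_half_notMem L 0)

end IsTheta

theorem isTheta_sigma : IsTheta L 1 (sigmaMul L 0) (sigma L) := by
  simpa using IsTheta.sigma_sub (L := L) 0

end

/-! ### Reflection z ↦ −z of theta functions. -/

section

variable {L : PeriodPair}

theorem IsTheta.comp_neg {d : ℂ} {α : Fin 2 → ℂ} {f : ℂ → ℂ} (hf : IsTheta L d α f)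
    (h : ∀ a, α a * α a = exp (d * qper L a * per L a)) : IsTheta L d α (fun z => f (-z)) where
  differentiable := hf.differentiable.comp differentiable_neg
  add_per a z := by
    have h1 := hf.add_per a (-(z + per L a))
    rw [show -(z + per L a) + per L a = -z by ring] at h1
    rw [h1]
    have h2 : α a * exp (d * qper L a * z) * (α a * exp (d * qper L a * -(z + per L a))) = 1 := by
      rw [mul_mul_mul_comm, h, ← exp_add, ← exp_add,
        show d * qper L a * per L a + (d * qper L a * z + d * qper L a * -(z + per L a)) = 0 by ring,
        exp_zero]
    linear_combination (-f (-(z + per L a))) * h2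

theorem sigmaMul_zero_sq (a : Fin 2) :
    sigmaMul L 0 a * sigmaMul L 0 a = exp (1 * qper L a * per L a) := by
  rw [sigmaMul, neg_mul_neg, ← exp_add]
  ring_nf

/-! ### The Legendre relation and multiplier classes -/

/-- Moving ω₀/2 by both periods in the two possible orders must give the same value of σ. This shows
only that the Legendre expression lies in 2πiℤ, which together with `legendre_ne_zero` is all that
is needed. -/
theorem exp_legendre : exp (qper L 0 * per L 1 - qper L 1 * per L 0) = 1 := by
  have h2 := sigma_add_per (L := L) 1 (per L 0 / 2 + per L 0)
  rw [show per L 0 / 2 + per L 0 + per L 1 = per L 0 / 2 + per L 1 + per L 0 by ring,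
    sigma_add_per 0 (per L 0 / 2 + per L 1), sigma_add_per 1 (per L 0 / 2),
    sigma_add_per 0 (per L 0 / 2)] at h2
  have h0 := sigma_ne_zero L (per_half_notMem L 0)
  have h3 : exp (qper L 0 * (per L 0 / 2 + per L 1 + per L 0 / 2)) *
      exp (qper L 1 * (per L 0 / 2 + per L 1 / 2)) =
      exp (qper L 1 * (per L 0 / 2 + per L 0 + per L 1 / 2)) *
      exp (qper L 0 * (per L 0 / 2 + per L 0 / 2)) := by
    apply mul_right_cancel₀ h0
    linear_combination h2
  rw [← exp_add, ← exp_add] at h3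
  rw [show qper L 0 * per L 1 - qper L 1 * per L 0 =
      (qper L 0 * (per L 0 / 2 + per L 1 + per L 0 / 2) + qper L 1 * (per L 0 / 2 + per L 1 / 2)) -
      (qper L 1 * (per L 0 / 2 + per L 0 + per L 1 / 2) +
        qper L 0 * (per L 0 / 2 + per L 0 / 2)) by ring, exp_sub, h3, div_self (exp_ne_zero _)]

theorem per_ne_zero (a : Fin 2) : per L a ≠ 0 := by
  intro h
  apply per_half_notMem L a
  simp [h]

/-- Otherwise q_a = c ω_a for one constant c, and σ(z) exp(−c z²/2) would be an entire Bloch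
function with a zero at the origin, hence zero. -/
theorem legendre_ne_zero : qper L 0 * per L 1 - qper L 1 * per L 0 ≠ 0 := by
  intro h
  set c := qper L 0 / per L 0 with hc
  have hq : ∀ a, qper L a = c * per L a := by
    have h0 := per_ne_zero (L := L) 0
    intro a
    fin_cases a
    · simp only [Fin.zero_eta, hc]; field_simp
    · simp only [Fin.mk_one, hc]; field_simp; linear_combination -h
  have hB : ∀ a z, sigma L (z + per L a) * exp (-(c / 2 * (z + per L a) ^ 2)) =
      (-1) * (sigma L z * exp (-(c / 2 * z ^ 2))) := by
    intro a z
    rw [sigma_add_per, hq, show -(c / 2 * (z + per L a) ^ 2) =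
      -(c * per L a * (z + per L a / 2)) + -(c / 2 * z ^ 2) by ring, exp_add, exp_neg]
    have := exp_ne_zero (c * per L a * (z + per L a / 2))
    generalize exp (c * per L a * (z + per L a / 2)) = E at this ⊢
    field_simp
  have hd : Differentiable ℂ (fun z => sigma L z * exp (-(c / 2 * z ^ 2))) :=
    (differentiable_sigma L).mul (by fun_prop)
  have := bloch_eq_zero (L := L) hd (B := fun _ => -1) hB (z₀ := 0)
    (by simp [sigma_zero]) (per L 0 / 2)
  exact mul_ne_zero (sigma_ne_zero L (per_half_notMem L 0)) (exp_ne_zero _) this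

/-- Taking logarithms gives a linear system for s and b whose determinant is the nonzero Legendre
expression. -/
theorem exists_class {B : Fin 2 → ℂ} (hB : ∀ a, B a ≠ 0) :
    ∃ s b, ∀ a, B a = exp (qper L a * s + b * per L a) := by
  set D := qper L 0 * per L 1 - qper L 1 * per L 0 with hD
  have hD0 : D ≠ 0 := legendre_ne_zero
  refine ⟨(log (B 0) * per L 1 - log (B 1) * per L 0) / D,
    (qper L 0 * log (B 1) - qper L 1 * log (B 0)) / D, fun a => ?_⟩
  rw [← exp_log (hB a)]
  congr 1
  fin_cases a
  · simp only [Fin.zero_eta]; field_simp; rw [hD]; ring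
  · simp only [Fin.mk_one]; field_simp; rw [hD]; ring

theorem exists_of_mem_lattice {s : ℂ} (hs : s ∈ L.lattice) :
    ∃ b, ∀ a, exp (qper L a * s + b * per L a) = 1 := by
  obtain ⟨m, n, rfl⟩ := PeriodPair.mem_lattice.mp hs
  refine ⟨-(m * qper L 0 + n * qper L 1), fun a => ?_⟩
  have hp0 : per L 0 = L.ω₁ := rfl
  have hp1 : per L 1 = L.ω₂ := rfl
  fin_cases a
  · simp only [Fin.zero_eta, ← hp0, ← hp1]
    rw [show qper L 0 * (m * per L 0 + n * per L 1) + -(m * qper L 0 + n * qper L 1) * per L 0 =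
      n * (qper L 0 * per L 1 - qper L 1 * per L 0) by ring, exp_int_mul, exp_legendre, one_zpow]
  · simp only [Fin.mk_one, ← hp0, ← hp1]
    rw [show qper L 1 * (m * per L 0 + n * per L 1) + -(m * qper L 0 + n * qper L 1) * per L 1 =
      ((-m : ℤ) : ℂ) * (qper L 0 * per L 1 - qper L 1 * per L 0) by push_cast; ring,
      exp_int_mul, exp_legendre, one_zpow]

/-- Here G(z) = σ(z + s) exp(bz) has the same multipliers as σ. Its odd part is a multiple of σ, and
its even part H vanishes at two inequivalent half periods. Degree 1 permits only one zero, so H = 0,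
and H(0) = σ(s). -/
theorem mem_lattice_of_class_trivial {s b : ℂ}
    (h : ∀ a, exp (qper L a * s + b * per L a) = 1) : s ∈ L.lattice := by
  have hG : IsTheta L 1 (sigmaMul L 0) (fun z => sigma L (z + s) * exp (b * z)) := by
    refine ((isTheta_sigma.comp_add s).mul (IsTheta.exp_mul b)).congr (by ring) fun a => ?_
    have := h a
    rw [exp_add] at this
    rw [one_mul, mul_assoc, this, mul_one]
  set G : ℂ → ℂ := fun z => sigma L (z + s) * exp (b * z) with hGdef
  have hGneg : IsTheta L 1 (sigmaMul L 0) (fun z => G (-z)) :=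
    hG.comp_neg sigmaMul_zero_sq
  obtain ⟨K, hK, hGK⟩ := (hG.sub hGneg).dvd_sigma (sigmaMul_ne_zero 0) (y := 0) (by simp)
  have hKc : ∀ z, K z = K 0 := fun z => by
    have h2 : ∀ a z, K (z + per L a) = K z := fun a z => by
      rw [hK.add_per]; simp [div_self (sigmaMul_ne_zero (L := L) 0 a)]
    exact eq_const_of_periodic hK.differentiable h2 z 0
  have hodd : ∀ z, G z - G (-z) = K 0 * sigma L z := fun z => by
    rw [hGK z, hKc, sub_zero, mul_comm]
  set H : ℂ → ℂ := fun z => G z - K 0 / 2 * sigma L z with hHdef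
  have hH : IsTheta L 1 (sigmaMul L 0) H := hG.sub (isTheta_sigma.const_mul (K 0 / 2))
  have hHhalf : ∀ a, H (per L a / 2) = 0 := by
    intro a
    have h1 := hH.add_per a (-(per L a / 2))
    have h2 : H (-(per L a / 2)) = H (per L a / 2) := by
      simp only [hHdef, sigma_neg]
      linear_combination -hodd (per L a / 2)
    rw [show -(per L a / 2) + per L a = per L a / 2 by ring, h2, sigmaMul, neg_mul, ← exp_add,
      show qper L a * (per L a / 2 - 0) + 1 * qper L a * -(per L a / 2) = 0 by ring, exp_zero] at h1
    linear_combination h1 / 2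
  obtain ⟨M, hM, hHM⟩ := hH.dvd_sigma (sigmaMul_ne_zero 0) (hHhalf 0)
  have hM0 : M (per L 1 / 2) = 0 := by
    have := hHhalf 1
    rw [hHM] at this
    exact (mul_eq_zero.mp this).resolve_left (sigma_ne_zero L (per_half_sub_notMem L))
  have hMz := (hM.congr (sub_self 1) (fun a => rfl)).eq_zero hM0
  have : H 0 = 0 := by rw [hHM, hMz, mul_zero]
  simp only [hHdef, hGdef, sigma_zero] at this
  simpa [sigma_eq_zero_iff] using this

/-- A double-Bloch function without poles vanishes if its multipliers are not in the trivial
class. -/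
theorem IsTheta.eq_zero_of_class {f : ℂ → ℂ} {s b : ℂ}
    (hf : IsTheta L 0 (fun a => exp (qper L a * s + b * per L a)) f) (hs : s ∉ L.lattice) (z : ℂ) :
    f z = 0 := by
  by_contra hz
  obtain ⟨c, b', hfe⟩ := bloch_eq_exp hf.differentiable
    (B := fun a => exp (qper L a * s + b * per L a)) (fun a z => by rw [hf.add_per]; simp)
  have hc : c ≠ 0 := by rintro rfl; exact hz (by rw [hfe]; simp)
  refine hs (mem_lattice_of_class_trivial (L := L) (b := b - b') fun a => ?_)
  have h1 := hf.add_per a 0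
  rw [hfe, hfe] at h1
  simp only [zero_add, mul_zero, exp_zero, mul_one] at h1
  have h2 : exp (b' * per L a) = exp (qper L a * s + b * per L a) :=
    mul_left_cancel₀ hc (by linear_combination h1)
  rw [show qper L a * s + (b - b') * per L a = qper L a * s + b * per L a - b' * per L a by ring,
    exp_sub, h2, div_self (exp_ne_zero _)]

/-! ### Products of sigma functions -/

section tau

variable {N : ℕ} {y : Fin N → ℂ}

variable (L) in
/-- The multiplier of `tau L y`. -/
def tauMul (y : Fin N → ℂ) (a : Fin 2) : ℂ := ∏ i, sigmaMul L (y i) a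

theorem tauMul_ne_zero (y : Fin N → ℂ) (a : Fin 2) : tauMul L y a ≠ 0 :=
  Finset.prod_ne_zero_iff.mpr fun _ _ => sigmaMul_ne_zero _ _

theorem isTheta_tau (y : Fin N → ℂ) : IsTheta L N (tauMul L y) (tau L y) :=
  (IsTheta.prod Finset.univ fun i _ => IsTheta.sigma_sub (y i)).congr (by simp) fun _ => rfl

theorem tau_eq_zero_iff {z : ℂ} : tau L y z = 0 ↔ z ∈ poles L y := by
  simp [tau, poles, Finset.prod_eq_zero_iff, sigma_eq_zero_iff]

theorem tau_ne_zero {z : ℂ} (h : ∀ i, z - y i ∉ L.lattice) : tau L y z ≠ 0 := by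
  rw [Ne, tau_eq_zero_iff]
  rintro ⟨i, hi⟩
  exact h i hi

theorem tau_apply_self (y : Fin N → ℂ) (i : Fin N) : tau L y (y i) = 0 :=
  tau_eq_zero_iff.mpr ⟨i, by simp⟩

/-- Passing from one set of zeros to another shifts the class by the difference of their sums. -/
theorem tauMul_eq (y y' : Fin N → ℂ) (a : Fin 2) :
    tauMul L y a = tauMul L y' a * exp (qper L a * ∑ i, (y' i - y i)) := by
  rw [tauMul, tauMul, Finset.mul_sum, exp_sum, ← Finset.prod_mul_distrib]
  refine Finset.prod_congr rfl fun i _ => ?_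
  rw [sigmaMul, sigmaMul, neg_mul, ← exp_add]
  ring_nf

theorem countable_poles (y : Fin N → ℂ) : (poles L y).Countable := by
  have : poles L y = ⋃ i, (fun z => z - y i) ⁻¹' (L.lattice : Set ℂ) := by
    ext z; simp [poles]
  rw [this]
  exact Set.countable_iUnion fun i =>
    (countable_lattice L).preimage_of_injOn (sub_left_injective.injOn)

/-- The sigma factors are split off one at a time; since the points are inequivalent, the quotient
still vanishes at the remaining ones. -/
theorem IsTheta.dvd_tau {d : ℂ} {α : Fin 2 → ℂ} {f : ℂ → ℂ} (hf : IsTheta L d α f)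
    (hα : ∀ a, α a ≠ 0) (hy : ∀ i j, i ≠ j → y i - y j ∉ L.lattice) (h : ∀ i, f (y i) = 0) :
    ∃ g, IsTheta L (d - N) (fun a => α a / tauMul L y a) g ∧ ∀ z, f z = tau L y z * g z := by
  have key : ∀ s : Finset (Fin N), ∃ g, IsTheta L (d - s.card)
      (fun a => α a / ∏ i ∈ s, sigmaMul L (y i) a) g ∧
      ∀ z, f z = (∏ i ∈ s, sigma L (z - y i)) * g z := by
    intro s
    induction s using Finset.induction_on with
    | empty => exact ⟨f, hf.congr (by simp) (by simp), by simp⟩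
    | insert i s hi ih =>
      obtain ⟨g, hg, hfg⟩ := ih
      have hgi : g (y i) = 0 := by
        have h1 := h i
        rw [hfg] at h1
        refine (mul_eq_zero.mp h1).resolve_left (Finset.prod_ne_zero_iff.mpr fun j hj => ?_)
        exact sigma_ne_zero L (hy i j (by rintro rfl; exact hi hj))
      obtain ⟨g', hg', hgg⟩ := hg.dvd_sigma
        (fun a => div_ne_zero (hα a) (Finset.prod_ne_zero_iff.mpr fun _ _ => sigmaMul_ne_zero _ _))
        hgi
      refine ⟨g', hg'.congr ?_ fun a => ?_, fun z => ?_⟩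
      · rw [Finset.card_insert_of_notMem hi]; push_cast; ring
      · rw [Finset.prod_insert hi, div_div, mul_comm]
      · rw [hfg, hgg, Finset.prod_insert hi]; ring
  obtain ⟨g, hg, hfg⟩ := key Finset.univ
  exact ⟨g, hg.congr (by simp) (fun _ => rfl), hfg⟩

variable (L) in
/-- The derivative of `tau L y` at `y i`. -/
def tauDeriv (y : Fin N → ℂ) (i : Fin N) : ℂ := ∏ l ∈ Finset.univ.erase i, sigma L (y i - y l)

theorem tauDeriv_ne_zero (hy : ∀ i j, i ≠ j → y i - y j ∉ L.lattice) (i : Fin N) :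
    tauDeriv L y i ≠ 0 :=
  Finset.prod_ne_zero_iff.mpr fun l hl => sigma_ne_zero L (hy i l (Finset.ne_of_mem_erase hl).symm)

variable (L) in
/-- The numerator of the double-Bloch function of class `s` with residues `c` at the points `y`. -/
def interp (s : ℂ) (y c : Fin N → ℂ) (z : ℂ) : ℂ :=
  ∑ j, c j * (sigma L (z - y j + s) / sigma L s * ∏ l ∈ Finset.univ.erase j, sigma L (z - y l))

theorem isTheta_interp (s : ℂ) (y c : Fin N → ℂ) :
    IsTheta L N (fun a => tauMul L y a * exp (qper L a * s)) (interp L s y c) := by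
  refine IsTheta.sum _ fun j _ => IsTheta.const_mul ?_ _
  have h1 := ((IsTheta.sigma_sub (L := L) (y j)).comp_add s).const_mul (sigma L s)⁻¹
  have h2 := IsTheta.prod (Finset.univ.erase j) fun l _ => IsTheta.sigma_sub (L := L) (y l)
  have h3 := (h1.mul h2).congr (d₁ := N) (α₁ := fun a => tauMul L y a * exp (qper L a * s)) ?_ ?_
  · convert h3 using 3 with z
    rw [div_eq_inv_mul, show z - y j + s = z + s - y j by ring]
  · rw [Finset.sum_const, Finset.card_erase_of_mem (Finset.mem_univ j)]
    have : 0 < N := j.pos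
    simp only [Finset.card_univ, Fintype.card_fin, nsmul_eq_mul, mul_one]
    rw [Nat.cast_pred this]; ring
  · intro a
    rw [tauMul, ← Finset.mul_prod_erase _ _ (Finset.mem_univ j), one_mul]
    ring

theorem interp_apply_self {s : ℂ} (hs : s ∉ L.lattice) (y c : Fin N → ℂ) (i : Fin N) :
    interp L s y c (y i) = c i * tauDeriv L y i := by
  rw [interp, Finset.sum_eq_single i]
  · simp [tauDeriv, div_self (sigma_ne_zero L hs)]
  · intro j _ hj
    rw [Finset.prod_eq_zero (Finset.mem_erase.mpr ⟨hj.symm, Finset.mem_univ i⟩)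
      (by simp [sigma_zero])]
    simp
  · simp

theorem interp_eq {s : ℂ} (y c : Fin N → ℂ) {z : ℂ} (hz : z ∉ poles L y) :
    interp L s y c z =
      tau L y z * ∑ j, c j * (sigma L (z - y j + s) / (sigma L s * sigma L (z - y j))) := by
  rw [interp, Finset.mul_sum]
  refine Finset.sum_congr rfl fun j _ => ?_
  have : sigma L (z - y j) ≠ 0 := sigma_ne_zero L fun h => hz ⟨j, h⟩
  rw [tau, ← Finset.mul_prod_erase _ _ (Finset.mem_univ j), mul_comm (sigma L s), ← div_div]
  field_simp

/-- Uniqueness of interpolation: the quotient by τ has degree 0 and class s ∉ Λ. -/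
theorem IsTheta.eq_zero_of_forall {s b : ℂ} {g : ℂ → ℂ}
    (hg : IsTheta L N (fun a => tauMul L y a * exp (qper L a * s + b * per L a)) g)
    (hs : s ∉ L.lattice)
    (hy : ∀ i j, i ≠ j → y i - y j ∉ L.lattice) (h : ∀ i, g (y i) = 0) (z : ℂ) : g z = 0 := by
  obtain ⟨k, hk, hgk⟩ := hg.dvd_tau (fun a => mul_ne_zero (tauMul_ne_zero _ _) (exp_ne_zero _)) hy h
  have := (hk.congr (α₁ := fun a => exp (qper L a * s + b * per L a)) (sub_self _) fun a =>
    mul_div_cancel_left₀ _ (tauMul_ne_zero _ _)).eq_zero_of_class hs z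
  rw [hgk, this, mul_zero]

theorem IsTheta.eq_interp {s : ℂ} {g : ℂ → ℂ}
    (hg : IsTheta L N (fun a => tauMul L y a * exp (qper L a * s)) g) (hs : s ∉ L.lattice)
    (hy : ∀ i j, i ≠ j → y i - y j ∉ L.lattice) (z : ℂ) :
    g z = interp L s y (fun i => g (y i) / tauDeriv L y i) z := by
  have h := (hg.sub (isTheta_interp s y (fun i => g (y i) / tauDeriv L y i)))
  have h' := (h.congr (α₁ := fun a => tauMul L y a * exp (qper L a * s + 0 * per L a)) rfl
    (by simp)).eq_zero_of_forall hs hy (fun i => by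
      rw [interp_apply_self hs, div_mul_cancel₀ _ (tauDeriv_ne_zero hy i), sub_self]) z
  exact sub_eq_zero.mp h'

end tau

end

section

variable {L : PeriodPair}

/-! ### The functions `coordU` and `coordV` -/

variable (L) in
/-- The common denominator of `coordU` and `coordV`. -/
def den (η z : ℂ) : ℂ := sigma L (z + η) * sigma L (z - η)

theorem den_ne_zero_iff {η z : ℂ} : den L η z ≠ 0 ↔ Regular L η z := by
  simp [den, Regular, sigma_eq_zero_iff, not_or, and_comm]

theorem den_neg (η z : ℂ) : den L η (-z) = den L η z := by
  rw [den, den, show -z + η = -(z - η) by ring, show -z - η = -(z + η) by ring, sigma_neg, sigma_neg]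
  ring

theorem den_zero (η : ℂ) : den L η 0 = -sigma L η ^ 2 := by
  rw [den, zero_add, zero_sub, sigma_neg]; ring

theorem isTheta_den (η : ℂ) : IsTheta L 2 (fun a => sigmaMul L 0 a ^ 2) (den L η) := by
  have h1 := (isTheta_sigma (L := L)).comp_add η
  have h2 := (isTheta_sigma (L := L)).comp_add (-η)
  refine (h1.mul h2).congr (by norm_num) fun a => ?_
  rw [mul_mul_mul_comm, ← exp_add, show 1 * qper L a * η + 1 * qper L a * -η = 0 by ring, exp_zero]
  ring

theorem IsTheta.pow {d : ℂ} {α : Fin 2 → ℂ} {f : ℂ → ℂ} (hf : IsTheta L d α f) (n : ℕ) :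
    IsTheta L (n * d) (fun a => α a ^ n) (fun z => f z ^ n) where
  differentiable := hf.differentiable.pow n
  add_per a z := by
    rw [hf.add_per, mul_pow, mul_pow, ← exp_nat_mul]; ring_nf

theorem IsTheta.comp_neg_of_even {n : ℕ} {g : ℂ → ℂ}
    (hg : IsTheta L (2 * n) (fun a => sigmaMul L 0 a ^ (2 * n)) g) :
    IsTheta L (2 * n) (fun a => sigmaMul L 0 a ^ (2 * n)) (fun z => g (-z)) := by
  refine hg.comp_neg fun a => ?_
  rw [← mul_pow, sigmaMul_zero_sq, ← exp_nat_mul]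
  push_cast; ring_nf

/-- Even theta functions of even degree are homogeneous polynomials in `σ²` and `den`. -/
theorem IsTheta.exists_polynomial_of_even {η : ℂ} (hη : η ∉ L.lattice) (n : ℕ) {g : ℂ → ℂ}
    (hg : IsTheta L (2 * n) (fun a => sigmaMul L 0 a ^ (2 * n)) g) (heven : ∀ z, g (-z) = g z) :
    ∃ p : ℂ[X], p.natDegree ≤ n ∧ ∀ z, g z =
      ∑ j ∈ Finset.range (n + 1), p.coeff j * (sigma L z ^ 2) ^ j * den L η z ^ (n - j) := by
  induction n generalizing g with
  | zero =>
    refine ⟨C (g 0), by simp, fun z => ?_⟩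
    have := eq_const_of_periodic hg.differentiable (fun a z => by rw [hg.add_per]; simp) z 0
    simp [this]
  | succ n ih =>
    have hd0 : den L η 0 ≠ 0 := by
      rw [den_zero]; exact neg_ne_zero.mpr (pow_ne_zero 2 (sigma_ne_zero L hη))
    -- With this c the difference vanishes at 0. Being even, it is divisible by σ², and the quotient
    -- is even of degree 2n.
    set c := g 0 / den L η 0 ^ (n + 1) with hc
    have h1 : IsTheta L (2 * (n + 1 : ℕ)) (fun a => sigmaMul L 0 a ^ (2 * (n + 1)))
        (fun z => g z - c * den L η z ^ (n + 1)) :=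
      hg.sub ((((isTheta_den η).pow (n + 1)).congr (by push_cast; ring)
        (fun a => by rw [← pow_mul])).const_mul c)
    obtain ⟨g₁, hg₁, hgg₁⟩ := h1.dvd_sigma (fun a => pow_ne_zero _ (sigmaMul_ne_zero _ _)) (y := 0)
      (by rw [hc]; field_simp; ring)
    simp only [sub_zero] at hgg₁
    have hodd : ∀ z, g₁ z + g₁ (-z) = 0 := by
      have hd : Differentiable ℂ fun z => g₁ z + g₁ (-z) :=
        hg₁.differentiable.add (hg₁.differentiable.comp differentiable_neg)
      refine entire_eq_zero_of_mul (differentiable_sigma L) hd (fun z => ?_) _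
        (sigma_ne_zero L (per_half_notMem L 0))
      have e1 := hgg₁ z
      have e2 := hgg₁ (-z)
      rw [heven, den_neg, sigma_neg] at e2
      linear_combination e2 - e1
    obtain ⟨g₂, hg₂, hgg₂⟩ := hg₁.dvd_sigma
      (fun a => div_ne_zero (pow_ne_zero _ (sigmaMul_ne_zero _ _)) (sigmaMul_ne_zero _ _)) (y := 0)
      (by have := hodd 0; rw [neg_zero] at this; linear_combination this / 2)
    simp only [sub_zero] at hgg₂
    have heven₂ : ∀ z, g₂ z - g₂ (-z) = 0 := by
      have hd : Differentiable ℂ fun z => g₂ z - g₂ (-z) :=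
        hg₂.differentiable.sub (hg₂.differentiable.comp differentiable_neg)
      refine entire_eq_zero_of_mul (differentiable_sigma L) hd (fun z => ?_) _
        (sigma_ne_zero L (per_half_notMem L 0))
      have e1 := hodd z
      rw [hgg₂, hgg₂, sigma_neg] at e1
      linear_combination e1
    obtain ⟨p, hp, hgp⟩ := ih (g := g₂) (hg₂.congr (by push_cast; ring) fun a => by
      have := sigmaMul_ne_zero (L := L) 0 a
      rw [div_div, div_eq_iff (mul_ne_zero this this)]; ring)
      (fun z => (sub_eq_zero.mp (heven₂ z)).symm)
    refine ⟨X * p + C c, ?_, fun z => ?_⟩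
    · refine (natDegree_add_C (p := X * p) (a := c)).le.trans ?_
      exact natDegree_mul_le.trans (by rw [natDegree_X]; omega)
    · rw [Finset.sum_range_succ']
      have h3 : ∀ j ∈ Finset.range (n + 1), (X * p + C c).coeff (j + 1) * (sigma L z ^ 2) ^ (j + 1) *
          den L η z ^ (n + 1 - (j + 1)) =
          sigma L z ^ 2 * (p.coeff j * (sigma L z ^ 2) ^ j * den L η z ^ (n - j)) := by
        intro j _
        rw [coeff_add, coeff_X_mul, coeff_C_succ, Nat.add_sub_add_right]
        ring
      rw [Finset.sum_congr rfl h3, ← Finset.mul_sum, ← hgp]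
      simp only [coeff_add, coeff_C_zero, coeff_X_mul_zero, pow_zero, tsub_zero]
      have := hgg₁ z
      rw [hgg₂] at this
      linear_combination this

theorem den_pow_mul_eval_coordU {η z : ℂ} (hz : Regular L η z) {n : ℕ} {p : ℂ[X]}
    (hp : p.natDegree ≤ n) :
    den L η z ^ n * p.eval (coordU L η z) =
      ∑ j ∈ Finset.range (n + 1), p.coeff j * (sigma L z ^ 2) ^ j * den L η z ^ (n - j) := by
  rw [eval_eq_sum_range' (Nat.lt_succ_of_le hp), Finset.mul_sum]
  refine Finset.sum_congr rfl fun j hj => ?_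
  have hd := den_ne_zero_iff.mpr hz
  have hu : coordU L η z = sigma L z ^ 2 / den L η z := rfl
  have hj' : j ≤ n := by simpa [Nat.lt_succ_iff] using hj
  rw [hu, div_pow]
  nth_rw 1 [← Nat.sub_add_cancel hj', pow_add]
  field_simp

theorem isTheta_sigma_two_mul : IsTheta L 4 (fun a => sigmaMul L 0 a ^ 4) (fun z => sigma L (2 * z)) where
  differentiable := (differentiable_sigma L).comp (differentiable_id.const_mul 2)
  add_per a z := by
    rw [show 2 * (z + per L a) = 2 * z + per L a + per L a by ring, sigma_add_per, sigma_add_per,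
      show sigmaMul L 0 a ^ 4 = (sigmaMul L 0 a * sigmaMul L 0 a) * (sigmaMul L 0 a * sigmaMul L 0 a)
        by ring, sigmaMul_zero_sq, ← exp_add, ← exp_add,
      show 1 * qper L a * per L a + 1 * qper L a * per L a + 4 * qper L a * z =
        qper L a * (2 * z + per L a + per L a / 2) + qper L a * (2 * z + per L a / 2) by ring, exp_add]
    ring

variable (L) in
/-- Representatives of the points of order two. -/
def halfPeriod : Fin 4 → ℂ := ![0, per L 0 / 2, per L 1 / 2, per L 1 / 2 + per L 0 / 2]

theorem two_mul_halfPeriod_mem (i : Fin 4) : 2 * halfPeriod L i ∈ L.lattice := by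
  have h0 := per_mem L 0
  have h1 := per_mem L 1
  fin_cases i
  · simp [halfPeriod]
  · simpa [halfPeriod, mul_div_cancel₀] using h0
  · simpa [halfPeriod, mul_div_cancel₀] using h1
  · have := add_mem h1 h0
    convert this using 1
    simp [halfPeriod]; ring

theorem halfPeriod_sub_notMem {i j : Fin 4} (hij : i ≠ j) :
    halfPeriod L i - halfPeriod L j ∉ L.lattice := by
  let α : Fin 4 → ℚ := ![0, 1 / 2, 0, 1 / 2]
  let β : Fin 4 → ℚ := ![0, 0, 1 / 2, 1 / 2]
  have hrep : ∀ i, halfPeriod L i = (α i : ℂ) * L.ω₁ + (β i : ℂ) * L.ω₂ := by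
    intro i
    fin_cases i <;> simp [halfPeriod, α, β, per] <;> ring
  have : halfPeriod L i - halfPeriod L j =
      ((α i - α j : ℚ) : ℂ) * L.ω₁ + ((β i - β j : ℚ) : ℂ) * L.ω₂ := by
    rw [hrep, hrep]; push_cast; ring
  rw [this, L.mul_ω₁_add_mul_ω₂_mem_lattice]
  fin_cases i <;> fin_cases j <;> simp_all [α, β]

theorem exists_sub_halfPeriod_mem {z : ℂ} (hz : 2 * z ∈ L.lattice) :
    ∃ i, z - halfPeriod L i ∈ L.lattice := by
  obtain ⟨m, n, h⟩ := PeriodPair.mem_lattice.mp hz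
  have hmem : ∀ a b : ℤ, (a : ℂ) * L.ω₁ + b * L.ω₂ ∈ L.lattice := fun a b =>
    PeriodPair.mem_lattice.mpr ⟨a, b, rfl⟩
  rcases Int.even_or_odd' m with ⟨a, rfl | rfl⟩ <;> rcases Int.even_or_odd' n with ⟨b, rfl | rfl⟩ <;>
    push_cast at h
  · exact ⟨0, by convert hmem a b using 1; simp [halfPeriod]; linear_combination -h / 2⟩
  · exact ⟨2, by convert hmem a b using 1; simp [halfPeriod, per]; linear_combination -h / 2⟩
  · exact ⟨1, by convert hmem a b using 1; simp [halfPeriod, per]; linear_combination -h / 2⟩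
  · exact ⟨3, by convert hmem a b using 1; simp [halfPeriod, per]; linear_combination -h / 2⟩

/-- At a half period oddness and quasi-periodicity give g = −g. Evenness of the degree makes the
factor trivial; at the sum of the half periods this also uses `exp_legendre`. -/
theorem IsTheta.eq_zero_of_odd {n : ℕ} {g : ℂ → ℂ}
    (hg : IsTheta L (2 * n) (fun a => sigmaMul L 0 a ^ (2 * n)) g) (hodd : ∀ z, g (-z) = -g z)
    {z : ℂ} (hz : 2 * z ∈ L.lattice) : g z = 0 := by
  have hmul : ∀ a, sigmaMul L 0 a ^ (2 * n) = exp (n * qper L a * per L a) := fun a => by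
    rw [pow_mul, pow_two, sigmaMul_zero_sq, ← exp_nat_mul]; ring_nf
  have hstep : ∀ a w, g (w + per L a) = exp (n * qper L a * (2 * w + per L a)) * g w := by
    intro a w
    rw [hg.add_per, hmul, ← exp_add]; ring_nf
  obtain ⟨i, hi⟩ := exists_sub_halfPeriod_mem hz
  refine hg.eq_zero_add_lattice (fun a => pow_ne_zero _ (sigmaMul_ne_zero _ _)) ?_ hi
  have hhalf : ∀ a, g (per L a / 2) = 0 := by
    intro a
    have := hstep a (-(per L a / 2))
    rw [show -(per L a / 2) + per L a = per L a / 2 by ring, hodd,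
      show (n : ℂ) * qper L a * (2 * -(per L a / 2) + per L a) = 0 by ring, exp_zero] at this
    linear_combination this / 2
  fin_cases i
  · have := hodd 0
    simp only [neg_zero] at this
    simp only [halfPeriod, Fin.zero_eta, Matrix.cons_val_zero]
    linear_combination this / 2
  · exact hhalf 0
  · exact hhalf 1
  · simp only [halfPeriod, Fin.reduceFinMk, Matrix.cons_val]
    have h1 := hstep 0 (per L 1 / 2 - per L 0 / 2)
    have h2 := hstep 1 (-(per L 1 / 2 + per L 0 / 2))
    rw [show -(per L 1 / 2 + per L 0 / 2) + per L 1 = per L 1 / 2 - per L 0 / 2 by ring, hodd] at h2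
    rw [h2, show per L 1 / 2 - per L 0 / 2 + per L 0 = per L 1 / 2 + per L 0 / 2 by ring,
      ← mul_assoc, ← exp_add, show (n : ℂ) * qper L 0 * (2 * (per L 1 / 2 - per L 0 / 2) + per L 0) +
        n * qper L 1 * (2 * -(per L 1 / 2 + per L 0 / 2) + per L 1) =
        n * (qper L 0 * per L 1 - qper L 1 * per L 0) by ring, exp_nat_mul, exp_legendre, one_pow] at h1
    linear_combination h1 / 2

/-- Theta functions of even degree, divided by the power of `den` of the same degree, are polynomials
in `coordU` and `coordV`. -/
theorem IsTheta.exists_mvPolynomial {η : ℂ} (hη : η ∉ L.lattice) {n : ℕ} {g : ℂ → ℂ}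
    (hg : IsTheta L (2 * n) (fun a => sigmaMul L 0 a ^ (2 * n)) g) :
    ∃ p : MvPolynomial (Fin 2) ℂ, ∀ z, Regular L η z →
      g z = den L η z ^ n * MvPolynomial.eval ![coordU L η z, coordV L η z] p := by
  have hneg := hg.comp_neg_of_even
  obtain ⟨p₁, hp₁, h₁⟩ := (hg.add hneg).exists_polynomial_of_even hη n
    (fun z => by rw [neg_neg, add_comm])
  -- The factor `den`² compensates for the degree 4 of σ(2z), so that the odd part of g becomes v
  -- times an even theta function k of the original degree.
  have hodd := (hg.sub hneg).mul ((isTheta_den η).pow 2)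
  replace hodd := hodd.congr (d₁ := 2 * (n + 2 : ℕ)) (α₁ := fun a => sigmaMul L 0 a ^ (2 * (n + 2)))
    (by push_cast; ring) (fun a => by ring)
  obtain ⟨k, hk, hgk⟩ := entire_dvd hodd.differentiable isTheta_sigma_two_mul.differentiable
    (fun z hz => by
      rw [sigma_eq_zero_iff] at hz
      refine ⟨?_, hodd.eq_zero_of_odd (fun z => by rw [neg_neg, den_neg]; ring) hz⟩
      have h := (hasDerivAt_sigma (L := L) (2 * z)).comp z ((hasDerivAt_id' z).const_mul 2)
      have h' : deriv (fun z => sigma L (2 * z)) z = _ := h.deriv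
      rw [h']
      simpa using deriv_sigma_ne_zero hz)
  have hne : sigma L (2 * (per L 0 / 4)) ≠ 0 := by
    rw [show 2 * (per L 0 / 4) = per L 0 / 2 by ring]; exact sigma_ne_zero L (per_half_notMem L 0)
  have hkθ : IsTheta L (2 * n) (fun a => sigmaMul L 0 a ^ (2 * n)) k := by
    refine (IsTheta.of_mul (f := fun z => sigma L (2 * z)) (by rw [← funext hgk]; exact hodd)
      isTheta_sigma_two_mul (fun a => pow_ne_zero _ (sigmaMul_ne_zero _ _)) hk hne).congr
      (by push_cast; ring) fun a => ?_
    have := sigmaMul_ne_zero (L := L) 0 a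
    rw [div_eq_iff (pow_ne_zero _ this)]; ring
  have hkeven : ∀ z, k (-z) = k z := by
    intro z
    have h := entire_eq_zero_of_mul (f := fun z => sigma L (2 * z)) (g := fun z => k z - k (-z))
      isTheta_sigma_two_mul.differentiable (hk.sub (hk.comp differentiable_neg)) (fun z => by
        have e1 := hgk z
        have e2 := hgk (-z)
        rw [den_neg, neg_neg, show 2 * -z = -(2 * z) by ring, sigma_neg] at e2
        linear_combination -e1 - e2) _ hne z
    exact (sub_eq_zero.mp h).symm
  obtain ⟨p₂, hp₂, h₂⟩ := hkθ.exists_polynomial_of_even hη n hkeven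
  have haeval : ∀ (p : ℂ[X]) (z : ℂ), MvPolynomial.eval ![coordU L η z, coordV L η z]
      (Polynomial.aeval (MvPolynomial.X 0 : MvPolynomial (Fin 2) ℂ) p) = p.eval (coordU L η z) := by
    intro p z
    induction p using Polynomial.induction_on' with
    | add p q hp hq => simp only [map_add, hp, hq, eval_add]
    | monomial n c => simp [aeval_monomial, MvPolynomial.algebraMap_eq]
  refine ⟨MvPolynomial.C (1 / 2) * (Polynomial.aeval (MvPolynomial.X 0) p₁ +
    MvPolynomial.X 1 * Polynomial.aeval (MvPolynomial.X 0) p₂), fun z hz => ?_⟩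
  have hd := den_ne_zero_iff.mpr hz
  have e1 := h₁ z
  have e2 := h₂ z
  rw [← den_pow_mul_eval_coordU hz hp₁] at e1
  rw [← den_pow_mul_eval_coordU hz hp₂] at e2
  have e3 := hgk z
  have hv : coordV L η z = sigma L (2 * z) / den L η z ^ 2 := rfl
  simp only [map_mul, map_add, MvPolynomial.eval_C, MvPolynomial.eval_X, haeval]
  simp only [Matrix.cons_val_one, Matrix.cons_val_fin_one]
  have e4 : g z - g (-z) = coordV L η z * k z := by
    rw [hv, div_mul_eq_mul_div, eq_div_iff (pow_ne_zero 2 hd)]; exact e3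
  rw [e2] at e4
  linear_combination (e1 + e4) / 2

/-- As functions of z, σ² and `den L a` span the even theta functions of degree 2 when a ∉ Λ; the
coefficients come from z = 0 and z = a. The case a ∈ Λ follows by density. -/
theorem sigma_three_term (η a z : ℂ) :
    den L η z * sigma L a ^ 2 = sigma L η ^ 2 * den L a z + den L η a * sigma L z ^ 2 := by
  have hs := (differentiable_sigma L).continuous
  have hc : Continuous (fun a => den L η z * sigma L a ^ 2) := by fun_prop
  have hc' : Continuous (fun a => sigma L η ^ 2 * den L a z + den L η a * sigma L z ^ 2) := by
    unfold den; fun_prop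
  refine congrFun (Continuous.ext_on ((countable_lattice L).dense_compl ℝ) hc hc' ?_) a
  intro a ha
  have ha' := sigma_ne_zero L ha
  obtain ⟨p, hp, h⟩ := IsTheta.exists_polynomial_of_even (L := L) (η := a) ha 1 (g := den L η)
    ((isTheta_den η).congr (by norm_num) (fun a => by norm_num)) (den_neg η)
  simp only [Finset.sum_range_succ, Finset.sum_range_zero, pow_zero, mul_one, zero_add, pow_one,
    tsub_zero, tsub_self] at h
  have h0 := h 0
  have h1 := h a
  have hdz : den L a a = 0 := by simp [den, sigma_zero]
  rw [den_zero, den_zero, sigma_zero] at h0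
  rw [hdz] at h1
  simp only
  rw [h z]
  linear_combination (den L a z) * h0 - sigma L z ^ 2 * h1

/-- By `sigma_three_term`, the cross difference of the two fractions is a nonzero multiple of σ(z +
w) σ(z − w). -/
theorem coordU_eq_iff {η : ℂ} (hη : η ∉ L.lattice) {z w : ℂ} (hz : Regular L η z)
    (hw : Regular L η w) :
    coordU L η z = coordU L η w ↔ z - w ∈ L.lattice ∨ z + w ∈ L.lattice := by
  have hdz := den_ne_zero_iff.mpr hz
  have hdw := den_ne_zero_iff.mpr hw
  have hu : ∀ z, coordU L η z = sigma L z ^ 2 / den L η z := fun _ => rfl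
  have hη' := sigma_ne_zero L hη
  have h := sigma_three_term (L := L) η w z
  rw [hu, hu, div_eq_div_iff hdz hdw]
  have : sigma L z ^ 2 * den L η w = sigma L w ^ 2 * den L η z ↔ den L w z = 0 := by
    constructor
    · intro h1
      have : sigma L η ^ 2 * den L w z = 0 := by linear_combination -h1 - h
      exact (mul_eq_zero.mp this).resolve_left (pow_ne_zero 2 hη')
    · intro h1
      rw [h1] at h
      linear_combination -h
  rw [this, den, mul_eq_zero, sigma_eq_zero_iff, sigma_eq_zero_iff, or_comm]

/-- If σ² − u · `den` had no zero, `den` divided by it would be a degree 0 theta function vanishing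
at η, hence zero; but `den` is nonzero at 0. -/
theorem exists_coordU_eq {η : ℂ} (hη : η ∉ L.lattice) (u : ℂ) :
    ∃ z, Regular L η z ∧ coordU L η z = u := by
  by_contra hcon
  push Not at hcon
  have hθ : IsTheta L 2 (fun a => sigmaMul L 0 a ^ 2) (fun z => sigma L z ^ 2 - u * den L η z) :=
    ((isTheta_sigma.pow 2).congr (by norm_num) (fun _ => rfl)).sub ((isTheta_den η).const_mul u)
  have hη' := sigma_ne_zero L hη
  have hG : ∀ z, sigma L z ^ 2 - u * den L η z ≠ 0 := by
    intro z h0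
    by_cases hz : Regular L η z
    · refine hcon z hz ?_
      have hd := den_ne_zero_iff.mpr hz
      change sigma L z ^ 2 / den L η z = u
      rw [div_eq_iff hd]
      linear_combination h0
    · have hd : den L η z = 0 := by
        by_contra h; exact hz (den_ne_zero_iff.mp h)
      rw [hd] at h0
      have h1 : sigma L z = 0 := by simpa using h0
      rw [sigma_eq_zero_iff] at h1
      refine hz ⟨fun h => hη ?_, fun h => hη ?_⟩
      · simpa using sub_mem h1 h
      · simpa using sub_mem h h1
  obtain ⟨k, hk, hdk⟩ := entire_dvd (isTheta_den (L := L) η).differentiable hθ.differentiable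
    (fun z hz => absurd hz (hG z))
  have hkθ := IsTheta.of_mul (f := fun z => sigma L z ^ 2 - u * den L η z) (α := fun a => sigmaMul L 0 a ^ 2)
    (by rw [← funext hdk]; exact isTheta_den η) hθ
    (fun a => pow_ne_zero _ (sigmaMul_ne_zero _ _)) hk (hG 0)
  have hk0 : k η = 0 := by
    have := hdk η
    rw [show den L η η = 0 by simp [den, sigma_zero]] at this
    exact (mul_eq_zero.mp this.symm).resolve_left (by simpa [den, sigma_zero] using hη')
  have := (hkθ.congr (sub_self 2) (fun _ => rfl)).eq_zero hk0 0
  have h0 := hdk 0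
  rw [this, mul_zero, den_zero] at h0
  exact neg_ne_zero.mpr (pow_ne_zero 2 hη') h0

theorem squarefree_of_roots {q : ℂ[X]} (hq : q ≠ 0) {S : Finset ℂ} (hS : ∀ r ∈ S, q.eval r = 0)
    (hcard : q.natDegree ≤ S.card) : Squarefree q ∧ q.natDegree = S.card := by
  have hle : S.val ≤ q.roots := by
    rw [Multiset.le_iff_subset S.nodup]
    intro r hr
    exact (mem_roots hq).mpr (hS r hr)
  have h1 := Multiset.card_le_card hle
  have h2 := q.card_roots'
  have h3 : S.val = q.roots := Multiset.eq_of_le_of_card_le hle (by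
    rw [Finset.card_val]; omega)
  refine ⟨Separable.squarefree ?_, by rw [Finset.card_val] at h1; omega⟩
  rw [← nodup_roots_iff_of_splits hq (IsAlgClosed.splits q), ← h3]
  exact S.nodup

/-- The points of order two outside ±η + Λ give distinct roots of q. If 2η ∉ Λ there are four of
them. If 2η ∈ Λ at least three remain, and the coefficient of degree 4 vanishes. In both cases the
roots exhaust the degree. -/
theorem exists_curve {η : ℂ} (hη : η ∉ L.lattice) :
    ∃ q : ℂ[X], Squarefree q ∧ (q.natDegree = 3 ∨ q.natDegree = 4) ∧
      ∀ z, Regular L η z → coordV L η z ^ 2 = q.eval (coordU L η z) := by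
  obtain ⟨q, hq4, hq⟩ := IsTheta.exists_polynomial_of_even (L := L) (η := η) hη 4
    (g := fun z => sigma L (2 * z) ^ 2)
    ((isTheta_sigma_two_mul.pow 2).congr (by norm_num) (fun a => by ring))
    (fun z => by rw [mul_neg, sigma_neg, neg_sq])
  have hv : ∀ z, Regular L η z → coordV L η z ^ 2 = q.eval (coordU L η z) := by
    intro z hz
    have hd := den_ne_zero_iff.mpr hz
    have h1 := hq z
    rw [← den_pow_mul_eval_coordU hz hq4] at h1
    have h2 : coordV L η z = sigma L (2 * z) / den L η z ^ 2 := rfl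
    rw [h2, div_pow, h1]
    field_simp
  refine ⟨q, ?_⟩
  have hη' := sigma_ne_zero L hη
  have hq0 : q ≠ 0 := by
    rintro rfl
    have := hq (per L 0 / 4)
    simp only [coeff_zero, zero_mul, Finset.sum_const_zero,
      show 2 * (per L 0 / 4) = per L 0 / 2 by ring] at this
    exact pow_ne_zero 2 (sigma_ne_zero L (per_half_notMem L 0)) this
  -- At z = η `den` vanishes, so only the top coefficient survives; it is zero exactly when 2η ∈ Λ.
  have hlead : sigma L (2 * η) ^ 2 = q.coeff 4 * (sigma L η ^ 2) ^ 4 := by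
    have := hq η
    rw [show den L η η = 0 by simp [den, sigma_zero]] at this
    simpa [Finset.sum_range_succ] using this
  classical
  set W := Finset.univ.filter fun i => Regular L η (halfPeriod L i) with hW
  set S := W.image fun i => coordU L η (halfPeriod L i) with hS
  have hScard : S.card = W.card := by
    refine Finset.card_image_of_injOn fun i hi j hj hij => ?_
    by_contra hne
    simp only [hW, Finset.coe_filter, Finset.mem_univ, true_and, Set.mem_ofPred_eq] at hi hj
    rcases (coordU_eq_iff hη hi hj).mp hij with h | h
    · exact halfPeriod_sub_notMem hne h
    · refine halfPeriod_sub_notMem (L := L) hne ?_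
      have := sub_mem h (two_mul_halfPeriod_mem (L := L) j)
      convert this using 1; ring
  have hroot : ∀ r ∈ S, q.eval r = 0 := by
    intro r hr
    obtain ⟨i, hi, rfl⟩ := Finset.mem_image.mp hr
    have hi' : Regular L η (halfPeriod L i) := by simpa [hW] using hi
    rw [← hv _ hi', coordV, sigma_eq_zero_iff.mpr (two_mul_halfPeriod_mem i)]
    simp
  have key : q.natDegree ≤ W.card ∧ 3 ≤ W.card := by
    by_cases h2 : 2 * η ∈ L.lattice
    · have hc4 : q.coeff 4 = 0 := by
        rw [sigma_eq_zero_iff.mpr h2] at hlead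
        have := pow_ne_zero 4 (pow_ne_zero 2 hη')
        exact (mul_eq_zero.mp (by linear_combination -hlead)).resolve_right this
      have hdeg : q.natDegree ≤ 3 := by
        rcases Nat.lt_or_ge q.natDegree 4 with h | h
        · omega
        · have h4 : q.natDegree = 4 := le_antisymm hq4 h
          rw [← h4, coeff_natDegree, leadingCoeff_eq_zero] at hc4
          exact absurd hc4 hq0
      have hcompl : Wᶜ.card ≤ 1 := by
        rw [Finset.card_le_one]
        intro i hi j hj
        have hmem : ∀ i ∈ Wᶜ, halfPeriod L i - η ∈ L.lattice := by
          intro i hi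
          by_contra hcon
          refine (Finset.mem_compl.mp hi) (Finset.mem_filter.mpr ⟨Finset.mem_univ _, hcon, fun h => ?_⟩)
          refine hcon ?_
          have := sub_mem h h2
          convert this using 1; ring
        by_contra hne
        refine halfPeriod_sub_notMem (L := L) hne ?_
        simpa using sub_mem (hmem i hi) (hmem j hj)
      have := Finset.card_add_card_compl W
      rw [Fintype.card_fin] at this
      omega
    · have hall : W = Finset.univ := by
        refine Finset.filter_true_of_mem fun i _ => ⟨fun h => h2 ?_, fun h => h2 ?_⟩
        · have := sub_mem (two_mul_halfPeriod_mem (L := L) i) (add_mem h h)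
          convert this using 1; ring
        · have := sub_mem (add_mem h h) (two_mul_halfPeriod_mem (L := L) i)
          convert this using 1; ring
      rw [hall]
      simpa using hq4
  obtain ⟨hsq, hdeg⟩ := squarefree_of_roots hq0 hroot (by rw [hScard]; exact key.1)
  refine ⟨hsq, ?_, hv⟩
  have := key.2
  rw [hScard] at hdeg
  omega

theorem coordU_neg (η z : ℂ) : coordU L η (-z) = coordU L η z := by
  change sigma L (-z) ^ 2 / den L η (-z) = sigma L z ^ 2 / den L η z
  rw [den_neg, sigma_neg, neg_sq]

theorem coordV_neg (η z : ℂ) : coordV L η (-z) = -coordV L η z := by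
  change sigma L (2 * -z) / den L η (-z) ^ 2 = -(sigma L (2 * z) / den L η z ^ 2)
  rw [den_neg, mul_neg, sigma_neg, neg_div]

theorem Regular.neg {η z : ℂ} (h : Regular L η z) : Regular L η (-z) := by
  rw [← den_ne_zero_iff, den_neg, den_ne_zero_iff]; exact h

theorem coordV_add_lattice {η l : ℂ} (hl : l ∈ L.lattice) (z : ℂ) :
    coordV L η (z + l) = coordV L η z := by
  refine apply_add_lattice (L := L) (f := coordV L η) (fun a z => ?_) hl z
  change sigma L (2 * (z + per L a)) / den L η (z + per L a) ^ 2 = sigma L (2 * z) / den L η z ^ 2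
  have h1 := (isTheta_sigma_two_mul (L := L)).add_per a z
  have h2 := (isTheta_den (L := L) η).add_per a z
  rw [h1, h2, mul_pow, mul_pow, ← exp_nat_mul, ← pow_mul,
    show ((2 : ℕ) : ℂ) * (2 * qper L a * z) = 4 * qper L a * z by push_cast; ring]
  exact mul_div_mul_left _ _ (mul_ne_zero (pow_ne_zero _ (sigmaMul_ne_zero _ _)) (exp_ne_zero _))

/-- u determines the point up to sign. The odd function v separates z from −z except where v = 0,
which means 2z ∈ Λ, and there the two points coincide. -/
theorem curve_bijective {η : ℂ} (hη : η ∉ L.lattice) {z w : ℂ} (hz : Regular L η z)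
    (hw : Regular L η w) :
    (coordU L η z = coordU L η w ∧ coordV L η z = coordV L η w) ↔ z - w ∈ L.lattice := by
  rw [coordU_eq_iff hη hz hw]
  constructor
  · rintro ⟨h | h, hV⟩
    · exact h
    · have h1 : coordV L η z = -coordV L η w := by
        rw [← coordV_neg, ← coordV_add_lattice h (-w)]
        congr 1; ring
      have h2 : coordV L η w = 0 := by linear_combination (h1 - hV) / 2
      have h3 : sigma L (2 * w) = 0 := by
        have h4 : sigma L (2 * w) / den L η w ^ 2 = 0 := h2
        exact (div_eq_zero_iff.mp h4).resolve_right (pow_ne_zero 2 (den_ne_zero_iff.mpr hw))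
      rw [sigma_eq_zero_iff] at h3
      have := sub_mem h h3
      convert this using 1; ring
  · intro h
    refine ⟨.inl h, ?_⟩
    rw [← coordV_add_lattice h w]
    congr 1; ring

theorem curve_surjective {η : ℂ} (hη : η ∉ L.lattice) {q : ℂ[X]}
    (hq : ∀ z, Regular L η z → coordV L η z ^ 2 = q.eval (coordU L η z)) (u v : ℂ) :
    v ^ 2 = q.eval u ↔ ∃ z, Regular L η z ∧ coordU L η z = u ∧ coordV L η z = v := by
  constructor
  · intro h
    obtain ⟨z, hz, rfl⟩ := exists_coordU_eq hη u
    rw [← hq z hz] at h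
    rcases sq_eq_sq_iff_eq_or_eq_neg.mp h with h | h
    · exact ⟨z, hz, rfl, h.symm⟩
    · exact ⟨-z, hz.neg, coordU_neg η z, by rw [coordV_neg, h]⟩
  · rintro ⟨z, hz, rfl, rfl⟩
    exact hq z hz

end

section

variable {L : PeriodPair} {η lam : ℂ} {N : ℕ} {x : ℤ → Fin N → ℂ}

/-! ### Bilinear form of the equation -/

namespace Generic

theorem distinct (hx : Generic L η x) (m : ℤ) (i j : Fin N) (hij : i ≠ j) :
    x m i - x m j ∉ L.lattice := (hx.same_time m i j hij).1

theorem tau_prev (hx : Generic L η x) (m : ℤ) (i : Fin N) : tau L (x m) (x (m + 1) i) ≠ 0 :=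
  tau_ne_zero fun j => (hx.next_time m i j).1

theorem tau_prev_add (hx : Generic L η x) (m : ℤ) (i : Fin N) :
    tau L (x m) (x (m + 1) i + η) ≠ 0 :=
  tau_ne_zero fun j => by
    rw [show x (m + 1) i + η - x m j = x (m + 1) i - x m j + η by ring]
    exact (hx.next_time m i j).2

theorem tau_next (hx : Generic L η x) (m : ℤ) (i : Fin N) : tau L (x (m + 1)) (x m i) ≠ 0 :=
  tau_ne_zero fun j => by
    rw [← neg_mem_iff, neg_sub]
    exact (hx.next_time m j i).1

theorem tau_next_sub (hx : Generic L η x) (m : ℤ) (i : Fin N) :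
    tau L (x (m + 1)) (x m i - η) ≠ 0 :=
  tau_ne_zero fun j => by
    rw [← neg_mem_iff, show -(x m i - η - x (m + 1) j) = x (m + 1) j - x m i + η by ring]
    exact (hx.next_time m j i).2

theorem tau_self_add (hx : Generic L η x) (hη : η ∉ L.lattice) (m : ℤ) (i : Fin N) :
    tau L (x m) (x m i + η) ≠ 0 :=
  tau_ne_zero fun j => by
    rw [show x m i + η - x m j = x m i - x m j + η by ring]
    by_cases hij : i = j
    · subst hij; simpa using hη
    · exact (hx.same_time m i j hij).2

theorem tau_self_sub (hx : Generic L η x) (hη : η ∉ L.lattice) (m : ℤ) (i : Fin N) :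
    tau L (x m) (x m i - η) ≠ 0 :=
  tau_ne_zero fun j => by
    rw [← neg_mem_iff, show -(x m i - η - x m j) = x m j - x m i + η by ring]
    by_cases hij : i = j
    · subst hij; simpa using hη
    · exact (hx.same_time m j i (Ne.symm hij)).2

end Generic

variable (L η lam x) in
/-- The numerators `g m = tau L (x m) * ψ m` of a double-Bloch solution `ψ`: entire functions
satisfying the bilinear form of the equation. -/
structure IsBilinearSolution (B : Fin 2 → ℂ) (g : ℤ → ℂ → ℂ) : Prop where
  theta : ∀ m, IsTheta L N (fun a => tauMul L (x m) a * B a) (g m)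
  equation : ∀ m z, tau L (x (m + 1)) z * g m (z + η) - lam * tau L (x (m + 1)) (z + η) * g m z =
    tau L (x m) (z + η) * g (m + 1) z

theorem eq_of_eq_off_countable {f g : ℂ → ℂ} (hf : Continuous f) (hg : Continuous g) {S : Set ℂ}
    (hS : S.Countable) (h : ∀ z ∉ S, f z = g z) (z : ℂ) : f z = g z :=
  congrFun (Continuous.ext_on (hS.dense_compl ℝ) hf hg fun z hz => h z hz) z

/-- Passing to the meromorphic normal form removes the singularities without changing values at
analytic points. -/
theorem exists_entire_eq {f : ℂ → ℂ} (hf : ∀ z, MeromorphicAt f z)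
    (h : ∀ z, 0 ≤ meromorphicOrderAt f z) :
    ∃ g, Differentiable ℂ g ∧ ∀ z, AnalyticAt ℂ f z → g z = f z := by
  have hmer : MeromorphicOn f Set.univ := fun z _ => hf z
  refine ⟨toMeromorphicNFOn f Set.univ, fun z => ?_, fun z hz => ?_⟩
  · refine AnalyticAt.differentiableAt ?_
    rw [← (meromorphicNFOn_toMeromorphicNFOn f Set.univ
      (Set.mem_univ z)).meromorphicOrderAt_nonneg_iff_analyticAt,
      meromorphicOrderAt_toMeromorphicNFOn hmer (Set.mem_univ z)]
    exact h z
  · rw [toMeromorphicNFOn_eq_toMeromorphicNFAt hmer (Set.mem_univ z),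
      toMeromorphicNFAt_eq_self.mpr hz.meromorphicNFAt]

theorem differentiable_tau (y : Fin N → ℂ) : Differentiable ℂ (tau L y) :=
  (isTheta_tau y).differentiable

theorem add_per_notMem_poles {y : Fin N → ℂ} {z : ℂ} (hz : z ∉ poles L y) (a : Fin 2) :
    z + per L a ∉ poles L y := by
  rintro ⟨i, hi⟩
  refine hz ⟨i, ?_⟩
  rw [← notMem_add_lattice (per_mem L a)]
  convert hi using 1; ring

theorem countable_add_mem_poles (y : Fin N → ℂ) (t : ℂ) : {z | z + t ∈ poles L y}.Countable :=
  (countable_poles (L := L) y).preimage_of_injOn (f := fun z => z + t) (add_left_injective t).injOn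

theorem IsDoubleBlochSolution.exists_bilinear {B : ℂ × ℂ} {ψ : ℤ → ℂ → ℂ}
    (h : IsDoubleBlochSolution L η lam x B ψ) :
    ∃ g, IsBilinearSolution L η lam x ![B.1, B.2] g ∧
      ∀ m, ∀ z ∉ poles L (x m), g m z = tau L (x m) z * ψ m z := by
  have hex : ∀ m, ∃ g : ℂ → ℂ, Differentiable ℂ g ∧
      ∀ z ∉ poles L (x m), g z = tau L (x m) z * ψ m z := by
    intro m
    have hτ := fun z => (differentiable_tau (L := L) (x m)).analyticAt z
    have hord : ∀ z, 0 ≤ meromorphicOrderAt (fun z => tau L (x m) z * ψ m z) z := by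
      intro z
      by_cases hz : z ∈ poles L (x m)
      · rw [fun_meromorphicOrderAt_mul (hτ z).meromorphicAt (h.meromorphicAt m z)]
        have h1 := h.simple_poles m z
        -- A zero of τ absorbs the at most simple pole of ψ.
        have h2 : (1 : WithTop ℤ) ≤ meromorphicOrderAt (tau L (x m)) z := by
          have hd : Differentiable ℂ (dslope (tau L (x m)) z) := fun w =>
            ((differentiableOn_dslope (s := Set.univ) univ_mem).mpr
              (differentiable_tau (x m)).differentiableOn).differentiableAt univ_mem
          have he : tau L (x m) = (fun w => w - z) * dslope (tau L (x m)) z := by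
            funext w
            have := sub_smul_dslope (tau L (x m)) z w
            rw [tau_eq_zero_iff.mpr hz, sub_zero, smul_eq_mul] at this
            exact this.symm
          rw [he, meromorphicOrderAt_mul (by fun_prop) (hd.analyticAt z).meromorphicAt,
            meromorphicOrderAt_id_sub_const]
          exact le_add_of_nonneg_right (hd.analyticAt z).meromorphicOrderAt_nonneg
        have := add_le_add h2 h1
        simpa using this
      · exact ((hτ z).fun_mul (h.analyticAt m z hz)).meromorphicOrderAt_nonneg
    obtain ⟨g, hg, hgf⟩ := exists_entire_eq
      (fun z => (hτ z).meromorphicAt.fun_mul (h.meromorphicAt m z)) hord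
    exact ⟨g, hg, fun z hz => hgf z ((hτ z).fun_mul (h.analyticAt m z hz))⟩
  choose g hg hgψ using hex
  refine ⟨g, ⟨fun m => ⟨hg m, fun a z => ?_⟩, fun m z => ?_⟩, hgψ⟩
  · have hc := (hg m).continuous
    refine eq_of_eq_off_countable (f := fun z => g m (z + per L a))
      (g := fun z => tauMul L (x m) a * (![B.1, B.2] : Fin 2 → ℂ) a *
        exp ((N : ℂ) * qper L a * z) * g m z) (by fun_prop) (by fun_prop)
      (countable_poles (L := L) (x m)) (fun z hz => ?_) z
    have hb : ψ m (z + per L a) = (![B.1, B.2] : Fin 2 → ℂ) a * ψ m z := by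
      fin_cases a
      · exact h.bloch₁ m z hz
      · exact h.bloch₂ m z hz
    rw [hgψ m z hz, hgψ m _ (add_per_notMem_poles hz a), (isTheta_tau (x m)).add_per, hb]
    ring
  · have hc := fun m => (hg m).continuous
    have hτ := fun m => (differentiable_tau (L := L) (x m)).continuous
    have c1 := hc m
    have c2 := hc (m + 1)
    have c3 := hτ m
    have c4 := hτ (m + 1)
    refine eq_of_eq_off_countable
      (f := fun z => tau L (x (m + 1)) z * g m (z + η) - lam * tau L (x (m + 1)) (z + η) * g m z)
      (g := fun z => tau L (x m) (z + η) * g (m + 1) z) (by fun_prop) (by fun_prop)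
      (((countable_poles (L := L) (x m)).union (countable_add_mem_poles (L := L) (x m) η)).union
        (countable_poles (L := L) (x (m + 1)))) (fun z hz => ?_) z
    simp only [Set.mem_union, Set.mem_ofPred_eq, not_or] at hz
    obtain ⟨⟨h1, h2⟩, h3⟩ := hz
    have e := h.equation m z h1 h2 h3
    rw [hgψ m z h1, hgψ m _ h2, hgψ (m + 1) z h3, ← e]
    have t1 : tau L (x m) (z + η) ≠ 0 := fun h => h2 (tau_eq_zero_iff.mp h)
    have t2 : tau L (x (m + 1)) z ≠ 0 := fun h => h3 (tau_eq_zero_iff.mp h)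
    field_simp

/-- Since the points y are inequivalent modulo the lattice, all zeros of τ are simple. -/
theorem le_meromorphicOrderAt_div_tau {y : Fin N → ℂ} (hy : ∀ i j, i ≠ j → y i - y j ∉ L.lattice)
    {g : ℂ → ℂ} (hg : Differentiable ℂ g) (z : ℂ) :
    -1 ≤ meromorphicOrderAt (fun z => g z / tau L y z) z := by
  have hτ := (differentiable_tau (L := L) y).analyticAt z
  have hpole : meromorphicOrderAt (tau L y) z ≤ 1 := by
    by_cases hz : z ∈ poles L y
    · obtain ⟨i, hi⟩ := hz
      have hd : Differentiable ℂ (fun w => sigma L (w - y i)) :=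
        (differentiable_sigma L).comp (differentiable_id.sub_const (y i))
      have hd' : Differentiable ℂ (dslope (fun w => sigma L (w - y i)) z) := fun w =>
        ((differentiableOn_dslope (s := Set.univ) univ_mem).mpr
          hd.differentiableOn).differentiableAt univ_mem
      have hr : Differentiable ℂ (fun w => ∏ j ∈ Finset.univ.erase i, sigma L (w - y j)) :=
        Differentiable.fun_finsetProd fun j _ =>
          (differentiable_sigma L).comp (differentiable_id.sub_const (y j))
      rw [meromorphicOrderAt_eq_int_iff (n := 1) hτ.meromorphicAt |>.mpr ?_]
      · rfl
      · refine ⟨fun w => dslope (fun w => sigma L (w - y i)) z w *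
          ∏ j ∈ Finset.univ.erase i, sigma L (w - y j), (hd'.mul hr).analyticAt z, ?_, ?_⟩
        · refine mul_ne_zero ?_ (Finset.prod_ne_zero_iff.mpr fun j hj => sigma_ne_zero L fun h => ?_)
          · rw [dslope_same, deriv_comp_sub_const]; exact deriv_sigma_ne_zero hi
          · refine hy j i (Finset.ne_of_mem_erase hj) ?_
            simpa using sub_mem hi h
        · refine Eventually.of_forall fun w => ?_
          have := sub_smul_dslope (fun w => sigma L (w - y i)) z w
          simp only [sigma_eq_zero_iff.mpr hi, sub_zero] at this
          rw [zpow_one, smul_eq_mul, ← mul_assoc, ← smul_eq_mul (w - z), this, tau,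
            Finset.mul_prod_erase Finset.univ (fun j => sigma L (w - y j)) (Finset.mem_univ i)]
    · have hne : tau L y z ≠ 0 := fun h => hz (tau_eq_zero_iff.mp h)
      rw [hτ.meromorphicNFAt.meromorphicOrderAt_eq_zero_iff.mpr hne]
      exact zero_le_one
  have hgan := hg.analyticAt z
  rw [show (fun z => g z / tau L y z) = g / tau L y from rfl,
    meromorphicOrderAt_div hgan.meromorphicAt hτ.meromorphicAt]
  have h0 := hgan.meromorphicOrderAt_nonneg
  generalize meromorphicOrderAt g z = p at h0
  generalize meromorphicOrderAt (tau L y) z = r at hpole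
  lift r to ℤ using (hpole.trans_lt (WithTop.coe_lt_top 1)).ne
  induction p using WithTop.recTopCoe with
  | top => exact le_top
  | coe p =>
    have h1 : r ≤ 1 := by exact_mod_cast hpole
    have h2 : 0 ≤ p := by exact_mod_cast h0
    change ((-1 : ℤ) : WithTop ℤ) ≤ ((p - r : ℤ) : WithTop ℤ)
    exact WithTop.coe_le_coe.mpr (by omega)

theorem IsBilinearSolution.isDoubleBlochSolution (hx : Generic L η x) {B : Fin 2 → ℂ}
    {g : ℤ → ℂ → ℂ} (h : IsBilinearSolution L η lam x B g) :
    IsDoubleBlochSolution L η lam x (B 0, B 1) (fun m z => g m z / tau L (x m) z) := by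
  have hne : ∀ m, ∀ z ∉ poles L (x m), tau L (x m) z ≠ 0 := fun m z hz h =>
    hz (tau_eq_zero_iff.mp h)
  have hbl : ∀ a m z, z ∉ poles L (x m) → g m (z + per L a) / tau L (x m) (z + per L a) =
      B a * (g m z / tau L (x m) z) := by
    intro a m z hz
    have h0 := hne m z hz
    have h1 := tauMul_ne_zero (L := L) (x m) a
    rw [(h.theta m).add_per, (isTheta_tau (x m)).add_per]
    field_simp
  refine ⟨fun m z hz => ?_, fun m z => ?_, fun m z => ?_, hbl 0, hbl 1, fun m z h1 h2 h3 => ?_⟩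
  · exact ((h.theta m).differentiable.analyticAt z).fun_div ((differentiable_tau _).analyticAt z)
      (hne m z hz)
  · exact ((h.theta m).differentiable.analyticAt z).meromorphicAt.fun_div
      ((differentiable_tau _).analyticAt z).meromorphicAt
  · exact le_meromorphicOrderAt_div_tau (hx.distinct m) (h.theta m).differentiable z
  · have t1 := hne _ _ h1
    have t2 := hne _ _ h2
    have t3 := hne _ _ h3
    have e := h.equation m z
    field_simp
    linear_combination e

/-! ### Equations of motion of the poles -/

variable (L η x) in
/-- The discrete time equations of motion of the zeros of the tau functions. -/
def EquationsOfMotion : Prop := ∀ m i,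
  -(tau L (x (m + 1 + 1)) (x (m + 1) i - η) * tau L (x (m + 1)) (x (m + 1) i + η) *
    tau L (x m) (x (m + 1) i)) =
  tau L (x (m + 1 + 1)) (x (m + 1) i) * tau L (x (m + 1)) (x (m + 1) i - η) *
    tau L (x m) (x (m + 1) i + η)

namespace IsBilinearSolution

variable {B : Fin 2 → ℂ} {g : ℤ → ℂ → ℂ}

theorem at_next (h : IsBilinearSolution L η lam x B g) (m : ℤ) (i : Fin N) :
    -(lam * tau L (x (m + 1)) (x (m + 1) i + η) * g m (x (m + 1) i)) =
      tau L (x m) (x (m + 1) i + η) * g (m + 1) (x (m + 1) i) := by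
  have := h.equation m (x (m + 1) i)
  rw [tau_apply_self] at this
  linear_combination this

theorem at_next_sub (h : IsBilinearSolution L η lam x B g) (m : ℤ) (i : Fin N) :
    tau L (x (m + 1)) (x (m + 1) i - η) * g m (x (m + 1) i) =
      tau L (x m) (x (m + 1) i) * g (m + 1) (x (m + 1) i - η) := by
  have := h.equation m (x (m + 1) i - η)
  rw [sub_add_cancel, tau_apply_self] at this
  linear_combination this

theorem at_self_sub (h : IsBilinearSolution L η lam x B g) (m : ℤ) (i : Fin N) :
    tau L (x (m + 1)) (x m i - η) * g m (x m i) =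
      lam * tau L (x (m + 1)) (x m i) * g m (x m i - η) := by
  have := h.equation m (x m i - η)
  rw [sub_add_cancel, tau_apply_self] at this
  linear_combination this

/-- With p = x_i^{m+1}, the equations at (m, p), (m, p − η) and (m + 1, p − η) are linear and
homogeneous in g^m(p), g^{m+1}(p) and g^{m+1}(p − η). Eliminating the last two leaves the equation
of motion times λ g^m(p). -/
theorem motion (h : IsBilinearSolution L η lam x B g) (hlam : lam ≠ 0) {m : ℤ} {i : Fin N}
    (hg : g m (x (m + 1) i) ≠ 0) :
    -(tau L (x (m + 1 + 1)) (x (m + 1) i - η) * tau L (x (m + 1)) (x (m + 1) i + η) *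
      tau L (x m) (x (m + 1) i)) =
    tau L (x (m + 1 + 1)) (x (m + 1) i) * tau L (x (m + 1)) (x (m + 1) i - η) *
      tau L (x m) (x (m + 1) i + η) := by
  have h1 := h.at_next m i
  have h2 := h.at_next_sub m i
  have h3 := h.at_self_sub (m + 1) i
  apply mul_right_cancel₀ (mul_ne_zero hlam hg)
  generalize tau L (x (m + 1 + 1)) (x (m + 1) i - η) = a at *
  generalize tau L (x (m + 1)) (x (m + 1) i + η) = b at *
  linear_combination a * tau L (x m) (x (m + 1) i) * h1 +
    tau L (x m) (x (m + 1) i) * tau L (x m) (x (m + 1) i + η) * h3 -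
    lam * tau L (x (m + 1 + 1)) (x (m + 1) i) * tau L (x m) (x (m + 1) i + η) * h2

end IsBilinearSolution

theorem sum_mul_aeval_eq_zero {ι : Type*} (s : Finset ι) (a μ : ι → ℂ) (φ : ι → ℂ → ℂ)
    (hstep : ∀ c : ι → ℂ, (∀ z, ∑ r ∈ s, c r * φ r z = 0) → ∀ z, ∑ r ∈ s, c r * μ r * φ r z = 0)
    (h0 : ∀ z, ∑ r ∈ s, a r * φ r z = 0) (p : ℂ[X]) (z : ℂ) :
    ∑ r ∈ s, a r * p.eval (μ r) * φ r z = 0 := by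
  have hpow : ∀ n : ℕ, ∀ z, ∑ r ∈ s, a r * μ r ^ n * φ r z = 0 := by
    intro n
    induction n with
    | zero => simpa using h0
    | succ n ih =>
      intro z
      have := hstep _ ih z
      simpa only [pow_succ, mul_assoc] using this
  induction p using Polynomial.induction_on' with
  | add p q hp hq =>
    simp only [eval_add, mul_add, add_mul, Finset.sum_add_distrib, hp, hq, add_zero]
  | monomial n c =>
    have := congrArg (c * ·) (hpow n z)
    simp only [mul_zero, Finset.mul_sum] at this
    rw [← this]
    refine Finset.sum_congr rfl fun r _ => ?_
    rw [eval_monomial]; ring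

/-- If a family of functions is linearly dependent and this is inherited under multiplication of the
coefficients by `μ`, there is a linear relation between functions with the same `μ`. -/
theorem exists_relation_of_eigen {ι : Type*} [DecidableEq ι] (s : Finset ι) (a μ : ι → ℂ) (φ : ι → ℂ → ℂ)
    (hstep : ∀ c : ι → ℂ, (∀ z, ∑ r ∈ s, c r * φ r z = 0) → ∀ z, ∑ r ∈ s, c r * μ r * φ r z = 0)
    (h0 : ∀ z, ∑ r ∈ s, a r * φ r z = 0) (r₀ : ι) (z : ℂ) :
    ∑ r ∈ s, (if μ r = μ r₀ then a r else 0) * φ r z = 0 := by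
  classical
  -- Up to a scalar, p(μ) projects onto the part of the relation with eigenvalue μ r₀.
  set p : ℂ[X] := ∏ ν ∈ (s.image μ).erase (μ r₀), (X - C ν) with hp
  have h := sum_mul_aeval_eq_zero s a μ φ hstep h0 p z
  have hne : p.eval (μ r₀) ≠ 0 := by
    rw [hp, eval_prod, Finset.prod_ne_zero_iff]
    intro ν hν
    simpa [sub_eq_zero] using (Finset.ne_of_mem_erase hν).symm
  apply mul_left_cancel₀ hne
  rw [mul_zero, Finset.mul_sum]
  refine Eq.trans ?_ h
  refine Finset.sum_congr rfl fun r hr => ?_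
  split_ifs with hμ
  · rw [hμ]; ring
  · have : p.eval (μ r) = 0 := by
      rw [hp, eval_prod]
      refine Finset.prod_eq_zero (Finset.mem_erase.mpr ⟨hμ, Finset.mem_image_of_mem μ hr⟩) (by simp)
    rw [this]; ring

theorem equationsOfMotion (hx : Generic L η x) (hη : η ∉ L.lattice) (hlam : lam ≠ 0) (hN : 0 < N)
    {B : Fin N → ℂ × ℂ} {Ψ : Fin N → ℤ → ℂ → ℂ}
    (hΨ : ∀ r, IsDoubleBlochSolution L η lam x (B r) (Ψ r))
    (hB : ∀ r s, EquivMultipliers L (B r) (B s))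
    (hind : ∀ m, PeriodicIndependent L η (x m) (fun r => Ψ r m)) : EquationsOfMotion L η x := by
  classical
  choose g hg hgΨ using fun r => (hΨ r).exists_bilinear
  intro m i
  by_cases hex : ∃ r, g r m (x (m + 1) i) ≠ 0
  · obtain ⟨r, hr⟩ := hex
    exact (hg r).motion hlam hr
  exfalso
  push Not at hex
  set r₁ : Fin N := ⟨0, hN⟩
  choose b hb₁ hb₂ using fun r => hB r r₁
  set y := x (m + 1) with hy
  -- Equivalent multipliers are made equal by the gauge factors exp(b_r z), so that complex linear
  -- combinations are again theta functions.
  set φ : Fin N → ℂ → ℂ := fun r z => g r (m + 1) z * exp (b r * z) with hφ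
  set β : Fin 2 → ℂ := ![(B r₁).1, (B r₁).2] with hβ
  have hφθ : ∀ r, IsTheta L N (fun a => tauMul L y a * β a) (φ r) := by
    intro r
    refine (((hg r).theta (m + 1)).mul (IsTheta.exp_mul (b r))).congr (add_zero _) fun a => ?_
    rw [mul_assoc]
    congr 1
    fin_cases a
    · exact (hb₁ r).symm
    · exact (hb₂ r).symm
  have hyi : ∀ r, φ r (y i) = 0 := by
    intro r
    have := (hg r).at_next m i
    rw [hex, mul_zero, neg_zero] at this
    have := (mul_eq_zero.mp this.symm).resolve_left (hx.tau_prev_add m i)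
    simp [hφ, hy, this]
  have hyη : ∀ r, φ r (y i - η) = 0 := by
    intro r
    have := (hg r).at_next_sub m i
    rw [hex, mul_zero] at this
    have := (mul_eq_zero.mp this.symm).resolve_left (hx.tau_prev m i)
    simp [hφ, hy, this]
  -- Vanishing at all y_j makes a combination divisible by τ; the degree 0 quotient has a further
  -- zero at y_i − η.
  have hinj : ∀ c : Fin N → ℂ, (∀ j, ∑ r, c r * φ r (y j) = 0) → ∀ z, ∑ r, c r * φ r z = 0 := by
    intro c hc
    by_cases hβ0 : ∀ a, β a ≠ 0
    · have hθ : IsTheta L N (fun a => tauMul L y a * β a) (fun z => ∑ r, c r * φ r z) :=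
        IsTheta.sum _ fun r _ => (hφθ r).const_mul (c r)
      obtain ⟨k, hk, hkeq⟩ := hθ.dvd_tau (fun a => mul_ne_zero (tauMul_ne_zero _ _) (hβ0 a))
        (hx.distinct (m + 1)) hc
      have hk0 : k (y i - η) = 0 := by
        have := hkeq (y i - η)
        simp only [hyη, mul_zero, Finset.sum_const_zero] at this
        exact (mul_eq_zero.mp this.symm).resolve_left (hx.tau_self_sub hη (m + 1) i)
      intro z
      rw [hkeq, (hk.congr (sub_self _) (fun _ => rfl)).eq_zero hk0, mul_zero]
    -- A zero multiplier forces all φ_r to vanish identically.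
    · push Not at hβ0
      obtain ⟨a, ha⟩ := hβ0
      intro z
      refine Finset.sum_eq_zero fun r _ => ?_
      have := (hφθ r).add_per a (z - per L a)
      rw [sub_add_cancel, ha] at this
      rw [this]; ring
  -- Row i of the N × N matrix of values is zero, hence a nontrivial relation exists.
  obtain ⟨c, hc0, hc⟩ : ∃ c : Fin N → ℂ, c ≠ 0 ∧ ∀ j, ∑ r, c r * φ r (y j) = 0 := by
    let M : Matrix (Fin N) (Fin N) ℂ := Matrix.of fun j r => φ r (y j)
    have hdet : M.det = 0 := Matrix.det_eq_zero_of_row_eq_zero i fun r => hyi r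
    obtain ⟨c, hc0, hc⟩ := Matrix.exists_mulVec_eq_zero_iff.mpr hdet
    refine ⟨c, hc0, fun j => ?_⟩
    have := congrFun hc j
    simp only [Matrix.mulVec, dotProduct, M, Matrix.of_apply, Pi.zero_apply] at this
    rw [← this]
    exact Finset.sum_congr rfl fun r _ => mul_comm _ _
  set μ : Fin N → ℂ := fun r => exp (-(b r * η)) with hμ
  -- The gauge factor makes the shift by η contribute μ_r = exp(−b_r η), so multiplication of
  -- coefficients by μ preserves the relations among the φ_r.
  have hpencil : ∀ r j, tau L (x (m + 1 + 1)) (y j - η) * (μ r * φ r (y j)) =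
      lam * tau L (x (m + 1 + 1)) (y j) * φ r (y j - η) := by
    intro r j
    have h1 := (hg r).at_self_sub (m + 1) j
    simp only [hφ, hμ, hy]
    rw [mul_left_comm (exp _), ← exp_add, show -(b r * η) + b r * x (m + 1) j =
      b r * (x (m + 1) j - η) by ring]
    linear_combination exp (b r * (x (m + 1) j - η)) * h1
  have hstep : ∀ c : Fin N → ℂ, (∀ z, ∑ r, c r * φ r z = 0) →
      ∀ z, ∑ r, c r * μ r * φ r z = 0 := by
    intro c hc
    refine hinj _ fun j => ?_
    apply mul_left_cancel₀ (hx.tau_next_sub (m + 1) j)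
    rw [mul_zero, Finset.mul_sum]
    have h1 : ∀ r ∈ Finset.univ, tau L (x (m + 1 + 1)) (x (m + 1) j - η) *
        (c r * μ r * φ r (y j)) =
        lam * tau L (x (m + 1 + 1)) (y j) * (c r * φ r (y j - η)) := by
      intro r _
      linear_combination c r * hpencil r j
    rw [Finset.sum_congr rfl h1, ← Finset.mul_sum, hc, mul_zero]
  obtain ⟨r₀, hr₀⟩ := Function.ne_iff.mp hc0
  have hrel := exists_relation_of_eigen Finset.univ c μ φ hstep (hinj c hc) r₀
  -- After undoing the gauge the coefficients are exp((b_r − b_{r₀}) z), which are η-periodic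
  -- because only indices with μ_r = μ_{r₀} are kept.
  have hp := hind (m + 1) (fun r z => (if μ r = μ r₀ then c r else 0) * exp ((b r - b r₀) * z))
    (fun r => by fun_prop) (fun r z => ?_) (fun z hz => ?_) r₀ 0
  · simp at hp
    exact hr₀ hp
  · split_ifs with h
    · rw [mul_add, exp_add, show (b r - b r₀) * η = -(b r₀ * η) - -(b r * η) by ring, exp_sub]
      rw [show exp (-(b r * η)) = exp (-(b r₀ * η)) from h, div_self (exp_ne_zero _), mul_one]
    · simp
  · have hτ : tau L y z ≠ 0 := fun h => hz (tau_eq_zero_iff.mp h)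
    apply mul_left_cancel₀ (mul_ne_zero hτ (exp_ne_zero (b r₀ * z)))
    rw [mul_zero, Finset.mul_sum]
    refine Eq.trans ?_ (hrel z)
    refine Finset.sum_congr rfl fun r _ => ?_
    simp only [hφ]
    rw [hgΨ r (m + 1) z hz, show b r * z = b r₀ * z + (b r - b r₀) * z by ring, exp_add]
    ring

end

section

variable {L : PeriodPair} {η lam : ℂ} {N : ℕ} {x : ℤ → Fin N → ℂ}

/-! ### The Lax pair -/

theorem tauMul_sub_const (y : Fin N → ℂ) (t : ℂ) (a : Fin 2) :
    tauMul L (fun i => y i - t) a = tauMul L y a * exp (qper L a * (N * t)) := by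
  rw [tauMul_eq (fun i => y i - t) y]
  simp

variable (L) in
/-- The multiplier of the functions of class `s`. -/
def classMul (y : Fin N → ℂ) (s : ℂ) (a : Fin 2) : ℂ := tauMul L y a * exp (qper L a * s)

variable (L η lam x) in
/-- The matrix of the spectral problem for the residues of a double-Bloch solution. -/
def laxMatrix (m : ℤ) (ζ : ℂ) : Matrix (Fin N) (Fin N) ℂ := Matrix.of fun i j =>
  lam * tau L (x (m + 1)) (x m i) * tau L (x m) (x m i - η) /
    (tau L (x (m + 1)) (x m i - η) * tauDeriv L (x m) i) *
    (sigma L (ζ + x m i - x m j) / sigma L (x m i - η - x m j))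

variable (L η lam x) in
/-- The matrix of the discrete time evolution of the residues of a double-Bloch solution. -/
def evolutionMatrix (m : ℤ) (s : ℂ) : Matrix (Fin N) (Fin N) ℂ := Matrix.of fun i j =>
  -(lam * tau L (x (m + 1)) (x (m + 1) i + η)) /
    (tau L (x m) (x (m + 1) i + η) * tauDeriv L (x (m + 1)) i) *
    (sigma L (x (m + 1) i - x m j + s) / sigma L s *
      ∏ l ∈ Finset.univ.erase j, sigma L (x (m + 1) i - x m l))

/-- The matrix encodes the bilinear equation at z = x_i^m − η. The factor σ(s) has been cleared so
that its entries are entire in ζ = s − η. -/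
theorem laxMatrix_mulVec (hx : Generic L η x) (hη : η ∉ L.lattice) {s : ℂ} (hs : s ∉ L.lattice)
    (m : ℤ) (c : Fin N → ℂ) (i : Fin N) :
    tau L (x (m + 1)) (x m i - η) * (tauDeriv L (x m) i *
      (laxMatrix L η lam x m (s - η)).mulVec c i) =
      sigma L s * (lam * tau L (x (m + 1)) (x m i) * interp L s (x m) c (x m i - η)) := by
  have hp : x m i - η ∉ poles L (x m) := fun h => hx.tau_self_sub hη m i (tau_eq_zero_iff.mpr h)
  have h1 := hx.tau_next_sub m i
  have h2 := tauDeriv_ne_zero (hx.distinct m) i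
  have h3 := sigma_ne_zero L hs
  rw [interp_eq _ _ hp]
  simp only [Matrix.mulVec, dotProduct, laxMatrix, Matrix.of_apply, Finset.mul_sum]
  refine Finset.sum_congr rfl fun j _ => ?_
  have h4 : sigma L (x m i - η - x m j) ≠ 0 := sigma_ne_zero L fun h => hp ⟨j, h⟩
  rw [show x m i - η - x m j + s = s - η + x m i - x m j by ring]
  field_simp

theorem evolutionMatrix_mulVec (hx : Generic L η x) (m : ℤ) (s : ℂ) (c : Fin N → ℂ) (i : Fin N) :
    tau L (x m) (x (m + 1) i + η) * (tauDeriv L (x (m + 1)) i *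
      (evolutionMatrix L η lam x m s).mulVec c i) =
      -(lam * tau L (x (m + 1)) (x (m + 1) i + η) * interp L s (x m) c (x (m + 1) i)) := by
  have h1 := hx.tau_prev_add m i
  have h2 := tauDeriv_ne_zero (hx.distinct (m + 1)) i
  rw [interp]
  simp only [Matrix.mulVec, dotProduct, evolutionMatrix, Matrix.of_apply, Finset.mul_sum,
    ← Finset.sum_neg_distrib]
  refine Finset.sum_congr rfl fun j _ => ?_
  field_simp

/-- The bilinear equation for functions of class `s` holds as soon as it holds at the points
`x m i - η` and `x (m + 1) i`. -/
theorem bilinear_of_values (hx : Generic L η x) {s : ℂ} (hs : s ∉ L.lattice) {m : ℤ}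
    {f fh f' : ℂ → ℂ} (hf : IsTheta L N (classMul L (x m) s) f)
    (hfh : IsTheta L N (classMul L (x m) s) fh)
    (hf' : IsTheta L N (classMul L (x (m + 1)) s) f')
    (h1 : ∀ i, tau L (x (m + 1)) (x m i - η) * fh (x m i) =
      lam * tau L (x (m + 1)) (x m i) * f (x m i - η))
    (h2 : ∀ i, tau L (x m) (x (m + 1) i + η) * f' (x (m + 1) i) =
      -(lam * tau L (x (m + 1)) (x (m + 1) i + η) * f (x (m + 1) i))) (z : ℂ) :
    tau L (x (m + 1)) z * fh (z + η) - lam * tau L (x (m + 1)) (z + η) * f z =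
      tau L (x m) (z + η) * f' z := by
  have t1 := ((isTheta_tau (L := L) (x (m + 1))).mul (hfh.comp_add η))
  have t2 := (((isTheta_tau (L := L) (x (m + 1))).comp_add η).mul hf).const_mul lam
  have t3 := ((isTheta_tau (L := L) (x m)).comp_add η).mul hf'
  have t2' := t2.congr (α₁ := fun a => tauMul L (x (m + 1)) a *
    (classMul L (x m) s a * exp (N * qper L a * η))) rfl fun a => by ring
  have t3' := t3.congr (α₁ := fun a => tauMul L (x (m + 1)) a *
    (classMul L (x m) s a * exp (N * qper L a * η))) rfl fun a => by
      simp only [classMul]; ring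
  have hF := (t1.sub t2').sub t3'
  obtain ⟨k, hk, hFk⟩ := hF.dvd_tau (fun a => mul_ne_zero (tauMul_ne_zero _ _)
    (mul_ne_zero (mul_ne_zero (tauMul_ne_zero _ _) (exp_ne_zero _)) (exp_ne_zero _)))
    (hx.distinct (m + 1)) (fun i => by
      rw [tau_apply_self]; linear_combination -h2 i)
  -- After division by τ^{m+1} the defect has degree N and class s relative to the points x_i^m − η,
  -- and it vanishes at all of them.
  have hk0 : ∀ z, k z = 0 := by
    refine IsTheta.eq_zero_of_forall (L := L) (s := s) (b := 0) (y := fun i => x m i - η)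
      (hk.congr (by ring) fun a => ?_) hs (fun i j hij => ?_) fun i => ?_
    · rw [mul_div_cancel_left₀ _ (tauMul_ne_zero _ _), tauMul_sub_const, classMul]
      ring_nf
    · rw [sub_sub_sub_cancel_right]; exact hx.distinct m i j hij
    · have := hFk (x m i - η)
      rw [sub_add_cancel, tau_apply_self] at this
      refine (mul_eq_zero.mp (Eq.trans this.symm ?_)).resolve_left (hx.tau_next_sub m i)
      linear_combination h1 i
  have := hFk z
  rw [hk0, mul_zero] at this
  linear_combination this

/-- Holds for every vector c: the matrix image of c stands in for the shifted function. For an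
eigenvector the two differ by a scalar, and the actual equation results. -/
theorem bilinear_interp (hx : Generic L η x) (hη : η ∉ L.lattice) {s : ℂ} (hs : s ∉ L.lattice)
    (m : ℤ) (c : Fin N → ℂ) (z : ℂ) :
    tau L (x (m + 1)) z *
        interp L s (x m) ((sigma L s)⁻¹ • (laxMatrix L η lam x m (s - η)).mulVec c) (z + η) -
      lam * tau L (x (m + 1)) (z + η) * interp L s (x m) c z =
      tau L (x m) (z + η) *
        interp L s (x (m + 1)) ((evolutionMatrix L η lam x m s).mulVec c) z := by
  refine bilinear_of_values hx hs (isTheta_interp s _ _) (isTheta_interp s _ _)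
    (isTheta_interp s _ _) (fun i => ?_) (fun i => ?_) z
  · have h := laxMatrix_mulVec (lam := lam) hx hη hs m c i
    have h3 := sigma_ne_zero L hs
    rw [interp_apply_self hs, Pi.smul_apply, smul_eq_mul]
    field_simp
    linear_combination h
  · rw [interp_apply_self hs, ← evolutionMatrix_mulVec hx]
    ring

theorem interp_injective {s : ℂ} (hs : s ∉ L.lattice) {y : Fin N → ℂ}
    (hy : ∀ i j, i ≠ j → y i - y j ∉ L.lattice) {c : Fin N → ℂ} (h : ∀ z, interp L s y c z = 0) :
    c = 0 := by
  funext i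
  have := h (y i)
  rw [interp_apply_self hs] at this
  exact (mul_eq_zero.mp this).resolve_right (tauDeriv_ne_zero hy i)

/-- Both sides applied to c reduce, for row i with p = x_i^{m+1}, to values at p − η and p, which
`bilinear_interp` at p − η relates. What is left is the equation of motion at p. -/
theorem laxMatrix_mul_evolutionMatrix (hx : Generic L η x) (hη : η ∉ L.lattice)
    (he : EquationsOfMotion L η x) {s : ℂ} (hs : s ∉ L.lattice) (m : ℤ) :
    laxMatrix L η lam x (m + 1) (s - η) * evolutionMatrix L η lam x m s =
      evolutionMatrix L η lam x m s * laxMatrix L η lam x m (s - η) := by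
  rw [← Matrix.mulVec_injective.eq_iff]
  funext c i
  rw [← Matrix.mulVec_mulVec, ← Matrix.mulVec_mulVec]
  have hσ := sigma_ne_zero L hs
  set p := x (m + 1) i
  set c' := (evolutionMatrix L η lam x m s).mulVec c with hc'
  set ch := (laxMatrix L η lam x m (s - η)).mulVec c with hch
  have h1 := laxMatrix_mulVec (lam := lam) hx hη hs (m + 1) c' i
  have h2 := evolutionMatrix_mulVec (lam := lam) hx m s ((sigma L s)⁻¹ • ch) i
  have h3 := bilinear_interp (lam := lam) hx hη hs m c (p - η)
  rw [sub_add_cancel, tau_apply_self] at h3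
  rw [Matrix.mulVec_smul, Pi.smul_apply, smul_eq_mul] at h2
  have h4 := he m i
  have n1 := hx.tau_next_sub (m + 1) i
  have n2 := hx.tau_prev_add m i
  have n3 := tauDeriv_ne_zero (hx.distinct (m + 1)) i
  have n4 := hx.tau_prev m i
  apply mul_left_cancel₀ (mul_ne_zero (mul_ne_zero n1 n2) (mul_ne_zero n3 n4))
  rw [← hch, ← hc'] at h3
  change tau L (x (m + 1 + 1)) (p - η) * _ = _ at h1
  change tau L (x m) (p + η) * _ = _ at h2
  generalize interp L s (x (m + 1)) c' (p - η) = F' at *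
  have h3' : tau L (x (m + 1)) (p - η) *
    interp L s (x m) ((sigma L s)⁻¹ • ch) p = tau L (x m) p * F' := by linear_combination h3
  generalize interp L s (x m) ((sigma L s)⁻¹ • ch) p = Fh at *
  have h2' : tau L (x m) (p + η) * (tauDeriv L (x (m + 1)) i *
      (evolutionMatrix L η lam x m s).mulVec ch i) =
      -(sigma L s * (lam * tau L (x (m + 1)) (p + η) * Fh)) := by
    rw [← mul_right_inj' (inv_ne_zero hσ)]
    rw [mul_neg, inv_mul_cancel_left₀ hσ]
    linear_combination h2
  linear_combination (tau L (x m) (p + η) * tau L (x m) p) * h1 -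
    (tau L (x (m + 1 + 1)) (p - η) * tau L (x m) p) * h2' -
    (sigma L s * lam * tau L (x (m + 1 + 1)) p * tau L (x m) (p + η)) * h3' -
    (sigma L s * lam * Fh) * h4

/-- A kernel vector gives a function vanishing at all x_i^{m+1}. Its quotient by τ^{m+1} has degree
0 and class s + Σ(x_i^{m+1} − x_i^m), so it is zero. -/
theorem evolutionMatrix_det_ne_zero (hx : Generic L η x) (hη : η ∉ L.lattice) (hlam : lam ≠ 0)
    {s : ℂ} (hs : s ∉ L.lattice) {m : ℤ} (h : s + ∑ i, (x (m + 1) i - x m i) ∉ L.lattice) :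
    (evolutionMatrix L η lam x m s).det ≠ 0 := by
  intro hdet
  obtain ⟨c, hc0, hc⟩ := Matrix.exists_mulVec_eq_zero_iff.mpr hdet
  refine hc0 (interp_injective hs (hx.distinct m) fun z => ?_)
  obtain ⟨k, hk, hfk⟩ := (isTheta_interp (L := L) s (x m) c).dvd_tau
    (fun a => mul_ne_zero (tauMul_ne_zero _ _) (exp_ne_zero _)) (hx.distinct (m + 1)) fun i => by
      have := evolutionMatrix_mulVec (lam := lam) hx m s c i
      rw [hc, Pi.zero_apply, mul_zero, mul_zero, eq_comm, neg_eq_zero] at this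
      exact (mul_eq_zero.mp this).resolve_left
        (mul_ne_zero hlam (hx.tau_self_add hη (m + 1) i))
  rw [hfk, (hk.congr (α₁ := fun a => exp (qper L a * (s + ∑ i, (x (m + 1) i - x m i)) +
    0 * per L a)) (sub_self _) fun a => ?_).eq_zero_of_class h, mul_zero]
  rw [tauMul_eq (x m) (x (m + 1)), mul_assoc, mul_div_cancel_left₀ _ (tauMul_ne_zero _ _),
    ← exp_add]
  ring_nf

/-- A kernel vector gives a function vanishing at all x_i^m − η; dividing these zeros out leaves
degree 0 and class s − Nη. A nonzero eigenvalue is needed later in order to take its logarithm. -/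
theorem laxMatrix_det_ne_zero (hx : Generic L η x) (hη : η ∉ L.lattice) (hlam : lam ≠ 0)
    {s : ℂ} (hs : s ∉ L.lattice) (m : ℤ) (h : s - N * η ∉ L.lattice) :
    (laxMatrix L η lam x m (s - η)).det ≠ 0 := by
  intro hdet
  obtain ⟨c, hc0, hc⟩ := Matrix.exists_mulVec_eq_zero_iff.mpr hdet
  refine hc0 (interp_injective hs (hx.distinct m) fun z => ?_)
  obtain ⟨k, hk, hfk⟩ := (isTheta_interp (L := L) s (x m) c).dvd_tau (y := fun i => x m i - η)
    (fun a => mul_ne_zero (tauMul_ne_zero _ _) (exp_ne_zero _))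
    (fun i j hij => by rw [sub_sub_sub_cancel_right]; exact hx.distinct m i j hij) fun i => by
      have := laxMatrix_mulVec (lam := lam) hx hη hs m c i
      rw [hc, Pi.zero_apply, mul_zero, mul_zero, eq_comm] at this
      exact (mul_eq_zero.mp ((mul_eq_zero.mp this).resolve_left
        (sigma_ne_zero L hs))).resolve_left (mul_ne_zero hlam (hx.tau_next m i))
  rw [hfk, (hk.congr (α₁ := fun a => exp (qper L a * (s - N * η) +
    0 * per L a)) (sub_self _) fun a => ?_).eq_zero_of_class h, mul_zero]
  rw [tauMul_sub_const, mul_div_mul_left _ _ (tauMul_ne_zero _ _), ← exp_sub]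
  ring_nf

theorem differentiable_laxMatrix (m : ℤ) (i j : Fin N) :
    Differentiable ℂ fun ζ => laxMatrix L η lam x m ζ i j := by
  have := differentiable_sigma L
  simp only [laxMatrix, Matrix.of_apply]
  fun_prop

/-- For ζ outside a countable set the two matrices are conjugate by the invertible evolution matrix;
the remaining ζ follow by continuity. -/
theorem charpoly_laxMatrix_succ (hx : Generic L η x) (hη : η ∉ L.lattice) (hlam : lam ≠ 0)
    (he : EquationsOfMotion L η x) (m : ℤ) (ζ ν : ℂ) :
    (Matrix.scalar (Fin N) ν - laxMatrix L η lam x (m + 1) ζ).det =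
      (Matrix.scalar (Fin N) ν - laxMatrix L η lam x m ζ).det := by
  have hcont : ∀ m, Continuous fun ζ => (Matrix.scalar (Fin N) ν - laxMatrix L η lam x m ζ).det :=
    fun m => Continuous.matrix_det (continuous_const.sub
      (continuous_matrix fun i j => (differentiable_laxMatrix m i j).continuous))
  have hcount : ∀ t : ℂ, {ζ | ζ + t ∈ L.lattice}.Countable := fun t =>
    (countable_lattice L).preimage_of_injOn (f := fun z => z + t) (add_left_injective t).injOn
  refine eq_of_eq_off_countable (hcont (m + 1)) (hcont m)
    ((hcount η).union (hcount (η + ∑ i, (x (m + 1) i - x m i)))) (fun ζ hζ => ?_) ζ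
  simp only [Set.mem_union, Set.mem_ofPred_eq, not_or] at hζ
  rw [← add_assoc] at hζ
  have h := laxMatrix_mul_evolutionMatrix (lam := lam) hx hη he hζ.1 m
  have hd := evolutionMatrix_det_ne_zero (lam := lam) hx hη hlam hζ.1 hζ.2
  rw [add_sub_cancel_right] at h
  apply mul_right_cancel₀ hd
  rw [← Matrix.det_mul, sub_mul, h, mul_comm (Matrix.det _), ← Matrix.det_mul, mul_sub,
    (Matrix.scalar_commute ν (fun r => mul_comm ν r) _).eq]

theorem charpoly_laxMatrix (hx : Generic L η x) (hη : η ∉ L.lattice) (hlam : lam ≠ 0)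
    (he : EquationsOfMotion L η x) (m : ℤ) (ζ ν : ℂ) :
    (Matrix.scalar (Fin N) ν - laxMatrix L η lam x m ζ).det =
      (Matrix.scalar (Fin N) ν - laxMatrix L η lam x 0 ζ).det := by
  induction m using Int.induction_on with
  | zero => rfl
  | succ n ih => rw [charpoly_laxMatrix_succ hx hη hlam he, ih]
  | pred n ih => rw [← charpoly_laxMatrix_succ hx hη hlam he, sub_add_cancel, ih]

end

section

variable {L : PeriodPair} {η lam : ℂ} {N : ℕ} {x : ℤ → Fin N → ℂ}

/-! ### The spectral curve -/

theorem charpoly_coeff_smul (A : Matrix (Fin N) (Fin N) ℂ) {c : ℂ} (hc : c ≠ 0) {j : ℕ}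
    (hj : j ≤ N) : (c • A).charpoly.coeff j = c ^ (N - j) * A.charpoly.coeff j := by
  have h : (c • A).charpoly.comp (C c * X) = C (c ^ N) * A.charpoly := by
    refine Polynomial.funext fun t => ?_
    rw [eval_comp, Matrix.eval_charpoly, eval_mul, eval_C, eval_mul, eval_C, eval_X,
      Matrix.eval_charpoly]
    have : Matrix.scalar (Fin N) (c * t) - c • A = c • (Matrix.scalar (Fin N) t - A) := by
      rw [smul_sub, Matrix.scalar_apply, Matrix.scalar_apply, ← Matrix.diagonal_smul]
      rfl
    rw [this, Matrix.det_smul, Fintype.card_fin]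
  have hcoeff := congrArg (fun p => p.coeff j) h
  simp only [comp_C_mul_X_coeff, coeff_C_mul] at hcoeff
  apply mul_right_cancel₀ (pow_ne_zero j hc)
  rw [hcoeff, mul_right_comm, ← pow_add, Nat.sub_add_cancel hj]

/-- The coefficients are universal polynomials in the entries. -/
theorem differentiable_charpoly_coeff {A : ℂ → Matrix (Fin N) (Fin N) ℂ}
    (hA : ∀ i j, Differentiable ℂ fun ζ => A ζ i j) (n : ℕ) :
    Differentiable ℂ fun ζ => (A ζ).charpoly.coeff n := by
  have h : ∀ p : MvPolynomial (Fin N × Fin N) ℂ,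
      Differentiable ℂ fun ζ => MvPolynomial.eval (fun ij => A ζ ij.1 ij.2) p := by
    intro p
    induction p using MvPolynomial.induction_on with
    | C a => simp
    | add p q hp hq => simpa using hp.fun_add hq
    | mul_X p ij hp => simpa using hp.fun_mul (hA ij.1 ij.2)
  convert h ((Matrix.charpoly.univ ℂ (Fin N)).coeff n) using 2 with ζ
  exact (Matrix.charpoly.univ_coeff_eval₂Hom (Fin N) (RingHom.id ℂ)
    (fun ij => A ζ ij.1 ij.2) n).symm

theorem laxMatrix_add_per (m : ℤ) (a : Fin 2) (ζ : ℂ) (i j : Fin N) :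
    laxMatrix L η lam x m (ζ + per L a) i j =
      sigmaMul L 0 a * exp (qper L a * ζ) * (exp (qper L a * x m i) *
        laxMatrix L η lam x m ζ i j * exp (-(qper L a * x m j))) := by
  simp only [laxMatrix, Matrix.of_apply]
  rw [show ζ + per L a + x m i - x m j = (ζ + x m i - x m j) + per L a by ring,
    isTheta_sigma.add_per, show 1 * qper L a * (ζ + x m i - x m j) = qper L a * ζ +
      qper L a * x m i + -(qper L a * x m j) by ring, exp_add, exp_add]
  ring

/-- A period shift of ζ multiplies the Lax matrix by a scalar and conjugates it by a diagonal
matrix, so only powers of the scalar reach the characteristic polynomial. Squaring makes the degree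
even. -/
theorem isTheta_charpoly_coeff (m : ℤ) {j : ℕ} (hj : j ≤ N) :
    IsTheta L (2 * (N - j : ℕ)) (fun a => sigmaMul L 0 a ^ (2 * (N - j)))
      (fun ζ => ((laxMatrix L η lam x m ζ) ^ 2).charpoly.coeff j) where
  differentiable := by
    refine differentiable_charpoly_coeff (fun i k => ?_) j
    have h := differentiable_laxMatrix (L := L) (η := η) (lam := lam) (x := x) m
    simp only [pow_two, Matrix.mul_apply]
    exact Differentiable.fun_sum fun l _ => (h i l).mul (h l k)
  add_per a ζ := by
    have hμ : sigmaMul L 0 a * exp (qper L a * ζ) ≠ 0 :=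
      mul_ne_zero (sigmaMul_ne_zero _ _) (exp_ne_zero _)
    set D := Matrix.diagonal fun i => exp (qper L a * x m i) with hD
    set D' := Matrix.diagonal fun i => exp (-(qper L a * x m i)) with hD'
    have hDD : D' * D = 1 := by
      rw [hD, hD', Matrix.diagonal_mul_diagonal, ← Matrix.diagonal_one]
      congr 1
      funext i
      rw [← exp_add, neg_add_cancel, exp_zero]
    have h1 : laxMatrix L η lam x m (ζ + per L a) =
        (sigmaMul L 0 a * exp (qper L a * ζ)) • (D * laxMatrix L η lam x m ζ * D') := by
      ext i j
      rw [laxMatrix_add_per, Matrix.smul_apply, hD, hD', Matrix.mul_diagonal,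
        Matrix.diagonal_mul, smul_eq_mul]
    have h2 : (D * laxMatrix L η lam x m ζ * D') ^ 2 = D * (laxMatrix L η lam x m ζ ^ 2 * D') := by
      rw [pow_two, pow_two, show D * laxMatrix L η lam x m ζ * D' *
        (D * laxMatrix L η lam x m ζ * D') = D * laxMatrix L η lam x m ζ * (D' * D) *
        (laxMatrix L η lam x m ζ * D') by simp only [Matrix.mul_assoc], hDD]
      simp only [Matrix.mul_assoc, Matrix.one_mul]
    rw [h1, _root_.smul_pow, charpoly_coeff_smul _ (pow_ne_zero 2 hμ) hj, h2, Matrix.charpoly_mul_comm,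
      Matrix.mul_assoc, hDD, Matrix.mul_one, ← pow_mul, mul_pow, ← exp_nat_mul]
    push_cast
    ring_nf

theorem exists_spectralPolynomial (hη : η ∉ L.lattice) :
    ∃ P : (MvPolynomial (Fin 2) ℂ)[X], P.Monic ∧ P.natDegree = 2 * N ∧
      ∀ ζ k : ℂ, Regular L η ζ →
        den L η ζ ^ N * (P.map (MvPolynomial.eval ![coordU L η ζ, coordV L η ζ])).eval k =
          (Matrix.scalar (Fin N) (k ^ 2 * den L η ζ) - laxMatrix L η lam x 0 ζ ^ 2).det := by
  have h : ∀ j : Fin N, ∃ p : MvPolynomial (Fin 2) ℂ, ∀ ζ, Regular L η ζ →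
      (laxMatrix L η lam x 0 ζ ^ 2).charpoly.coeff j =
        den L η ζ ^ (N - j) * MvPolynomial.eval ![coordU L η ζ, coordV L η ζ] p := fun j =>
    (isTheta_charpoly_coeff 0 j.2.le).exists_mvPolynomial hη
  choose p hp using h
  set Q : (MvPolynomial (Fin 2) ℂ)[X] := ∑ j : Fin N, C (p j) * X ^ (j : ℕ) with hQ
  have hdeg : Q.degree < N := by
    refine (degree_sum_le _ _).trans_lt ((Finset.sup_lt_iff (WithBot.bot_lt_coe N)).mpr fun j _ => ?_)
    exact (degree_C_mul_X_pow_le _ _).trans_lt (WithBot.coe_lt_coe.mpr (Nat.cast_lt.mpr j.2))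
  have hmon : (X ^ N + Q).Monic := monic_X_pow_add hdeg
  have hnat : (X ^ N + Q).natDegree = N := by
    refine natDegree_eq_of_degree_eq_some ?_
    rw [degree_add_eq_left_of_degree_lt (by rwa [degree_X_pow]), degree_X_pow]
  -- The characteristic polynomial of the squared matrix is taken at k² · `den`; dividing by `den`^N
  -- leaves a monic polynomial of degree N in k².
  refine ⟨expand _ 2 (X ^ N + Q), hmon.expand two_pos, by rw [natDegree_expand, hnat, mul_comm],
    fun ζ k hζ => ?_⟩
  have hN : (laxMatrix L η lam x 0 ζ ^ 2).charpoly.natDegree = N := by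
    rw [Matrix.charpoly_natDegree_eq_dim, Fintype.card_fin]
  have hlead := (Matrix.charpoly_monic (laxMatrix L η lam x 0 ζ ^ 2)).coeff_natDegree
  rw [hN] at hlead
  rw [map_expand, expand_eval, ← Matrix.eval_charpoly,
    eval_eq_sum_range (p := (laxMatrix L η lam x 0 ζ ^ 2).charpoly), hN, Finset.sum_range_succ,
    hlead, Finset.sum_range]
  simp only [hQ, Polynomial.map_add, Polynomial.map_pow, map_X, Polynomial.map_sum,
    Polynomial.map_mul, map_C, eval_add, eval_pow, eval_X, eval_finsetSum, eval_mul, eval_C]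
  rw [mul_add, Finset.mul_sum, add_comm]
  congr 1
  · refine Finset.sum_congr rfl fun j _ => ?_
    rw [hp j ζ hζ, mul_pow, mul_assoc, mul_left_comm, mul_comm (den L η ζ ^ _) _]
    have : den L η ζ ^ N = den L η ζ ^ (N - j) * den L η ζ ^ (j : ℕ) := by
      rw [← pow_add, Nat.sub_add_cancel j.2.le]
    rw [this]
    ring
  · ring

/-- The squared matrix has eigenvalue ν² exactly when the matrix itself has eigenvalue ν or −ν; the
two signs correspond to the two values of exp(ℓ/2). -/
theorem det_scalar_sq_sub_sq (A : Matrix (Fin N) (Fin N) ℂ) (ν : ℂ) :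
    (Matrix.scalar (Fin N) (ν ^ 2) - A ^ 2).det =
      (Matrix.scalar (Fin N) ν - A).det * (Matrix.scalar (Fin N) (-ν) - A).det * (-1) ^ N := by
  have h : Matrix.scalar (Fin N) (ν ^ 2) - A ^ 2 =
      (Matrix.scalar (Fin N) ν - A) * (-(Matrix.scalar (Fin N) (-ν) - A)) := by
    have := (Matrix.scalar_commute ν (fun r => mul_comm ν r) A)
    rw [map_pow, this.sq_sub_sq, map_neg, neg_sub, sub_neg_eq_add, add_comm A]
    exact ((Commute.refl _).add_left this.symm).sub_right ((this).add_left (Commute.refl A))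
  rw [h, Matrix.det_mul, Matrix.det_neg, Fintype.card_fin]
  ring

theorem exists_eigenvector_iff (A : Matrix (Fin N) (Fin N) ℂ) (ν : ℂ) :
    (∃ c, c ≠ 0 ∧ A.mulVec c = ν • c) ↔ (Matrix.scalar (Fin N) ν - A).det = 0 := by
  rw [← Matrix.exists_mulVec_eq_zero_iff]
  refine exists_congr fun c => and_congr_right fun _ => ?_
  rw [Matrix.sub_mulVec, sub_eq_zero, eq_comm, Matrix.scalar_apply,
    ← Matrix.smul_one_eq_diagonal, Matrix.smul_mulVec, Matrix.one_mulVec]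

end

section

variable {L : PeriodPair} {η lam : ℂ} {N : ℕ} {x : ℤ → Fin N → ℂ}

/-! ### Solutions and eigenvectors -/

/-- The residues of a solution of class `s` are eigenvectors of the Lax matrix. -/
theorem IsBilinearSolution.laxMatrix_mulVec (hx : Generic L η x) (hη : η ∉ L.lattice)
    {B : Fin 2 → ℂ} {g : ℤ → ℂ → ℂ} (hg : IsBilinearSolution L η lam x B g) {s b : ℂ}
    (hs : s ∉ L.lattice) {c : ℤ → Fin N → ℂ}
    (hgc : ∀ m z, g m z = interp L s (x m) (c m) z * exp (b * z)) (m : ℤ) :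
    (laxMatrix L η lam x m (s - η)).mulVec (c m) = (exp (b * η) * sigma L s) • c m := by
  funext i
  have h1 := EllipticHirota.laxMatrix_mulVec (lam := lam) hx hη hs m (c m) i
  have h2 := hg.at_self_sub m i
  have h3 := hx.tau_next_sub m i
  have h4 := tauDeriv_ne_zero (hx.distinct m) i
  rw [hgc, hgc, interp_apply_self hs, show b * x m i = b * (x m i - η) + b * η by ring,
    exp_add] at h2
  have h5 : tau L (x (m + 1)) (x m i - η) * (c m i * tauDeriv L (x m) i * exp (b * η)) =
      lam * tau L (x (m + 1)) (x m i) * interp L s (x m) (c m) (x m i - η) :=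
    mul_right_cancel₀ (exp_ne_zero (b * (x m i - η))) (by linear_combination h2)
  rw [Pi.smul_apply, smul_eq_mul]
  apply mul_left_cancel₀ (mul_ne_zero h3 h4)
  linear_combination h1 - sigma L s * h5

/-- Invertible steps allow the recursion to run backwards as well as forwards. -/
theorem exists_int_seq {V : Type*} (S : ℤ → V ≃ V) (v : V) :
    ∃ c : ℤ → V, c 0 = v ∧ ∀ m, c (m + 1) = S m (c m) := by
  let F : ℕ → V := fun n => Nat.rec v (fun n w => S n w) n
  let G : ℕ → V := fun n => Nat.rec v (fun n w => (S (Int.negSucc n)).symm w) n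
  refine ⟨fun m => match m with
    | Int.ofNat n => F n
    | Int.negSucc n => G (n + 1), rfl, fun m => ?_⟩
  match m with
  | Int.ofNat n => rfl
  | Int.negSucc 0 =>
    change v = S (Int.negSucc 0) ((S (Int.negSucc 0)).symm v)
    simp
  | Int.negSucc (n + 1) =>
    change G (n + 1) = S (Int.negSucc (n + 1)) ((S (Int.negSucc (n + 1))).symm (G (n + 1)))
    simp

/-- Eigenvectors of the Lax matrix at time `0` give solutions. -/
theorem exists_solution_of_eigenvector (hx : Generic L η x) (hη : η ∉ L.lattice) (hlam : lam ≠ 0)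
    (he : EquationsOfMotion L η x) {s b : ℂ} (hs : s ∉ L.lattice)
    (hgen : ∀ m, s + ∑ i, (x (m + 1) i - x m i) ∉ L.lattice) {v : Fin N → ℂ} (hv : v ≠ 0)
    (heig : (laxMatrix L η lam x 0 (s - η)).mulVec v = (exp (b * η) * sigma L s) • v) :
    ∃ c : ℤ → Fin N → ℂ, (∀ m, c m ≠ 0) ∧
      IsBilinearSolution L η lam x (fun a => exp (qper L a * s + b * per L a))
        (fun m z => interp L s (x m) (c m) z * exp (b * z)) := by
  have hdet := fun m => evolutionMatrix_det_ne_zero (lam := lam) hx hη hlam hs (hgen m)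
  let S : ℤ → (Fin N → ℂ) ≃ (Fin N → ℂ) := fun m =>
    { toFun := (evolutionMatrix L η lam x m s).mulVec
      invFun := (evolutionMatrix L η lam x m s)⁻¹.mulVec
      left_inv := fun w => by
        rw [Matrix.mulVec_mulVec, Matrix.nonsing_inv_mul _ (hdet m).isUnit, Matrix.one_mulVec]
      right_inv := fun w => by
        rw [Matrix.mulVec_mulVec, Matrix.mul_nonsing_inv _ (hdet m).isUnit, Matrix.one_mulVec] }
  have hS : ∀ m w, S m w = (evolutionMatrix L η lam x m s).mulVec w := fun m w => rfl
  obtain ⟨c, hc0, hc⟩ := exists_int_seq S v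
  have hS0 : ∀ m w, S m w = 0 ↔ w = 0 := fun m w => by
    rw [← (S m).apply_eq_iff_eq (x := w), hS m 0, Matrix.mulVec_zero]
  have hne : ∀ m, c m ≠ 0 := by
    intro m
    induction m using Int.induction_on with
    | zero => rwa [hc0]
    | succ n ih => rw [hc]; exact fun h => ih ((hS0 _ _).mp h)
    | pred n ih =>
      rw [← sub_add_cancel (-(n : ℤ)) 1, hc] at ih
      exact fun h => ih ((hS0 _ _).mpr h)
  have hint := laxMatrix_mul_evolutionMatrix (lam := lam) hx hη he hs
  -- Compatibility transports the defect of the eigenvalue equation along the evolution, so it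
  -- vanishes at all times once it vanishes at time 0.
  have hstep : ∀ m w (ν : ℂ), (laxMatrix L η lam x (m + 1) (s - η)).mulVec (S m w) - ν • S m w =
      S m ((laxMatrix L η lam x m (s - η)).mulVec w - ν • w) := by
    intro m w ν
    rw [hS, hS, Matrix.mulVec_mulVec, hint, Matrix.mulVec_sub, Matrix.mulVec_mulVec,
      Matrix.mulVec_smul]
  have heigm : ∀ m, (laxMatrix L η lam x m (s - η)).mulVec (c m) -
      (exp (b * η) * sigma L s) • c m = 0 := by
    intro m
    induction m using Int.induction_on with
    | zero => rw [hc0, heig, sub_self]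
    | succ n ih => rw [hc, hstep, ih, hS0]
    | pred n ih =>
      rw [← sub_add_cancel (-(n : ℤ)) 1, hc, hstep] at ih
      exact (hS0 _ _).mp ih
  refine ⟨c, hne, fun m => ?_, fun m z => ?_⟩
  · refine ((isTheta_interp s (x m) (c m)).mul (IsTheta.exp_mul b)).congr (add_zero _) fun a => ?_
    rw [mul_assoc, ← exp_add]
  · have h := bilinear_interp (lam := lam) hx hη hs m (c m) z
    rw [sub_eq_zero.mp (heigm m), smul_smul, ← hS, ← hc, mul_comm (exp (b * η)),
      inv_mul_cancel_left₀ (sigma_ne_zero L hs)] at h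
    have hlin : interp L s (x m) (exp (b * η) • c m) (z + η) =
        exp (b * η) * interp L s (x m) (c m) (z + η) := by
      simp only [interp, Finset.mul_sum, Pi.smul_apply, smul_eq_mul, mul_assoc]
    rw [hlin] at h
    rw [mul_add b z η, exp_add]
    linear_combination exp (b * z) * h

/-! ### The explicit form of the solutions -/

/-- The powers in Φ and k combine into one gauge factor exp(bz) with bη = ℓ/2 + κ; the parts
depending on y_i are absorbed by the coefficients. -/
theorem sum_Phi {ζ ℓ κ : ℂ} (hη0 : η ≠ 0) (y c : Fin N → ℂ) {z : ℂ} (hz : z ∉ poles L y) :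
    ∑ i, c i * Phi L η ζ ℓ (z - y i) * exp (κ * (z / η)) =
      interp L (ζ + η) y (fun i => c i * exp (-(ℓ * y i / (2 * η)))) z *
        exp ((ℓ / 2 + κ) / η * z) / tau L y z := by
  have hτ : tau L y z ≠ 0 := fun h => hz (tau_eq_zero_iff.mp h)
  rw [interp_eq _ _ hz, mul_assoc, mul_div_cancel_left₀ _ hτ, Finset.sum_mul]
  refine Finset.sum_congr rfl fun i _ => ?_
  have e : exp (ℓ * ((z - y i) / (2 * η))) * exp (κ * (z / η)) =
      exp (-(ℓ * y i / (2 * η))) * exp ((ℓ / 2 + κ) / η * z) := by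
    rw [← exp_add, ← exp_add]
    congr 1
    field_simp
    ring
  rw [Phi, show ζ + (z - y i) + η = z - y i + (ζ + η) by ring]
  linear_combination c i * (sigma L (z - y i + (ζ + η)) /
    (sigma L (ζ + η) * sigma L (z - y i))) * e

/-- A solution whose numerators are interpolated from residues has the explicit form. -/
theorem hasForm_of_interp {ζ ℓ κ : ℂ} (hη0 : η ≠ 0)
    (hℓ : exp ℓ = sigma L (ζ - η) / sigma L (ζ + η)) {c : ℤ → Fin N → ℂ} {ψ : ℤ → ℂ → ℂ}
    (h : ∀ m, ∀ z ∉ poles L (x m), ψ m z =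
      interp L (ζ + η) (x m) (c m) z * exp ((ℓ / 2 + κ) / η * z) / tau L (x m) z) :
    HasForm L η x ζ (exp κ) ψ := by
  refine ⟨ℓ, κ, fun m i => c m i * exp (ℓ * x m i / (2 * η)), hℓ, rfl, fun m z hz => ?_⟩
  rw [sum_Phi hη0 _ _ hz, h m z hz]
  simp only [mul_assoc, ← exp_add, add_neg_cancel, exp_zero, mul_one]

theorem EquivMultipliers.of_forall {B B' : Fin 2 → ℂ} {b : ℂ}
    (h : ∀ a, B' a = B a * exp (b * per L a)) : EquivMultipliers L (B 0, B 1) (B' 0, B' 1) :=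
  ⟨b, h 0, h 1⟩

/-- With ζ = s − η, the excluded classes are s ∈ Λ and s − 2η ∈ Λ; the second has multipliers
equivalent to exp(2η q_a). Otherwise interpolation at the x_i^m applies, and k is fixed by bη = ℓ/2
+ log k. -/
theorem exists_hasForm (hx : Generic L η x) (hη : η ∉ L.lattice) {A : ℂ × ℂ} {ψ : ℤ → ℂ → ℂ}
    (hψ : IsDoubleBlochSolution L η lam x A ψ) (h1 : ¬ EquivMultipliers L (1, 1) A)
    (h2 : ¬ EquivMultipliers L
      (exp (4 * η * zetaW L (L.ω₁ / 2)), exp (4 * η * zetaW L (L.ω₂ / 2))) A) :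
    ∃ ζ k : ℂ, Regular L η ζ ∧ k ≠ 0 ∧ HasForm L η x ζ k ψ := by
  have hη0 : η ≠ 0 := by rintro rfl; exact hη (zero_mem _)
  obtain ⟨g, hg, hgψ⟩ := hψ.exists_bilinear
  set B : Fin 2 → ℂ := ![A.1, A.2] with hB
  have hψg : ∀ m, ∀ z ∉ poles L (x m), ψ m z = g m z / tau L (x m) z := by
    intro m z hz
    rw [hgψ m z hz, mul_div_cancel_left₀ _ fun h => hz (tau_eq_zero_iff.mp h)]
  by_cases hB0 : ∀ a, B a ≠ 0
  · obtain ⟨s, b, hsb⟩ := exists_class (L := L) hB0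
    have hs : s ∉ L.lattice := by
      intro hs
      obtain ⟨b', hb'⟩ := exists_of_mem_lattice hs
      refine h1 (EquivMultipliers.of_forall (B := fun _ => 1) (B' := B) (b := b - b') fun a => ?_)
      rw [hsb, ← hb' a, ← exp_add]
      ring_nf
    have hs2 : s - 2 * η ∉ L.lattice := by
      intro hs
      obtain ⟨b', hb'⟩ := exists_of_mem_lattice hs
      refine h2 (EquivMultipliers.of_forall (B := fun a => exp (4 * η * zetaW L (per L a / 2)))
        (B' := B) (b := b - b') fun a => ?_)
      rw [hsb, ← mul_one (exp (4 * η * _)), ← hb' a, ← exp_add, ← exp_add, qper]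
      ring_nf
    have hreg : Regular L η (s - η) := by
      refine ⟨?_, by rwa [sub_add_cancel]⟩
      rwa [show s - η - η = s - 2 * η by ring]
    have hden := den_ne_zero_iff.mpr hreg
    rw [den, mul_ne_zero_iff] at hden
    refine ⟨s - η, exp (b * η - log (sigma L (s - η - η) / sigma L (s - η + η)) / 2), hreg,
      exp_ne_zero _, hasForm_of_interp hη0 (exp_log (div_ne_zero hden.2 hden.1))
      (c := fun m i => g m (x m i) * exp (-b * x m i) / tauDeriv L (x m) i) fun m z hz => ?_⟩
    have hθ := (((hg.theta m).mul (IsTheta.exp_mul (-b))).congr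
      (α₁ := fun a => tauMul L (x m) a * exp (qper L a * s)) (add_zero _) fun a => by
        rw [hsb, mul_assoc, ← exp_add]; ring_nf).eq_interp hs (hx.distinct m) z
    rw [sub_add_cancel, ← hθ, hψg m z hz, mul_assoc, ← exp_add, add_sub_cancel,
      mul_div_cancel_right₀ _ hη0, neg_mul, neg_add_cancel, exp_zero, mul_one]
  -- A zero multiplier forces the zero solution, which has the required form with zero coefficients
  -- at any regular ζ.
  · push Not at hB0
    obtain ⟨a, ha⟩ := hB0
    obtain ⟨ζ, hζ⟩ : ∃ ζ, Regular L η ζ := ((exists_coordU_eq hη 0).imp fun _ h => h.1)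
    have hden := den_ne_zero_iff.mpr hζ
    rw [den, mul_ne_zero_iff] at hden
    refine ⟨ζ, exp 0, hζ, exp_ne_zero _, hasForm_of_interp hη0
      (exp_log (div_ne_zero hden.2 hden.1)) (c := 0) fun m z hz => ?_⟩
    have := (hg.theta m).add_per a (z - per L a)
    rw [sub_add_cancel, ha, mul_zero, zero_mul, zero_mul] at this
    rw [hψg m z hz, this]
    simp [interp]

/-! ### Admissible pairs -/

theorem exists_interp_ne_zero {s b : ℂ} (hs : s ∉ L.lattice) {y : Fin N → ℂ}
    (hy : ∀ i j, i ≠ j → y i - y j ∉ L.lattice) {c : Fin N → ℂ} (hc : c ≠ 0) :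
    ∃ z ∉ poles L y, interp L s y c z * exp (b * z) / tau L y z ≠ 0 := by
  by_contra! h
  refine hc (interp_injective hs hy (eq_of_eq_off_countable
    (isTheta_interp s y c).differentiable.continuous continuous_const
    (countable_poles (L := L) y) fun z hz => ?_))
  have hτ : tau L y z ≠ 0 := fun h => hz (tau_eq_zero_iff.mp h)
  simpa [hτ, exp_ne_zero] using h z hz

theorem Admissible.det_eq_zero (hx : Generic L η x) (hη : η ∉ L.lattice) (hlam : lam ≠ 0)
    (he : EquationsOfMotion L η x) {ζ k : ℂ} (h : Admissible L η lam x ζ k) :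
    (Matrix.scalar (Fin N) (k ^ 2 * den L η ζ) - laxMatrix L η lam x 0 ζ ^ 2).det = 0 := by
  have hη0 : η ≠ 0 := by rintro rfl; exact hη (zero_mem _)
  obtain ⟨hreg, B, ψ, hψ, ⟨m, z, hz, hmz⟩, ℓ, κ, c, hℓ, rfl, hc⟩ := h
  obtain ⟨g, hg, hgψ⟩ := hψ.exists_bilinear
  set d : ℤ → Fin N → ℂ := fun m i => c m i * exp (-(ℓ * x m i / (2 * η))) with hd
  set b := (ℓ / 2 + κ) / η with hb
  have hψd : ∀ m, ∀ z ∉ poles L (x m), ψ m z =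
      interp L (ζ + η) (x m) (d m) z * exp (b * z) / tau L (x m) z := fun m z hz => by
    rw [hc m z hz, sum_Phi hη0 _ _ hz]
  have hgd : ∀ m z, g m z = interp L (ζ + η) (x m) (d m) z * exp (b * z) := by
    intro m
    have h1 := (hg.theta m).differentiable.continuous
    have h2 := (isTheta_interp (L := L) (ζ + η) (x m) (d m)).differentiable.continuous
    refine eq_of_eq_off_countable h1 (by fun_prop) (countable_poles (L := L) (x m)) fun z hz => ?_
    rw [hgψ m z hz, hψd m z hz, mul_div_cancel₀ _ fun h => hz (tau_eq_zero_iff.mp h)]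
  have heig := hg.laxMatrix_mulVec hx hη hreg.2 hgd m
  have hdm : d m ≠ 0 := by
    intro h0
    rw [hψd m z hz, h0] at hmz
    simp [interp] at hmz
  have hdet := (exists_eigenvector_iff _ _).mp ⟨d m, hdm, heig⟩
  rw [add_sub_cancel_right, charpoly_laxMatrix hx hη hlam he] at hdet
  have hσ : sigma L (ζ + η) ≠ 0 := sigma_ne_zero L hreg.2
  -- Squaring removes the half logarithm: exp(ℓ) σ(ζ + η)² = σ(ζ − η) σ(ζ + η).
  have hν : exp κ ^ 2 * den L η ζ = (exp (b * η) * sigma L (ζ + η)) ^ 2 := by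
    rw [hb, div_mul_cancel₀ _ hη0, mul_pow, ← exp_nat_mul, ← exp_nat_mul,
      show ((2 : ℕ) : ℂ) * (ℓ / 2 + κ) = ℓ + (2 : ℕ) * κ by push_cast; ring, exp_add, hℓ, den]
    field_simp
  rw [hν, det_scalar_sq_sub_sq, hdet, zero_mul, zero_mul]

theorem admissible_of_det_eq_zero (hx : Generic L η x) (hη : η ∉ L.lattice) (hlam : lam ≠ 0)
    (he : EquationsOfMotion L η x) {ζ k : ℂ} (hreg : Regular L η ζ) (hk : k ≠ 0)
    (hgen : ∀ m, ζ + η + ∑ i, (x (m + 1) i - x m i) ∉ L.lattice)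
    (h : (Matrix.scalar (Fin N) (k ^ 2 * den L η ζ) - laxMatrix L η lam x 0 ζ ^ 2).det = 0) :
    Admissible L η lam x ζ k := by
  have hη0 : η ≠ 0 := by rintro rfl; exact hη (zero_mem _)
  have hden := den_ne_zero_iff.mpr hreg
  rw [den, mul_ne_zero_iff] at hden
  set ℓ := log (sigma L (ζ - η) / sigma L (ζ + η)) with hℓ
  have hexp : exp ℓ = sigma L (ζ - η) / sigma L (ζ + η) := exp_log (div_ne_zero hden.2 hden.1)
  set ν := exp (ℓ / 2 + log k) * sigma L (ζ + η) with hν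
  have hν2 : k ^ 2 * den L η ζ = ν ^ 2 := by
    rw [hν, mul_pow, ← exp_nat_mul,
      show ((2 : ℕ) : ℂ) * (ℓ / 2 + log k) = ℓ + (2 : ℕ) * log k by push_cast; ring, exp_add,
      hexp, exp_nat_mul, exp_log hk, den]
    field_simp [hden.1]
  rw [hν2, det_scalar_sq_sub_sq, mul_eq_zero, mul_eq_zero,
    or_iff_left (pow_ne_zero N (by norm_num : (-1 : ℂ) ≠ 0))] at h
  -- If −ν rather than ν is the eigenvalue, replacing ℓ by ℓ + 2πi flips the sign of exp(ℓ/2) and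
  -- leaves k unchanged.
  obtain ⟨ℓ', hℓ', hdet⟩ : ∃ ℓ', exp ℓ' = sigma L (ζ - η) / sigma L (ζ + η) ∧
      (Matrix.scalar (Fin N) (exp (ℓ' / 2 + log k) * sigma L (ζ + η)) -
        laxMatrix L η lam x 0 ζ).det = 0 := by
    rcases h with h | h
    · exact ⟨ℓ, hexp, h⟩
    · refine ⟨ℓ + 2 * Real.pi * I, by rw [exp_add, exp_two_pi_mul_I, mul_one, hexp], ?_⟩
      rw [show (ℓ + 2 * Real.pi * I) / 2 + log k = ℓ / 2 + log k + Real.pi * I by ring, exp_add,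
        exp_pi_mul_I, mul_neg_one, neg_mul]
      exact h
  obtain ⟨v, hv, heig⟩ := (exists_eigenvector_iff _ _).mpr hdet
  set b := (ℓ' / 2 + log k) / η with hb
  have hbη : ℓ' / 2 + log k = b * η := (div_mul_cancel₀ _ hη0).symm
  rw [hbη, ← add_sub_cancel_right ζ η] at heig
  rw [sub_add_cancel] at heig
  obtain ⟨c, hc, hg⟩ := exists_solution_of_eigenvector hx hη hlam he hreg.2 hgen hv heig
  refine ⟨hreg, _, _, hg.isDoubleBlochSolution hx, ⟨0, ?_⟩, ?_⟩
  · exact exists_interp_ne_zero hreg.2 (hx.distinct 0) (hc 0)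
  · rw [← exp_log hk]
    exact hasForm_of_interp hη0 hℓ' (c := c) fun m z _ => rfl

/-! ### Infinitely many solutions -/

/-- Any eigenvalue at time 0 will do: being nonzero, it has the form exp(bη) σ(s) for a suitable b.
-/
theorem exists_solution_of_class (hx : Generic L η x) (hη : η ∉ L.lattice) (hlam : lam ≠ 0)
    (hN : 0 < N) (he : EquationsOfMotion L η x) {s : ℂ} (hs : s ∉ L.lattice)
    (hgen : ∀ m, s + ∑ i, (x (m + 1) i - x m i) ∉ L.lattice) (hsN : s - N * η ∉ L.lattice) :
    ∃ b g, IsBilinearSolution L η lam x (fun a => exp (qper L a * s + b * per L a)) g ∧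
      ∀ m, ∃ z, g m z ≠ 0 := by
  have hη0 : η ≠ 0 := by rintro rfl; exact hη (zero_mem _)
  have hσ := sigma_ne_zero L hs
  have : Nonempty (Fin N) := ⟨⟨0, hN⟩⟩
  obtain ⟨ν, hν⟩ := Module.End.exists_eigenvalue (Matrix.toLin' (laxMatrix L η lam x 0 (s - η)))
  obtain ⟨v, hv⟩ := hν.exists_hasEigenvector
  have hv0 := hv.2
  have heig : (laxMatrix L η lam x 0 (s - η)).mulVec v = ν • v := hv.apply_eq_smul
  have hν0 : ν ≠ 0 := by
    rintro rfl
    rw [zero_smul] at heig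
    exact laxMatrix_det_ne_zero (lam := lam) hx hη hlam hs 0 hsN
      (Matrix.exists_mulVec_eq_zero_iff.mp ⟨v, hv0, heig⟩)
  obtain ⟨c, hc, hg⟩ := exists_solution_of_eigenvector (b := log (ν / sigma L s) / η) hx hη hlam he
    hs hgen hv0 (by
      rw [div_mul_cancel₀ _ hη0, exp_log (div_ne_zero hν0 hσ), div_mul_cancel₀ _ hσ, heig])
  refine ⟨_, _, hg, fun m => ?_⟩
  obtain ⟨z, -, hz⟩ := exists_interp_ne_zero (b := log (ν / sigma L s) / η) hs (hx.distinct m) (hc m)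
  exact ⟨z, fun h => hz (by rw [h, zero_div])⟩

/-- At each stage only countably many values of s are forbidden. -/
theorem exists_seq_classes (N : ℕ) (η : ℂ) (t : ℤ → ℂ) :
    ∃ s : ℕ → ℂ, (∀ n, s n ∉ L.lattice ∧ (∀ m, s n + t m ∉ L.lattice) ∧ s n - N * η ∉ L.lattice) ∧
      ∀ n n', n < n' → s n' - s n ∉ L.lattice := by
  refine exists_seq_of_forall_finset_exists
    (fun s => s ∉ L.lattice ∧ (∀ m, s + t m ∉ L.lattice) ∧ s - N * η ∉ L.lattice) (fun s s' => s' - s ∉ L.lattice) fun S _ => ?_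
  have hcount : ∀ t : ℂ, {ζ | ζ + t ∈ L.lattice}.Countable := fun t =>
    (countable_lattice L).preimage_of_injOn (f := fun z => z + t) (add_left_injective t).injOn
  have hbad := (((hcount 0).union (Set.countable_iUnion fun m => hcount (t m))).union
    (hcount (-(N * η)))).union (S.countable_toSet.biUnion fun s _ => hcount (-s))
  obtain ⟨s, hs⟩ := (hbad.dense_compl ℝ).nonempty
  simp only [Set.mem_compl_iff, Set.mem_union, Set.mem_iUnion, Set.mem_ofPred_eq, not_or,
    not_exists, add_zero, ← sub_eq_add_neg] at hs
  exact ⟨s, ⟨hs.1.1.1, hs.1.1.2, hs.1.2⟩, fun w hw => hs.2 w hw⟩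

/-- Functions with different multipliers are linearly independent. -/
theorem linearIndependent_of_multipliers {y : Fin N → ℂ} {A : ℕ → Fin 2 → ℂ} {g : ℕ → ℂ → ℂ}
    (hg : ∀ n, IsTheta L N (fun a => tauMul L y a * A n a) (g n)) (hA : Function.Injective A)
    (h0 : ∀ n, ∃ z, g n z ≠ 0) :
    LinearIndependent ℂ (fun n (z : ((poles L y)ᶜ : Set ℂ)) => g n z / tau L y z) := by
  rw [linearIndependent_iff']
  intro S c hc n₀ hn₀
  have hsum : ∀ z, ∑ n ∈ S, c n * g n z = 0 := by
    have hcont : Continuous fun z => ∑ n ∈ S, c n * g n z :=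
      continuous_finsetSum _ fun n _ => continuous_const.mul (hg n).differentiable.continuous
    refine eq_of_eq_off_countable hcont continuous_const (countable_poles (L := L) y) fun z hz => ?_
    have h := congrFun hc ⟨z, hz⟩
    simp only [Finset.sum_apply, Pi.smul_apply, smul_eq_mul, Pi.zero_apply, mul_div_assoc',
      ← Finset.sum_div] at h
    exact (div_eq_zero_iff.mp h).resolve_right fun h => hz (tau_eq_zero_iff.mp h)
  have hstep : ∀ a (c : ℕ → ℂ), (∀ z, ∑ n ∈ S, c n * g n z = 0) →
      ∀ z, ∑ n ∈ S, c n * A n a * g n z = 0 := by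
    intro a c hc z
    apply mul_left_cancel₀ (mul_ne_zero (tauMul_ne_zero (L := L) y a)
      (exp_ne_zero (N * qper L a * z)))
    rw [mul_zero, Finset.mul_sum]
    refine Eq.trans (Finset.sum_congr rfl fun n _ => ?_) (hc (z + per L a))
    rw [(hg n).add_per]
    ring
  -- Translation by a period multiplies coefficients by the multipliers. Separating first by one
  -- multiplier and then by the other isolates the single index n₀.
  have h1 := exists_relation_of_eigen S c (fun n => A n 0) g (hstep 0) hsum n₀
  have h2 := exists_relation_of_eigen S _ (fun n => A n 1) g (hstep 1) h1 n₀
  obtain ⟨z, hz⟩ := h0 n₀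
  have h3 := h2 z
  rw [Finset.sum_eq_single_of_mem n₀ hn₀] at h3
  · simpa [hz] using h3
  · intro n _ hn
    have : ¬ (A n 1 = A n₀ 1 ∧ A n 0 = A n₀ 0) := fun h => hn (hA (funext fun a => by
      fin_cases a
      · exact h.2
      · exact h.1))
    rw [← ite_and, if_neg this, zero_mul]

theorem exists_infinitely_many_solutions (hx : Generic L η x) (hη : η ∉ L.lattice)
    (hlam : lam ≠ 0) (hN : 0 < N) (he : EquationsOfMotion L η x) :
    ∃ (A : ℕ → ℂ × ℂ) (ψ : ℕ → ℤ → ℂ → ℂ),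
      (∀ n, IsDoubleBlochSolution L η lam x (A n) (ψ n)) ∧
      (∀ n n', n ≠ n' → ¬ EquivMultipliers L (A n) (A n')) ∧
      (∀ m, LinearIndependent ℂ
        (fun n (z : ((poles L (x m))ᶜ : Set ℂ)) => ψ n m z)) := by
  obtain ⟨s, hs, hss⟩ := exists_seq_classes (L := L) N η fun m => ∑ i, (x (m + 1) i - x m i)
  choose b g hg hg0 using fun n =>
    exists_solution_of_class hx hη hlam hN he (hs n).1 (hs n).2.1 (hs n).2.2
  set A : ℕ → Fin 2 → ℂ := fun n a => exp (qper L a * s n + b n * per L a) with hA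
  have hclass : ∀ n n' t, n ≠ n' → ¬ ∀ a, A n' a = A n a * exp (t * per L a) := by
    intro n n' t hn h
    have hmem : s n' - s n ∈ L.lattice := mem_lattice_of_class_trivial (L := L)
      (b := b n' - b n - t) fun a => by
        have h := h a
        simp only [hA, ← exp_add] at h
        rw [show qper L a * (s n' - s n) + (b n' - b n - t) * per L a =
          (qper L a * s n' + b n' * per L a) - (qper L a * s n + b n * per L a + t * per L a) by
          ring, exp_sub, h, div_self (exp_ne_zero _)]
    rcases hn.lt_or_gt with h | h
    · exact hss _ _ h hmem
    · exact hss _ _ h (by rw [← neg_mem_iff, neg_sub]; exact hmem)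
  refine ⟨fun n => (A n 0, A n 1), fun n m z => g n m z / tau L (x m) z,
    fun n => (hg n).isDoubleBlochSolution hx, fun n n' hn => ?_, fun m => ?_⟩
  · rintro ⟨t, h0, h1⟩
    refine hclass n n' t hn fun a => ?_
    fin_cases a
    · exact h0
    · exact h1
  · refine linearIndependent_of_multipliers (fun n => (hg n).theta m) (fun n n' h => ?_)
      fun n => hg0 n m
    by_contra hn
    refine hclass n n' 0 hn fun a => ?_
    rw [zero_mul, exp_zero, mul_one]
    exact (congrFun h a).symm

end

end EllipticHirota

end

/-! ### Assembly: on regular ζ the factor `den`^N is nonzero, so P = 0 is equivalent to the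
determinant condition. -/

theorem theorem3p2 (L : PeriodPair) (η lam : ℂ) (hη : η ∉ L.lattice) (hlam : lam ≠ 0)
    (N : ℕ) (hN : 0 < N) (x : ℤ → Fin N → ℂ) (hx : EllipticHirota.Generic L η x)
    (B : Fin N → ℂ × ℂ) (Ψ : Fin N → ℤ → ℂ → ℂ)
    (hΨ : ∀ r, EllipticHirota.IsDoubleBlochSolution L η lam x (B r) (Ψ r))
    (hB : ∀ r s, EllipticHirota.EquivMultipliers L (B r) (B s))
    (hind : ∀ m, EllipticHirota.PeriodicIndependent L η (x m) (fun r => Ψ r m)) :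
    -- infinitely many solutions, with pairwise inequivalent multipliers, linearly independent
    (∃ (A : ℕ → ℂ × ℂ) (ψ : ℕ → ℤ → ℂ → ℂ),
      (∀ n, EllipticHirota.IsDoubleBlochSolution L η lam x (A n) (ψ n)) ∧
      (∀ n n', n ≠ n' → ¬ EllipticHirota.EquivMultipliers L (A n) (A n')) ∧
      (∀ m, LinearIndependent ℂ
        (fun n (z : ((EllipticHirota.poles L (x m))ᶜ : Set ℂ)) => ψ n m z))) ∧
    -- the form of all solutions
    (∀ (A : ℂ × ℂ) (ψ : ℤ → ℂ → ℂ),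
      EllipticHirota.IsDoubleBlochSolution L η lam x A ψ →
      ¬ EllipticHirota.EquivMultipliers L (1, 1) A →
      ¬ EllipticHirota.EquivMultipliers L
        (Complex.exp (4 * η * EllipticHirota.zetaW L (L.ω₁ / 2)),
          Complex.exp (4 * η * EllipticHirota.zetaW L (L.ω₂ / 2))) A →
      ∃ ζ k : ℂ, EllipticHirota.Regular L η ζ ∧ k ≠ 0 ∧ EllipticHirota.HasForm L η x ζ k ψ) ∧
    -- the pairs `(ζ, k)` are parametrized by the points of an algebraic curve
    (∃ (q : Polynomial ℂ) (P : Polynomial (MvPolynomial (Fin 2) ℂ)),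
      Squarefree q ∧ (q.natDegree = 3 ∨ q.natDegree = 4) ∧
      P.Monic ∧ P.natDegree = 2 * N ∧
      (∀ u v : ℂ, v ^ 2 = q.eval u ↔
        ∃ ζ, EllipticHirota.Regular L η ζ ∧
          EllipticHirota.coordU L η ζ = u ∧ EllipticHirota.coordV L η ζ = v) ∧
      (∀ ζ ζ' : ℂ, EllipticHirota.Regular L η ζ → EllipticHirota.Regular L η ζ' →
        ((EllipticHirota.coordU L η ζ = EllipticHirota.coordU L η ζ' ∧
          EllipticHirota.coordV L η ζ = EllipticHirota.coordV L η ζ') ↔ ζ - ζ' ∈ L.lattice)) ∧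
      (∀ ζ k : ℂ, EllipticHirota.Admissible L η lam x ζ k → k ≠ 0 ∧
        (EllipticHirota.coordU L η ζ, EllipticHirota.coordV L η ζ, k) ∈
          EllipticHirota.coveringCurve q P) ∧
      (∀ ζ k : ℂ, EllipticHirota.Regular L η ζ → k ≠ 0 →
        (∀ m, ζ + η + ∑ i, (x (m + 1) i - x m i) ∉ L.lattice) →
        (EllipticHirota.coordU L η ζ, EllipticHirota.coordV L η ζ, k) ∈
          EllipticHirota.coveringCurve q P →
        EllipticHirota.Admissible L η lam x ζ k)) := by
  have he := EllipticHirota.equationsOfMotion hx hη hlam hN hΨ hB hind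
  obtain ⟨q, hq, hdeg, hqe⟩ := EllipticHirota.exists_curve hη
  obtain ⟨P, hP, hPdeg, hPe⟩ :=
    EllipticHirota.exists_spectralPolynomial (lam := lam) (x := x) hη
  refine ⟨EllipticHirota.exists_infinitely_many_solutions hx hη hlam hN he,
    fun A ψ hψ h1 h2 => EllipticHirota.exists_hasForm hx hη hψ h1 h2,
    q, P, hq, hdeg, hP, hPdeg, EllipticHirota.curve_surjective hη hqe,
    fun ζ ζ' hζ hζ' => EllipticHirota.curve_bijective hη hζ hζ', fun ζ k h => ?_,
    fun ζ k hζ hk hgen h => ?_⟩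
  · have hk : k ≠ 0 := by
      obtain ⟨-, B, ψ, -, -, ℓ, κ, c, -, rfl, -⟩ := h
      exact Complex.exp_ne_zero κ
    refine ⟨hk, hqe ζ h.1, ?_⟩
    have hdet := h.det_eq_zero hx hη hlam he
    rw [← hPe ζ k h.1] at hdet
    exact (mul_eq_zero.mp hdet).resolve_left
      (pow_ne_zero N (EllipticHirota.den_ne_zero_iff.mpr h.1))
  · refine EllipticHirota.admissible_of_det_eq_zero hx hη hlam he hζ hk hgen ?_
    rw [← hPe ζ k hζ, h.2, mul_zero]
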